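/- **Theorem 4.** For every $i\in\{1,2,3,\dots\}\cup\{\infty\}$, the model of deterministic $\{1\}$-weighted graphings in the microcosm $\mathfrak m_i$ characterises the class of languages over $\{0,1\}$ accepted by deterministic two-way multihead finite automata with at most $i$ heads (any finite number of heads if $i=\infty$). Moreover the model for $\mathfrak m_1$ characterises the regular languages, and the model for $\mathfrak m_\infty$ characterises the languages recognised by deterministic Turing machines in logarithmic space. The notions are the following. *Space and microcosms.* $X=\mathbb Z\times[0,1]^{\mathbb N}$ carries the product of the counting measure and Lebesgue measure. $\mathfrak m_1$ is the monoid of the translations $(n,x)\mapsto(n+k,x)$, $k\in\mathbb Z$; $\mathfrak m_{i+1}$ is the monoid generated by $\mathfrak m_i$ and the map exchanging the coordinates $x_1$ and $x_{i+1}$; $\mathfrak m_\infty=\bigcup_i\mathfrak m_i$. *Graphings.* A $\{1\}$-weighted graphing with set of states $D$ and carrier a measurable set $V\subseteq X$ is a countable family of edges; an edge $e$ has a measurable source $S_e\subseteq V$, a source state and a target state in $D$, and a measurable realisation $\phi_e$ with $\phi_e(S_e)\subseteq V$. It is in a microcosm $\mathfrak m$ if all $\phi_e\in\mathfrak m$ and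 all $\phi_e(S_e)$ are measurable. It is deterministic if, in each state, the set of points that lie in the sources of two distinct edges is null. The execution $F\mathbin{::}G$ is the graphing on the symmetric difference of the carriers, with pairs of states, whose edges are the alternating paths of edges of $F$ and of $G$, restricted to the points at which the path both starts and ends outside of the intersection of the carriers. *Words.* Fix eight distinct segments $\{n\}\times[0,1]^{\mathbb N}$, $n\in\mathbb Z$, called $(a,\mathrm{in})$ and $(a,\mathrm{out})$ for $a\in\{\star,0,1\}$, "accept" and "reject". Let $w=w_1\cdots w_n$, $a_0=\star$, $a_j=w_j$, with indices modulo $N=n+1$. Each isomorphism modulo null sets $\theta$ of $\{0,\dots,N-1\}\times[0,1]$ (with normalised measure) onto $[0,1]$, for instance $\theta(j,u)=(j+u)/N$, defines a representation $W_\theta$ of $w$: the (one-state) graphing on the six word segments which, for every $j$, has an edge sending the points of $(a_j,\mathrm{out})$ whose first coordinate is $\theta(j,u)$ to the points of $(a_{j+1},\mathrm{in})$ whose first coordinate is $\theta(j+1,u)$, the other coordinates being unchanged, and an edge in the opposite direction. The number $j$ is the address of $\theta(j,u)$. *Programs.* A program $P$ in $\mathfrak m$ is a deterministic graphing in $\mathfrak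 m$ on the eight segments, with a finite set of states, using only finitely many elements of $\mathfrak m$ as realisations, together with an initial state $d_0$ and a number $h$ of heads. We say that $P\mathbin{::}W_\theta$ is $\mathtt{true}$ (respectively $\mathtt{false}$) if for almost every $x\in[0,1]^{\mathbb N}$ whose first $h$ coordinates all have the address $0$ (that of $\star$), $P\mathbin{::}W_\theta$ has an edge (respectively has no edge) sending the point $x$ of "accept", in the state $d_0$, to a point of "accept", in the state $d_0$. $P$ has type $!\mathrm{List}\multimap\mathrm{Bool}$ if for every word $w$, either $P\mathbin{::}W_\theta$ is $\mathtt{true}$ for all $\theta$, or it is $\mathtt{false}$ for all $\theta$. Its language $[P]$ is the set of the words $w$ for which $P\mathbin{::}W_\theta$ is $\mathtt{true}$. The model of deterministic $\{1\}$-weighted graphings in $\mathfrak m$ *characterises* a class $\mathcal L$ of languages if $\{[P] : P \text{ a program in } \mathfrak m \text{ of type } !\mathrm{List}\multimap\mathrm{Bool}\}=\mathcal L$. -/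

import Mathlib

open MeasureTheory

/-! ### The measure space and the microcosms -/

/-- The Hilbert cube `[0,1]^ℕ`; its coordinates are indexed from `0`. -/
abbrev Cube : Type := ℕ → unitInterval

/-- Lebesgue measure on the Hilbert cube. -/
noncomputable def cubeMeasure : Measure Cube :=
  Measure.infinitePi (fun _ : ℕ => (volume : Measure unitInterval))

/-- The space `ℤ × [0,1]^ℕ`. -/
abbrev Pt : Type := ℤ × Cube

/-- Counting measure on `ℤ` times Lebesgue measure on the Hilbert cube. -/
noncomputable def ptMeasure : Measure Pt := Measure.count.prod cubeMeasure

instance : IsProbabilityMeasure cubeMeasure := by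
  unfold cubeMeasure; infer_instance

/-- Non-singular transformations: measurable maps `f` such that `f(A)` is null iff `A` is. -/
def NonSingular (f : Pt → Pt) : Prop :=
  Measurable f ∧ ∀ A : Set Pt, ptMeasure (f '' A) = 0 ↔ ptMeasure A = 0

/-- A microcosm: a set of non-singular transformations closed under composition and
containing the identity (multiplication in `Function.End` is composition). -/
structure Microcosm where
  maps : Submonoid (Function.End Pt)
  nonSingular : ∀ f ∈ maps, NonSingular f

/-- The translation `(n, x) ↦ (n + k, x)`. -/
def translation (k : ℤ) : Function.End Pt := fun p => (p.1 + k, p.2)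

/-- The map exchanging the coordinates of index `0` and `j` of the cube. -/
def headSwap (j : ℕ) : Function.End Pt := fun p => (p.1, fun a => p.2 (Equiv.swap 0 j a))

/-- The monoid of all translations. -/
def translations : Submonoid (Function.End Pt) where
  carrier := Set.range translation
  one_mem' := ⟨0, funext fun p => Prod.ext (add_zero p.1) rfl⟩
  mul_mem' := by
    rintro _ _ ⟨k, rfl⟩ ⟨l, rfl⟩
    exact ⟨l + k, funext fun p => Prod.ext (add_assoc p.1 l k).symm rfl⟩

/-- The monoids of maps with `i` heads, for finite `i`: the translations for `i = 1`, and for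
`i + 1` the smallest monoid that contains the one for `i` and the exchange of the first and the
`(i + 1)`-st coordinate (which is the identity when `i = 0`). -/
def headMaps : ℕ → Submonoid (Function.End Pt)
  | 0 => translations
  | i + 1 => headMaps i ⊔ Submonoid.closure {headSwap i}

/-- The same for `i ∈ ℕ ∪ {∞}`: for `∞` the union of the increasing sequence `headMaps`. -/
def headMapsTop (i : ℕ∞) : Submonoid (Function.End Pt) :=
  ENat.recTopCoe (C := fun _ => Submonoid (Function.End Pt)) (⨆ n, headMaps n) headMaps i

/-- The non-singular transformations form a monoid. -/
def nonSingularMaps : Submonoid (Function.End Pt) where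
  carrier := {f | NonSingular f}
  one_mem' := ⟨measurable_id, fun A => by
    rw [show ((1 : Function.End Pt) '' A) = A from Set.image_id A]⟩
  mul_mem' := by
    rintro f g ⟨hf, hf'⟩ ⟨hg, hg'⟩
    refine ⟨hf.comp hg, fun A => ?_⟩
    rw [show ((f * g : Function.End Pt) '' A) = f '' (g '' A) from Set.image_comp f g A]
    exact (hf' _).trans (hg' A)

theorem nonSingular_of_inverse {f g : Pt → Pt} (hf : Measurable f)
    (hg : MeasurePreserving g ptMeasure ptMeasure) (e : Pt ≃ᵐ Pt) (he : ⇑e = f)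
    (he' : ⇑e.symm = g) : NonSingular f := by
  refine ⟨hf, fun A => ?_⟩
  subst he he'
  rw [MeasurableEquiv.image_eq_preimage_symm, hg.measure_preimage_equiv]

theorem measurable_translation (k : ℤ) : Measurable (translation k) := by
  unfold translation
  have h : Measurable fun n : ℤ => n + k := measurable_of_countable _
  exact (h.comp measurable_fst).prodMk measurable_snd

theorem measurable_headSwap (j : ℕ) : Measurable (headSwap j) := by
  unfold headSwap
  refine Measurable.prodMk measurable_fst (measurable_pi_lambda _ fun a => ?_)
  exact (measurable_pi_apply _).comp measurable_snd

theorem measurePreserving_translation (k : ℤ) :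
    MeasurePreserving (translation k) ptMeasure ptMeasure := by
  have h1 : MeasurePreserving (fun n : ℤ => n + k) Measure.count Measure.count :=
    measurePreserving_add_right _ k
  exact h1.prod (MeasurePreserving.id cubeMeasure)

theorem measurePreserving_headSwap (j : ℕ) :
    MeasurePreserving (headSwap j) ptMeasure ptMeasure := by
  have h2 : MeasurePreserving (fun (x : Cube) a => x (Equiv.swap 0 j a))
      cubeMeasure cubeMeasure := by
    refine ⟨measurable_pi_lambda _ fun a => measurable_pi_apply _, ?_⟩
    have h := Measure.infinitePi_map_piCongrLeft
      (fun _ : ℕ => (volume : Measure unitInterval)) (Equiv.swap 0 j)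
    have hf : (fun (x : Cube) a => x (Equiv.swap 0 j a)) =
        MeasurableEquiv.piCongrLeft (fun _ : ℕ => unitInterval) (Equiv.swap 0 j) := by
      funext x a
      have h1 := Equiv.piCongrLeft_apply_apply (fun _ : ℕ => unitInterval) (Equiv.swap 0 j) x
        (Equiv.swap 0 j a)
      rw [Equiv.swap_apply_self] at h1
      exact h1.symm
    rw [hf]
    exact h
  exact (MeasurePreserving.id (Measure.count : Measure ℤ)).prod h2

theorem translation_mem_nonSingularMaps (k : ℤ) : translation k ∈ nonSingularMaps :=
  nonSingular_of_inverse (measurable_translation k) (measurePreserving_translation (-k))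
    { toFun := translation k
      invFun := translation (-k)
      left_inv := fun p => by simp [translation]
      right_inv := fun p => by simp [translation]
      measurable_toFun := measurable_translation k
      measurable_invFun := measurable_translation (-k) } rfl rfl

theorem headSwap_mem_nonSingularMaps (j : ℕ) : headSwap j ∈ nonSingularMaps :=
  nonSingular_of_inverse (measurable_headSwap j) (measurePreserving_headSwap j)
    { toFun := headSwap j
      invFun := headSwap j
      left_inv := fun p => by simp [headSwap]
      right_inv := fun p => by simp [headSwap]
      measurable_toFun := measurable_headSwap j
      measurable_invFun := measurable_headSwap j } rfl rfl

theorem headMaps_le (i : ℕ) : headMaps i ≤ nonSingularMaps := by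
  induction i with
  | zero =>
    rintro _ ⟨k, rfl⟩
    exact translation_mem_nonSingularMaps k
  | succ i ih =>
    refine sup_le ih ?_
    rw [Submonoid.closure_le]
    rintro _ rfl
    exact headSwap_mem_nonSingularMaps i

theorem headMapsTop_le (i : ℕ∞) : headMapsTop i ≤ nonSingularMaps := by
  induction i using ENat.recTopCoe with
  | top => exact iSup_le headMaps_le
  | coe n => exact headMaps_le n

/-- The microcosm `𝔪_i`, for `i ∈ {1, 2, …} ∪ {∞}`. -/
def headMicrocosm (i : ℕ∞) : Microcosm where
  maps := headMapsTop i
  nonSingular := fun _ hf => headMapsTop_le i hf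

/-! ### Graphings with states, and their execution -/

/-- A weightless (that is, `{1}`-weighted) graphing over `ℤ × [0,1]^ℕ` with set of states `D`:
a countable family of partial maps of `carrier × D`. The edge `e` goes from the points of `src e`
in the state `dom e` to their images under `real e` in the state `cod e`. -/
structure Graphing (D : Type) where
  carrier : Set Pt
  measurableSet_carrier : MeasurableSet carrier
  E : Type
  countable_E : Countable E
  dom : E → D
  cod : E → D
  src : E → Set Pt
  measurableSet_src : ∀ e, MeasurableSet (src e)
  src_subset : ∀ e, src e ⊆ carrier
  real : E → Pt → Pt
  measurable_real : ∀ e, Measurable (real e)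
  mapsTo : ∀ e, Set.MapsTo (real e) (src e) carrier

namespace Graphing

variable {D D' : Type}

/-- `G` is a graphing in the microcosm `m`: every edge is realised by an element of `m`, and the
targets of the edges are measurable. -/
def IsIn (G : Graphing D) (m : Microcosm) : Prop :=
  ∀ e, G.real e ∈ m.maps ∧ MeasurableSet (G.real e '' G.src e)

/-- Deterministic graphings: in each state, the points that lie in the sources of two distinct
edges form a null set. -/
def IsDeterministic (G : Graphing D) : Prop :=
  ∀ d, ptMeasure {p | ∃ e e', e ≠ e' ∧ G.dom e = d ∧ G.dom e' = d ∧ p ∈ G.src e ∩ G.src e'} = 0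

variable (F : Graphing D) (G : Graphing D')

/-- The map realising a path, i.e. a list of edges of two graphings (first edge first). -/
def pathReal : List (F.E ⊕ G.E) → Pt → Pt
  | [], p => p
  | .inl e :: π, p => pathReal π (F.real e p)
  | .inr e :: π, p => pathReal π (G.real e p)

/-- The final state of a path that is started in a given pair of states. -/
def pathCod : List (F.E ⊕ G.E) → D × D' → D × D'
  | [], s => s
  | .inl e :: π, s => pathCod π (F.cod e, s.2)
  | .inr e :: π, s => pathCod π (s.1, G.cod e)

/-- The set of points from which a path can be followed, starting in a given pair of states. -/
def pathSrc : List (F.E ⊕ G.E) → D × D' → Set Pt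
  | [], _ => Set.univ
  | .inl e :: π, s =>
      {p | F.dom e = s.1 ∧ p ∈ F.src e ∧ F.real e p ∈ pathSrc π (F.cod e, s.2)}
  | .inr e :: π, s =>
      {p | G.dom e = s.2 ∧ p ∈ G.src e ∧ G.real e p ∈ pathSrc π (s.1, G.cod e)}

/-- Non-empty paths that alternate between edges of `F` and edges of `G`. -/
def IsAlternating (π : List (F.E ⊕ G.E)) : Prop :=
  π ≠ [] ∧ π.IsChain (fun a b => a.isLeft ≠ b.isLeft)

theorem measurable_pathReal (π : List (F.E ⊕ G.E)) : Measurable (pathReal F G π) := by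
  induction π with
  | nil => exact measurable_id
  | cons a π ih =>
    cases a with
    | inl e => exact ih.comp (F.measurable_real e)
    | inr e => exact ih.comp (G.measurable_real e)

theorem measurableSet_pathSrc (π : List (F.E ⊕ G.E)) (s : D × D') :
    MeasurableSet (pathSrc F G π s) := by
  induction π generalizing s with
  | nil => exact MeasurableSet.univ
  | cons a π ih =>
    cases a with
    | inl e =>
      exact (MeasurableSet.const _).inter
        ((F.measurableSet_src e).inter (F.measurable_real e (ih _)))
    | inr e =>
      exact (MeasurableSet.const _).inter
        ((G.measurableSet_src e).inter (G.measurable_real e (ih _)))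

theorem mem_of_pathSrc (π : List (F.E ⊕ G.E)) (hπ : π ≠ []) (s : D × D') (p : Pt)
    (hp : p ∈ pathSrc F G π s) :
    p ∈ F.carrier ∪ G.carrier ∧ pathReal F G π p ∈ F.carrier ∪ G.carrier := by
  induction π generalizing s p with
  | nil => exact absurd rfl hπ
  | cons a π ih =>
    cases a with
    | inl e =>
      obtain ⟨-, h1, h2⟩ := hp
      refine ⟨Or.inl (F.src_subset e h1), ?_⟩
      by_cases h : π = []
      · subst h
        exact Or.inl (F.mapsTo e h1)
      · exact (ih h _ _ h2).2
    | inr e =>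
      obtain ⟨-, h1, h2⟩ := hp
      refine ⟨Or.inr (G.src_subset e h1), ?_⟩
      by_cases h : π = []
      · subst h
        exact Or.inr (G.mapsTo e h1)
      · exact (ih h _ _ h2).2

/-- The execution `F ∷ G`: the graphing on the symmetric difference of the carriers whose edges
are the alternating paths, restricted to the points that start and end outside of the cut
`F.carrier ∩ G.carrier`. Its states are the pairs of states. -/
def execution [Countable D] [Countable D'] : Graphing (D × D') where
  carrier := (F.carrier ∪ G.carrier) \ (F.carrier ∩ G.carrier)
  measurableSet_carrier := (F.measurableSet_carrier.union G.measurableSet_carrier).diff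
    (F.measurableSet_carrier.inter G.measurableSet_carrier)
  E := {π : List (F.E ⊕ G.E) // IsAlternating F G π} × (D × D')
  countable_E := by
    have := F.countable_E
    have := G.countable_E
    infer_instance
  dom := fun e => e.2
  cod := fun e => pathCod F G e.1.1 e.2
  src := fun e => {p | p ∈ pathSrc F G e.1.1 e.2 ∧ p ∉ F.carrier ∩ G.carrier ∧
    pathReal F G e.1.1 p ∉ F.carrier ∩ G.carrier}
  measurableSet_src := fun e =>
    have hc := (F.measurableSet_carrier.inter G.measurableSet_carrier).compl
    (measurableSet_pathSrc F G _ _).inter (hc.inter (measurable_pathReal F G _ hc))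
  src_subset := fun e p hp => ⟨(mem_of_pathSrc F G _ e.1.2.1 _ p hp.1).1, hp.2.1⟩
  real := fun e => pathReal F G e.1.1
  measurable_real := fun e => measurable_pathReal F G _
  mapsTo := fun e p hp => ⟨(mem_of_pathSrc F G _ e.1.2.1 _ p hp.1).2, hp.2.2⟩

end Graphing

/-! ### Words -/

/-- The vertices of the type of binary words: `(a, true)` is `a`-in and `(a, false)` is `a`-out,
where the symbol `a` is `none` for `⋆` and `some b` for the letter `b`. -/
abbrev ListVertex : Type := Option Bool × Bool

/-- The integer `n` such that the vertex is realised by the segment `{n} × [0,1]^ℕ`. -/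
def ListVertex.index : ListVertex → ℤ
  | (none, true) => 0
  | (none, false) => 1
  | (some false, true) => 2
  | (some false, false) => 3
  | (some true, true) => 4
  | (some true, false) => 5

/-- The indices of the segments of the two vertices of the type of booleans. -/
def acceptIndex : ℤ := 6

/-- See `acceptIndex`. -/
def rejectIndex : ℤ := 7

/-- The segment `{n} × [0,1]^ℕ`. -/
def unitSegment (n : ℤ) : Set Pt := {p | p.1 = n}

/-- The carrier of the type of words. -/
def listSpace : Set Pt := ⋃ v : ListVertex, unitSegment v.index

/-- The carrier of the type of booleans. -/
def boolSpace : Set Pt := unitSegment acceptIndex ∪ unitSegment rejectIndex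

/-- The cyclic list of symbols `⋆ w₁ … w_n`. -/
def symbolAt (w : List Bool) : Fin (w.length + 1) → Option Bool :=
  Fin.cons none (fun j => some (w.get j))

/-- A splitting of the unit interval into `N` addresses of measure `1/N`: an isomorphism modulo
null sets of `{0, …, N-1} × [0,1]`, with its normalised measure, onto `[0,1]`. The basic example
is `point (j, u) = (j + u) / N`. -/
structure Splitting (N : ℕ) where
  point : Fin N × unitInterval → unitInterval
  locate : unitInterval → Fin N × unitInterval
  measurePreserving_point : MeasurePreserving point
    ((N : ENNReal)⁻¹ • (Measure.count : Measure (Fin N)).prod (volume : Measure unitInterval))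
    volume
  measurable_locate : Measurable locate
  locate_point : ∀ᵐ q ∂((Measure.count : Measure (Fin N)).prod (volume : Measure unitInterval)),
    locate (point q) = q

theorem measurableSet_segment (n : ℤ) : MeasurableSet (unitSegment n) :=
  measurable_fst (measurableSet_singleton n)

theorem measurableSet_listSpace : MeasurableSet listSpace :=
  MeasurableSet.iUnion fun v => measurableSet_segment v.index

/-- The map that goes to the segment `n` and to the address `j`, keeping the position inside of
the address and all coordinates but the first. -/
def Splitting.moveTo {N : ℕ} (S : Splitting N) (n : ℤ) (j : Fin N) (p : Pt) : Pt :=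
  (n, Function.update p.2 0 (S.point (j, (S.locate (p.2 0)).2)))

theorem Splitting.measurable_moveTo {N : ℕ} (S : Splitting N) (n : ℤ) (j : Fin N) :
    Measurable (S.moveTo n j) := by
  have h0 : Measurable fun p : Pt => p.2 0 := (measurable_pi_apply 0).comp measurable_snd
  have h1 : Measurable fun p : Pt => S.point (j, (S.locate (p.2 0)).2) :=
    S.measurePreserving_point.measurable.comp
      (measurable_const.prodMk (measurable_snd.comp (S.measurable_locate.comp h0)))
  refine measurable_const.prodMk (measurable_pi_lambda _ fun a => ?_)
  by_cases ha : a = 0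
  · subst ha
    simpa using h1
  · have h2 : Measurable fun p : Pt => p.2 a := (measurable_pi_apply a).comp measurable_snd
    simpa [Function.update_of_ne ha] using h2

/-- The part of the segment `n` that has the address `j`. -/
def Splitting.cell {N : ℕ} (S : Splitting N) (n : ℤ) (j : Fin N) : Set Pt :=
  {p | p.1 = n ∧ (S.locate (p.2 0)).1 = j}

theorem Splitting.measurableSet_cell {N : ℕ} (S : Splitting N) (n : ℤ) (j : Fin N) :
    MeasurableSet (S.cell n j) := by
  have h0 : Measurable fun p : Pt => (S.locate (p.2 0)).1 :=
    measurable_fst.comp (S.measurable_locate.comp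
      ((measurable_pi_apply 0).comp measurable_snd))
  exact (measurable_fst (measurableSet_singleton n)).inter (h0 (measurableSet_singleton j))

/-- The representation of the word `w` defined by a splitting into `|w| + 1` addresses. For each
position `j` of the cyclic list `⋆ w₁ … w_n` there is an edge `(j, true)` from the out-vertex of
its symbol, at the address `j`, to the in-vertex of the next symbol, at the address `j + 1`, and
an edge `(j, false)` in the opposite direction. -/
def wordGraphing (w : List Bool) (S : Splitting (w.length + 1)) : Graphing Unit where
  carrier := listSpace
  measurableSet_carrier := measurableSet_listSpace
  E := Fin (w.length + 1) × Bool
  countable_E := inferInstance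
  dom := fun _ => ()
  cod := fun _ => ()
  src := fun e => match e with
    | (j, true) => S.cell (ListVertex.index (symbolAt w j, false)) j
    | (j, false) => S.cell (ListVertex.index (symbolAt w (j + 1), true)) (j + 1)
  measurableSet_src := fun e => match e with
    | (_, true) => S.measurableSet_cell _ _
    | (_, false) => S.measurableSet_cell _ _
  src_subset := fun e => match e with
    | (_, true) => fun _ hp => Set.mem_iUnion_of_mem _ hp.1
    | (_, false) => fun _ hp => Set.mem_iUnion_of_mem _ hp.1
  real := fun e => match e with
    | (j, true) => S.moveTo (ListVertex.index (symbolAt w (j + 1), true)) (j + 1)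
    | (j, false) => S.moveTo (ListVertex.index (symbolAt w j, false)) j
  measurable_real := fun e => match e with
    | (_, true) => S.measurable_moveTo _ _
    | (_, false) => S.measurable_moveTo _ _
  mapsTo := fun e => match e with
    | (_, true) => fun _ _ => Set.mem_iUnion_of_mem _ rfl
    | (_, false) => fun _ _ => Set.mem_iUnion_of_mem _ rfl

/-! ### Programs and their languages -/

/-- A program in the microcosm `m` from words to booleans: a deterministic graphing in `m` with
finitely many states, realised by finitely many elements of `m`. The computation starts and ends
in the state `init`, and it starts with the first `heads` coordinates at the address of `⋆`. -/
structure Program (m : Microcosm) where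
  D : Type
  finite_D : Finite D
  graphing : Graphing D
  isIn : graphing.IsIn m
  isDeterministic : graphing.IsDeterministic
  carrier_eq : graphing.carrier = listSpace ∪ boolSpace
  finite_real : (Set.range graphing.real).Finite
  init : D
  heads : ℕ

namespace Program

variable {m : Microcosm} (P : Program m)

instance : Finite P.D := P.finite_D

/-- The execution of a program with a representation of a word. -/
def eval (w : List Bool) (S : Splitting (w.length + 1)) : Graphing (P.D × Unit) :=
  P.graphing.execution (wordGraphing w S)

/-- The execution has an edge, from the state `init` to itself, that sends the point of
coordinates `x` of the segment "accept" to a point of that segment. -/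
def AcceptsAt (w : List Bool) (S : Splitting (w.length + 1)) (x : Cube) : Prop :=
  ∃ e : (P.eval w S).E, (P.eval w S).dom e = (P.init, ()) ∧ (P.eval w S).cod e = (P.init, ()) ∧
    (acceptIndex, x) ∈ (P.eval w S).src e ∧
    (P.eval w S).real e (acceptIndex, x) ∈ unitSegment acceptIndex

/-- The points at which the computation starts: the heads are at the address of `⋆`. -/
def entry (w : List Bool) (S : Splitting (w.length + 1)) : Set Cube :=
  {x | ∀ a < P.heads, (S.locate (x a)).1 = 0}

/-- The execution is the boolean `true`. -/
def IsTrue (w : List Bool) (S : Splitting (w.length + 1)) : Prop :=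
  ∀ᵐ x ∂cubeMeasure, x ∈ P.entry w S → P.AcceptsAt w S x

/-- The execution is the boolean `false`. -/
def IsFalse (w : List Bool) (S : Splitting (w.length + 1)) : Prop :=
  ∀ᵐ x ∂cubeMeasure, x ∈ P.entry w S → ¬ P.AcceptsAt w S x

/-- `P` has the type `!List ⊸ Bool`: on every word its execution is a boolean, the same one for
all representations of the word. -/
def HasType : Prop :=
  ∀ w, (∀ S, P.IsTrue w S) ∨ (∀ S, P.IsFalse w S)

/-- The language accepted by a program. -/
def language : Language Bool := {w | ∀ S, P.IsTrue w S}

end Program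

/-- The model of deterministic `{1}`-weighted graphings in `m` characterises the set `𝓛`. -/
def Characterises (m : Microcosm) (𝓛 : Set (Language Bool)) : Prop :=
  {L | ∃ P : Program m, P.HasType ∧ P.language = L} = 𝓛

/-! ### Two-way multihead automata -/

/-- The symbols on an input tape `▷ w ◁`. -/
inductive TapeSymbol
  | left
  | right
  | letter (b : Bool)

/-- The symbol at a position: `▷` at `0`, the letters at `1, …, |w|`, then `◁`. -/
def readTape (w : List Bool) : ℕ → TapeSymbol
  | 0 => .left
  | p + 1 => match w[p]? with
    | some b => .letter b
    | none => .right

/-- The moves of a head. -/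
inductive Move
  | left
  | stay
  | right

/-- The new position on the input tape, whose positions are `0, …, |w| + 1`; a head does not
move beyond the endmarkers. -/
def Move.onInput (w : List Bool) : Move → ℕ → ℕ
  | .left, p => p - 1
  | .stay, p => p
  | .right, p => min (p + 1) (w.length + 1)

/-- The new position on a tape that is infinite to the right. -/
def Move.onTape : Move → ℕ → ℕ
  | .left, p => p - 1
  | .stay, p => p
  | .right, p => p + 1

/-- Deterministic two-way automata with `k` heads. -/
structure TwoWayDFA (k : ℕ) where
  Q : Type
  finite_Q : Finite Q
  start : Q
  accept : Set Q
  δ : Q → (Fin k → TapeSymbol) → Option (Q × (Fin k → Move))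

namespace TwoWayDFA

variable {k : ℕ} (M : TwoWayDFA k)

/-- The successor of a configuration, `none` when the automaton halts. -/
def next (w : List Bool) (c : M.Q × (Fin k → ℕ)) : Option (M.Q × (Fin k → ℕ)) :=
  (M.δ c.1 (fun a => readTape w (c.2 a))).map
    (fun r => (r.1, fun a => (r.2 a).onInput w (c.2 a)))

/-- The automaton, started with all heads on `▷`, halts in an accepting state. -/
def Accepts (w : List Bool) : Prop :=
  ∃ c, Relation.ReflTransGen (fun c c' => M.next w c = some c') (M.start, fun _ => 0) c ∧
    M.next w c = none ∧ c.1 ∈ M.accept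

/-- The language of the automaton. -/
def language : Language Bool := {w | M.Accepts w}

end TwoWayDFA

/-- The languages accepted by deterministic two-way multihead automata with at most `i` heads;
for `i = ∞` the number of heads is finite but arbitrary. -/
def twoWayDFAClass (i : ℕ∞) : Set (Language Bool) :=
  {L | ∃ k : ℕ, 1 ≤ k ∧ (k : ℕ∞) ≤ i ∧ ∃ M : TwoWayDFA k, M.language = L}

/-! ### Logarithmic space -/

/-- Deterministic Turing machines with a read-only two-way input tape and one work tape. -/
structure OfflineTM where
  Q : Type
  finite_Q : Finite Q
  Γ : Type
  finite_Γ : Finite Γ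
  blank : Γ
  start : Q
  accept : Set Q
  δ : Q → TapeSymbol → Γ → Option (Q × Γ × Move × Move)

namespace OfflineTM

variable (M : OfflineTM)

/-- A configuration: state, input head, contents of the work tape, work head. -/
structure Cfg where
  state : M.Q
  inputHead : ℕ
  tape : ℕ → M.Γ
  workHead : ℕ

/-- The initial configuration. -/
def initial : M.Cfg := ⟨M.start, 0, fun _ => M.blank, 0⟩

/-- The successor of a configuration, `none` when the machine halts. -/
def next (w : List Bool) (c : M.Cfg) : Option M.Cfg :=
  (M.δ c.state (readTape w c.inputHead) (c.tape c.workHead)).map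
    (fun r => ⟨r.1, r.2.2.1.onInput w c.inputHead, Function.update c.tape c.workHead r.2.1,
      r.2.2.2.onTape c.workHead⟩)

/-- Reachability from the initial configuration on the input `w`. -/
def Reaches (w : List Bool) (c : M.Cfg) : Prop :=
  Relation.ReflTransGen (fun c c' => M.next w c = some c') M.initial c

/-- The machine halts in an accepting state. -/
def Accepts (w : List Bool) : Prop :=
  ∃ c, M.Reaches w c ∧ M.next w c = none ∧ c.state ∈ M.accept

/-- On each input `w` the machine uses at most `C · (log₂ |w| + 1)` cells of the work tape. -/
def RunsInLogSpace : Prop :=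
  ∃ C : ℕ, ∀ w c, M.Reaches w c → c.workHead < C * (Nat.log 2 w.length + 1)

end OfflineTM

/-- The class of languages recognised by a Turing machine in logarithmic space. -/
def Logspace : Set (Language Bool) :=
  {L | ∃ M : OfflineTM, M.RunsInLogSpace ∧ L = {w | M.Accepts w}}

/-! A program and a word interact like a finite control with heads on a circular tape. The maps of a
microcosm only translate segments and permute coordinates, so a program edge chooses which
coordinate becomes the first one and which segment to visit, while a word edge moves the first
coordinate to a neighbouring address. Thus addresses are head positions on the cycle `⋆ w₁ … w_n`,
and the segment shows the symbol at the head that has just moved. This is the notion of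
`CircularAutomaton`: it sees only that head, and it must announce the symbol at the head that it
moves next, because an edge into the wrong segment leads nowhere.

From automata to programs (`CircularAutomaton.exists_program`), the state of the program also
records which head occupies the first coordinate. Almost every point has well-behaved addresses, and
from such a point the execution follows the automaton.

The converse (`Program.exists_circularAutomaton`) is harder, since the sources of edges are
arbitrary measurable sets and a program may react to the position inside of an address. There are
finitely many states and realisations, hence finitely many possible behaviours at a point, and one
behaviour `t` occurs on a set of positive measure. By regularity of the measure
(`exists_frequently_place_mem`), each word has a splitting with addresses so finely interleaved that
some points of this set remain in it wherever their heads are placed. From there the program acts as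
the automaton of `t`, which does not depend on the word. The type forces the same boolean for all
splittings, so this automaton recognises the language.

Circular and two-way automata with the same number of heads simulate each other
(`CircularAutomaton.exists_twoWayDFA`, `TwoWayDFA.accepts_toCircular`). With one head, the
excursions into a prefix have finitely many outcomes, so there are finitely many left quotients
(`TwoWayDFA.isRegular_language`). With any number of heads, positions are written in binary on a
work tape (`twoWayDFAClass_subset_logspace`); conversely a logarithmic tape is a pair of stacks,
coded by numbers of polynomial size that boundedly many heads can hold
(`logspace_subset_twoWayDFAClass`). These simulations are composed from `Routine`s. -/

/-! ### Deterministic acceptance -/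

/-- Acceptance by a deterministic transition system: the computation from the configuration
halts, in an accepting configuration. -/
inductive AccFrom {C : Type*} (next : C → Option C) (acc : C → Prop) : C → Prop
  | halt {c : C} : next c = none → acc c → AccFrom next acc c
  | step {c c' : C} : next c = some c' → AccFrom next acc c' → AccFrom next acc c

/-- The inductive form allows induction on an accepting computation; a diverging computation has no
derivation. -/
theorem accFrom_iff {C : Type*} (next : C → Option C) (acc : C → Prop) (c : C) :
    AccFrom next acc c ↔ ∃ c', Relation.ReflTransGen (fun c c' => next c = some c') c c' ∧
      next c' = none ∧ acc c' := by
  constructor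
  · intro h
    induction h with
    | halt h h' => exact ⟨_, .refl, h, h'⟩
    | step h _ ih =>
      obtain ⟨c', h1, h2⟩ := ih
      exact ⟨c', .head h h1, h2⟩
  · rintro ⟨c', h, h1, h2⟩
    induction h using Relation.ReflTransGen.head_induction_on with
    | refl => exact .halt h1 h2
    | head h _ ih => exact .step h ih

theorem accFrom_iff_of_step {C : Type*} {next : C → Option C} {acc : C → Prop} {c c' : C}
    (h : next c = some c') : AccFrom next acc c ↔ AccFrom next acc c' := by
  refine ⟨fun h' => ?_, .step h⟩
  cases h' with
  | halt h' => simp [h] at h'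
  | step h' h'' =>
    rw [h, Option.some.injEq] at h'
    rwa [h']

theorem accFrom_iff_of_halt {C : Type*} {next : C → Option C} {acc : C → Prop} {c : C}
    (h : next c = none) : AccFrom next acc c ↔ acc c := by
  refine ⟨fun h' => ?_, .halt h⟩
  cases h' with
  | halt _ h' => exact h'
  | step h' => simp [h] at h'

/-! ### Devices and routines -/

/-- A store with a finite view of it and finitely many actions on it; both may depend on an
input word. -/
structure Device where
  V : Type
  A : Type
  S : Type
  view : List Bool → S → V
  act : List Bool → A → S → S
  nop : V → A
  act_nop : ∀ w σ, act w (nop (view w σ)) σ = σ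

/-- A finite control for a device, which returns a result when it exits. -/
structure Routine (X : Device) (O : Type) where
  Q : Type
  finite_Q : Finite Q
  start : Q
  δ : Q → X.V → (Q × X.A) ⊕ O

namespace Routine

variable {X : Device} {O O' I : Type}

instance (R : Routine X O) : Finite R.Q := R.finite_Q

/-- The run of a routine from the state `q` and the store `σ` exits with the result `o` and the
store `σ'`, and the invariant `P` holds all along. -/
inductive Run (R : Routine X O) (w : List Bool) (P : X.S → Prop) : R.Q → X.S → O → X.S → Prop
  | exit {q σ o} : R.δ q (X.view w σ) = .inr o → P σ → Run R w P q σ o σ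
  | step {q σ q' a o σ'} : R.δ q (X.view w σ) = .inl (q', a) → P σ →
      Run R w P q' (X.act w a σ) o σ' → Run R w P q σ o σ'

/-- The run of a routine from its initial state. -/
def Computes (R : Routine X O) (w : List Bool) (P : X.S → Prop) (σ : X.S) (o : O) (σ' : X.S) :
    Prop := R.Run w P R.start σ o σ'

/-- The routine that returns a function of the view. -/
def look (f : X.V → O) : Routine X O where
  Q := Unit
  finite_Q := inferInstance
  start := ()
  δ := fun _ v => .inr (f v)

/-- The routine that performs one action. -/
def perform [Finite O] (f : X.V → X.A × O) : Routine X O where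
  Q := Option O
  finite_Q := inferInstance
  start := none
  δ := fun q v => match q with
    | none => .inl (some (f v).2, (f v).1)
    | some o => .inr o

/-- Sequential composition. -/
def bind [Finite O] (R : Routine X O) (T : O → Routine X O') : Routine X O' where
  Q := R.Q ⊕ Σ o, (T o).Q
  finite_Q := inferInstance
  start := .inl R.start
  δ := fun q v => match q with
    | .inl q => match R.δ q v with
      | .inl (q', a) => .inl (.inl q', a)
      -- An exit performs no action, so the passage to `T o` is a transition of its own with the
      -- idle action. That action depends on the view: a tape cell is rewritten with its own symbol.
      | .inr o => .inl (.inr ⟨o, (T o).start⟩, X.nop v)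
    | .inr ⟨o, q⟩ => match (T o).δ q v with
      | .inl (q', a) => .inl (.inr ⟨o, q'⟩, a)
      | .inr o' => .inr o'

/-- Iteration of a family of routines until one of them returns a result in `O`. -/
def iter [Finite I] (B : I → Routine X (I ⊕ O)) (i : I) : Routine X O where
  Q := Σ i, (B i).Q
  finite_Q := inferInstance
  start := ⟨i, (B i).start⟩
  δ := fun q v => match (B q.1).δ q.2 v with
    | .inl (q', a) => .inl (⟨q.1, q'⟩, a)
    | .inr (.inl i') => .inl (⟨i', (B i').start⟩, X.nop v)
    | .inr (.inr o) => .inr o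

variable {w : List Bool} {P : X.S → Prop} {σ σ' σ'' : X.S}

theorem computes_look {f : X.V → O} {o : O} (hf : f (X.view w σ) = o) (h : P σ) :
    (look f).Computes w P σ o σ := by
  subst hf
  exact .exit rfl h

theorem computes_perform [Finite O] {f : X.V → X.A × O} {a : X.A} {o : O}
    (hf : f (X.view w σ) = (a, o)) (ha : X.act w a σ = σ') (h : P σ) (h' : P σ') :
    (perform f).Computes w P σ o σ' := by
  subst ha
  refine .step (q' := some o) (a := a) ?_ h (.exit rfl h')
  simp only [perform, hf]

theorem Run.nop_step {R : Routine X O} {q q' : R.Q} {o : O}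
    (h : R.δ q (X.view w σ) = .inl (q', X.nop (X.view w σ))) (hP : P σ)
    (h' : R.Run w P q' σ o σ') : R.Run w P q σ o σ' := by
  refine .step h hP ?_
  rwa [X.act_nop]

theorem Computes.bind [Finite O] {R : Routine X O} {T : O → Routine X O'} {o : O} {o' : O'}
    (h : R.Computes w P σ o σ') (h' : (T o).Computes w P σ' o' σ'') :
    (R.bind T).Computes w P σ o' σ'' := by
  have key : ∀ q σ o' σ'', (T o).Run w P q σ o' σ'' →
      (R.bind T).Run w P (.inr ⟨o, q⟩) σ o' σ'' := by
    intro q σ o' σ'' h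
    induction h with
    | exit h1 h2 => exact .exit (by simp [Routine.bind, h1]) h2
    | step h1 h2 _ ih => exact .step (by simp only [Routine.bind, h1]) h2 ih
  unfold Computes at h
  change (R.bind T).Run w P (.inl R.start) σ o' σ''
  generalize R.start = q at h
  induction h with
  | exit h1 h2 =>
    exact .nop_step (by simp only [Routine.bind, h1]) h2 (key _ _ _ _ h')
  | step h1 h2 _ ih =>
    exact .step (by simp only [Routine.bind, h1]) h2 (ih h' key)

/-- The index of `iter` fixes only the initial state; states and transitions are common to all
indices, so a run of `iter B i'` can continue one of `iter B i₀`. Inner states are arbitrary for the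
sake of the induction. -/
theorem iter_run [Finite I] {B : I → Routine X (I ⊕ O)} {i : I} {q : (B i).Q} {r : I ⊕ O}
    (i₀ : I) (h : (B i).Run w P q σ r σ') :
    match r with
    | .inr o => (iter B i₀).Run w P ⟨i, q⟩ σ o σ'
    | .inl i' => ∀ o σ'', (iter B i').Computes w P σ' o σ'' →
        (iter B i₀).Run w P ⟨i, q⟩ σ o σ'' := by
  have start : ∀ i' o τ τ' (q : (iter B i').Q), (iter B i').Run w P q τ o τ' →
      (iter B i₀).Run w P q τ o τ' := by
    intro i' o τ τ' q h
    induction h with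
    | exit h1 h2 => exact .exit h1 h2
    | step h1 h2 _ ih => exact .step h1 h2 ih
  induction h with
  | @exit q σ r h1 h2 =>
    cases r with
    | inr o => exact .exit (by simp [iter, h1]) h2
    | inl i' =>
      intro o σ'' h
      exact .nop_step (by simp only [iter, h1]) h2 (start i' _ _ _ _ h)
  | @step q σ q' a r σ' h1 h2 _ ih =>
    have e : (iter B i₀).δ ⟨i, q⟩ (X.view w σ) = .inl (⟨i, q'⟩, a) := by simp [iter, h1]
    cases r with
    | inr o => exact .step e h2 ih
    | inl i' => exact fun o σ'' h => .step e h2 (ih o σ'' h)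

theorem computes_iter_done [Finite I] {B : I → Routine X (I ⊕ O)} {i : I} {o : O}
    (h : (B i).Computes w P σ (.inr o) σ') : (iter B i).Computes w P σ o σ' :=
  iter_run i h

theorem computes_iter_step [Finite I] {B : I → Routine X (I ⊕ O)} {i i' : I} {o : O}
    (h : (B i).Computes w P σ (.inl i') σ') (h' : (iter B i').Computes w P σ' o σ'') :
    (iter B i).Computes w P σ o σ'' :=
  iter_run i h o σ'' h'

/-- Iteration of a routine until it returns a result in `O`. -/
def loop (B : Routine X (Unit ⊕ O)) : Routine X O := iter (fun _ => B) ()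

theorem computes_loop_done {B : Routine X (Unit ⊕ O)} {o : O}
    (h : B.Computes w P σ (.inr o) σ') : (loop B).Computes w P σ o σ' :=
  computes_iter_done (B := fun _ => B) h

theorem computes_loop_step {B : Routine X (Unit ⊕ O)} {o : O}
    (h : B.Computes w P σ (.inl ()) σ') (h' : (loop B).Computes w P σ' o σ'') :
    (loop B).Computes w P σ o σ'' :=
  computes_iter_step (B := fun _ => B) h h'

theorem Computes.congr_left {R : Routine X O} {o : O} (h : R.Computes w P σ o σ') (e : σ'' = σ) :
    R.Computes w P σ'' o σ' := e ▸ h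

theorem Computes.congr_right {R : Routine X O} {o : O} (h : R.Computes w P σ o σ')
    (e : σ' = σ'') : R.Computes w P σ o σ'' := e ▸ h

theorem Computes.congr_out {R : Routine X O} {o o' : O} (h : R.Computes w P σ o σ')
    (e : o = o') : R.Computes w P σ o' σ' := e ▸ h

/-! ### Simulation of a deterministic transition system by an iterated routine -/

section Simulation

variable [Finite I] {B : I → Routine X (I ⊕ Bool)} {C : Type*} {next : C → Option C}
  {acc : C → Prop} {Rel : C → I → X.S → Prop}

/-- The routine `B` performs one step of a transition system on the configurations that are
represented, by `Rel`, by an index and a store. -/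
def Simulates (B : I → Routine X (I ⊕ Bool)) (w : List Bool) (P : X.S → Prop)
    (next : C → Option C) (acc : C → Prop) (Rel : C → I → X.S → Prop) : Prop :=
  ∀ c i σ, Rel c i σ →
    (∀ c', next c = some c' → ∃ i' σ', Rel c' i' σ' ∧ (B i).Computes w P σ (.inl i') σ') ∧
    (next c = none → ∃ b σ', (b = true ↔ acc c) ∧ (B i).Computes w P σ (.inr b) σ')

/-- Here determinism is used. The iterated run may start in the middle of an inner routine; the
inner run from the same point agrees with it up to the inner exit, so its result decides what comes
next. If this is a new index, `H` supplies the following inner run and the induction continues. -/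
theorem Simulates.accFrom_of_run (H : Simulates B w P next acc Rel) {i₀ : I}
    {q : (iter B i₀).Q} {o : Bool} (h : (iter B i₀).Run w P q σ o σ') :
    ∀ r τ, (B q.1).Run w P q.2 σ r τ → o = true →
      r = .inr true ∨ ∃ i, r = .inl i ∧ ∀ c, Rel c i τ → AccFrom next acc c := by
  induction h with
  | @exit q σ o h1 h2 =>
    rintro r τ hr rfl
    cases hr with
    | exit h3 _ =>
      left
      rw [show (iter B i₀).δ q = _ from rfl] at h1
      simp only [iter, h3] at h1
      rcases r with i | b
      · simp at h1
      · simpa using h1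
    | step h3 _ _ =>
      simp [iter, h3] at h1
  | @step q σ q' a o σ' h1 h2 h3 ih =>
    rintro r τ hr rfl
    cases hr with
    | exit h4 _ =>
      simp only [iter, h4] at h1
      rcases r with i | b
      · refine .inr ⟨i, rfl, fun c hc => ?_⟩
        simp only [Sum.inl.injEq] at h1
        obtain ⟨rfl, rfl⟩ := h1
        rw [X.act_nop] at ih
        obtain ⟨H1, H2⟩ := H c i _ hc
        cases hn : next c with
        | none =>
          obtain ⟨b, τ', hb, hB⟩ := H2 hn
          rcases ih _ _ hB rfl with h | ⟨i, h, _⟩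
          · simp only [Sum.inr.injEq] at h
            exact .halt hn (hb.1 h)
          · simp at h
        | some c' =>
          obtain ⟨i', τ', hR, hB⟩ := H1 c' hn
          rcases ih _ _ hB rfl with h | ⟨i, h, h'⟩
          · simp at h
          · simp only [Sum.inl.injEq] at h
            subst h
            exact .step hn (h' _ hR)
      · simp at h1
    | @step _ _ q₁ a₁ _ _ h4 _ h5 =>
      simp only [iter, h4, Sum.inl.injEq] at h1
      obtain ⟨rfl, rfl⟩ := h1
      exact ih _ _ h5 rfl

/-- An iterated routine that simulates a transition system has the same acceptance. -/
theorem Simulates.computes_iff (H : Simulates B w P next acc Rel) {c : C} {i : I}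
    (h : Rel c i σ) : (∃ σ', (iter B i).Computes w P σ true σ') ↔ AccFrom next acc c := by
  constructor
  · rintro ⟨σ', hσ⟩
    obtain ⟨H1, H2⟩ := H c i _ h
    cases hn : next c with
    | none =>
      obtain ⟨b, τ', hb, hB⟩ := H2 hn
      rcases H.accFrom_of_run hσ _ _ hB rfl with h | ⟨i, h, _⟩
      · simp only [Sum.inr.injEq] at h
        exact .halt hn (hb.1 h)
      · simp at h
    | some c' =>
      obtain ⟨i', τ', hR, hB⟩ := H1 c' hn
      rcases H.accFrom_of_run hσ _ _ hB rfl with h | ⟨i, h, h'⟩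
      · simp at h
      · simp only [Sum.inl.injEq] at h
        subst h
        exact .step hn (h' _ hR)
  · intro hc
    induction hc generalizing i σ with
    | halt hn ha =>
      obtain ⟨b, τ', hb, hB⟩ := (H _ i _ h).2 hn
      rw [hb.2 ha] at hB
      exact ⟨τ', computes_iter_done hB⟩
    | step hn _ ih =>
      obtain ⟨i', τ', hR, hB⟩ := (H _ i _ h).1 _ hn
      obtain ⟨σ', h'⟩ := ih hR
      exact ⟨σ', computes_iter_step hB h'⟩

end Simulation

/-! ### Routines as machines -/

/-- One step of a routine that returns a boolean, followed by the recording of that boolean. -/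
def machineδ (R : Routine X Bool) : R.Q ⊕ Bool → X.V → Option ((R.Q ⊕ Bool) × X.A)
  | .inl q, v => match R.δ q v with
    | .inl (q', a) => some (.inl q', a)
    | .inr b => some (.inr b, X.nop v)
  | .inr _, _ => none

/-- The transition function of the machine of a routine. -/
def machineNext (R : Routine X Bool) (w : List Bool) (c : (R.Q ⊕ Bool) × X.S) :
    Option ((R.Q ⊕ Bool) × X.S) :=
  (R.machineδ c.1 (X.view w c.2)).map fun r => (r.1, X.act w r.2 c.2)

/-- The machine makes one transition more than the routine: it stores the returned boolean in its
state and then halts. -/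
theorem accFrom_machineNext_iff (R : Routine X Bool) (w : List Bool) (σ : X.S) :
    AccFrom (R.machineNext w) (fun c => c.1 = .inr true) (.inl R.start, σ) ↔
      ∃ σ', R.Computes w (fun _ => True) σ true σ' := by
  unfold Computes
  generalize R.start = q
  constructor
  · intro h
    generalize hc : ((.inl q, σ) : (R.Q ⊕ Bool) × X.S) = c at h
    induction h generalizing q σ with
    | halt _ h => subst hc; simp at h
    | step h h' ih =>
      subst hc
      simp only [machineNext, machineδ, Option.map_eq_some_iff] at h
      obtain ⟨r, h1, rfl⟩ := h
      cases hd : R.δ q (X.view w σ) with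
      | inl r' =>
        simp only [hd, Option.some.injEq] at h1
        subst h1
        obtain ⟨σ', h2⟩ := ih _ _ rfl
        exact ⟨σ', .step hd trivial h2⟩
      | inr b =>
        simp only [hd, Option.some.injEq] at h1
        subst h1
        cases h' with
        | halt _ h' =>
          simp only [Sum.inr.injEq] at h'
          subst h'
          exact ⟨σ, .exit hd trivial⟩
        | step h' => simp [machineNext, machineδ] at h'
  · rintro ⟨σ', h⟩
    generalize hb : true = b at h
    induction h with
    | exit h _ =>
      subst hb
      rename_i q σ _
      refine .step (c' := (.inr true, σ)) ?_ (.halt rfl rfl)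
      simp only [machineNext, machineδ, h, Option.map_some, X.act_nop]
    | step h _ _ ih =>
      refine .step ?_ (ih hb)
      simp only [machineNext, machineδ, h, Option.map_some]

/-- All configurations of the machine that are reached within `n` steps satisfy `P`. -/
def SafeFor (R : Routine X Bool) (w : List Bool) (P : X.S → Prop) :
    ℕ → (R.Q ⊕ Bool) × X.S → Prop
  | 0, c => P c.2
  | n + 1, c => P c.2 ∧ ∀ c', R.machineNext w c = some c' → SafeFor R w P n c'

/-- Safety counts steps because it must cover computations that never halt, while `Run` describes
only those that exit. -/
theorem SafeFor.of_reaches {R : Routine X Bool} {c c'} (h : ∀ n, R.SafeFor w P n c)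
    (h' : Relation.ReflTransGen (fun c c' => R.machineNext w c = some c') c c') : P c'.2 := by
  induction h' using Relation.ReflTransGen.head_induction_on with
  | refl => exact h 0
  | head h1 _ ih => exact ih fun n => (h (n + 1)).2 _ h1

/-- Leaving an inner run costs at least one transition, so fewer than `n` steps remain for the next
index. -/
theorem safeFor_of_run [Finite I] {B : I → Routine X (I ⊕ Bool)} {i₀ i : I} {q : (B i).Q}
    {r : I ⊕ Bool} (h : (B i).Run w P q σ r σ') (n : ℕ)
    (h' : ∀ i', r = .inl i' → ∀ m < n,
      (iter B i₀).SafeFor w P m (.inl ⟨i', (B i').start⟩, σ')) :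
    (iter B i₀).SafeFor w P n (.inl ⟨i, q⟩, σ) := by
  induction h generalizing n with
  | @exit q σ r h1 h2 =>
    cases n with
    | zero => exact h2
    | succ n =>
      refine ⟨h2, fun c' hc => ?_⟩
      simp only [machineNext, machineδ, iter, h1] at hc
      rcases r with i' | b
      · simp only [Option.map_some, X.act_nop] at hc
        cases hc
        exact h' i' rfl n (Nat.lt_succ_self n)
      · simp only [Option.map_some, X.act_nop] at hc
        cases hc
        cases n with
        | zero => exact h2
        | succ n => exact ⟨h2, fun c' hc => by simp [machineNext, machineδ] at hc⟩
  | @step q σ q' a r σ' h1 h2 _ ih =>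
    cases n with
    | zero => exact h2
    | succ n =>
      refine ⟨h2, fun c' hc => ?_⟩
      simp only [machineNext, machineδ, iter, h1, Option.map_some] at hc
      cases hc
      exact ih n fun i' hi m hm => h' i' hi m (hm.trans (Nat.lt_succ_self n))

/-- The machine of an iterated routine that simulates a transition system preserves the
invariant of the simulation. -/
theorem Simulates.safe [Finite I] {B : I → Routine X (I ⊕ Bool)} {C : Type*}
    {next : C → Option C} {acc : C → Prop} {Rel : C → I → X.S → Prop}
    (H : Simulates B w P next acc Rel) (i₀ : I) (n : ℕ) {c : C} {i : I} (h : Rel c i σ) :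
    (iter B i₀).SafeFor w P n (.inl ⟨i, (B i).start⟩, σ) := by
  -- The length of an inner run is only known to be positive.
  induction n using Nat.strong_induction_on generalizing c i σ with
  | _ n ih =>
    cases hn : next c with
    | none =>
      obtain ⟨b, τ, _, hB⟩ := (H c i σ h).2 hn
      exact safeFor_of_run hB n fun i' hi => by simp at hi
    | some c' =>
      obtain ⟨i', τ, hR, hB⟩ := (H c i σ h).1 c' hn
      refine safeFor_of_run hB n fun i'' hi m hm => ?_
      simp only [Sum.inl.injEq] at hi
      subst hi
      exact ih m hm hR

theorem Run.mono {R : Routine X O} {P' : X.S → Prop} (hP : ∀ σ, P σ → P' σ) {q : R.Q} {o : O}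
    (h : R.Run w P q σ o σ') : R.Run w P' q σ o σ' := by
  induction h with
  | exit h1 h2 => exact .exit h1 (hP _ h2)
  | step h1 h2 _ ih => exact .step h1 (hP _ h2) ih

theorem Simulates.mono [Finite I] {B : I → Routine X (I ⊕ Bool)} {C : Type*}
    {next : C → Option C} {acc : C → Prop} {Rel : C → I → X.S → Prop} {P' : X.S → Prop}
    (H : Simulates B w P next acc Rel) (hP : ∀ σ, P σ → P' σ) :
    Simulates B w P' next acc Rel := by
  intro c i σ h
  obtain ⟨h1, h2⟩ := H c i σ h
  refine ⟨fun c' hc => ?_, fun hc => ?_⟩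
  · obtain ⟨i', σ', hR, hB⟩ := h1 c' hc
    exact ⟨i', σ', hR, Run.mono hP hB⟩
  · obtain ⟨b, σ', hb, hB⟩ := h2 hc
    exact ⟨b, σ', hb, Run.mono hP hB⟩

end Routine

/-! ### Transport of acceptance along maps; heads and tapes as devices -/

theorem accFrom_map {C C' : Type*} {next : C → Option C} {acc : C → Prop}
    {next' : C' → Option C'} {acc' : C' → Prop} (f : C → C')
    (hn : ∀ c, next' (f c) = (next c).map f) (ha : ∀ c, acc' (f c) ↔ acc c) (c : C) :
    AccFrom next' acc' (f c) ↔ AccFrom next acc c := by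
  constructor
  · intro h
    generalize hc : f c = c' at h
    induction h generalizing c with
    | halt h1 h2 =>
      subst hc
      rw [hn, Option.map_eq_none_iff] at h1
      exact .halt h1 ((ha _).1 h2)
    | step h1 _ ih =>
      subst hc
      rw [hn, Option.map_eq_some_iff] at h1
      obtain ⟨d, h1, rfl⟩ := h1
      exact .step h1 (ih _ rfl)
  · intro h
    induction h with
    | halt h1 h2 => exact .halt (by rw [hn, h1]; rfl) ((ha _).2 h2)
    | step h1 _ ih => exact .step (by rw [hn, h1]; rfl) ih

theorem readTape_eq_left_iff (w : List Bool) (x : ℕ) : readTape w x = .left ↔ x = 0 := by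
  cases x with
  | zero => simp [readTape]
  | succ x =>
    simp only [readTape, Nat.succ_ne_zero, iff_false]
    split <;> simp

theorem readTape_eq_right_iff (w : List Bool) (x : ℕ) :
    readTape w x = .right ↔ w.length + 1 ≤ x := by
  cases x with
  | zero => simp [readTape]
  | succ x =>
    simp only [readTape]
    split
    · rename_i h
      have := (List.getElem?_eq_some_iff.1 h).1
      simp; omega
    · rename_i h
      have := List.getElem?_eq_none_iff.1 h
      simp; omega

theorem Move.onInput_le (w : List Bool) (m : Move) {p : ℕ} (hp : p ≤ w.length + 1) :
    m.onInput w p ≤ w.length + 1 := by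
  cases m <;> simp [Move.onInput] <;> omega

/-- The positions of a family of heads on a two-way input tape. -/
abbrev headDevice (H : Type) : Device where
  V := H → TapeSymbol
  A := H → Move
  S := H → ℕ
  view := fun w p a => readTape w (p a)
  act := fun w m p a => (m a).onInput w (p a)
  nop := fun _ _ => .stay
  act_nop := fun _ _ => rfl

/-- The positions and the contents of the tapes of a Turing machine. -/
@[ext] structure TapeStore (Γ : Type) where
  inputHead : ℕ
  tape : ℕ → Γ
  workHead : ℕ

/-- An input tape and a work tape, with their heads. -/
abbrev tapeDevice (Γ : Type) : Device where
  V := TapeSymbol × Γ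
  A := Γ × Move × Move
  S := TapeStore Γ
  view := fun w σ => (readTape w σ.inputHead, σ.tape σ.workHead)
  act := fun w a σ => ⟨a.2.1.onInput w σ.inputHead, Function.update σ.tape σ.workHead a.1,
    a.2.2.onTape σ.workHead⟩
  nop := fun v => (v.2, .stay, .stay)
  act_nop := fun w σ => by
    ext
    · rfl
    · simp
    · rfl

/-- A routine on the positions of finitely many heads is a multihead automaton. -/
theorem Routine.exists_twoWayDFA {H : Type} [Fintype H] (R : Routine (headDevice H) Bool) :
    ∃ M : TwoWayDFA (Fintype.card H), ∀ w, M.Accepts w ↔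
      ∃ σ', R.Computes w (fun _ => True) (fun _ => 0) true σ' := by
  let e : H ≃ Fin (Fintype.card H) := Fintype.equivFin H
  let M : TwoWayDFA (Fintype.card H) :=
    { Q := R.Q ⊕ Bool
      finite_Q := inferInstance
      start := .inl R.start
      accept := {.inr true}
      δ := fun q v => (R.machineδ q (fun a => v (e a))).map fun r => (r.1, fun a => r.2 (e.symm a)) }
  refine ⟨M, fun w => ?_⟩
  rw [← R.accFrom_machineNext_iff w]
  refine (accFrom_iff (M.next w) (fun c => c.1 ∈ M.accept) _).symm.trans ?_
  refine accFrom_map (next' := M.next w) (fun c : (R.Q ⊕ Bool) × (H → ℕ) =>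
    (c.1, fun a => c.2 (e.symm a))) ?_ (fun c => Iff.rfl) (.inl R.start, fun _ => 0)
  rintro ⟨q, p⟩
  simp only [TwoWayDFA.next, machineNext, M, Option.map_map, Equiv.symm_apply_apply]
  rfl

/-- A routine on the tapes is a Turing machine; its reachable configurations satisfy the
invariants of the machine of the routine. -/
theorem Routine.exists_offlineTM {Γ : Type} [Finite Γ] (blank : Γ)
    (R : Routine (tapeDevice Γ) Bool) :
    ∃ M : OfflineTM, (∀ w, M.Accepts w ↔
      ∃ σ', R.Computes w (fun _ => True) ⟨0, fun _ => blank, 0⟩ true σ') ∧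
      ∀ w (B : ℕ), (∀ n, R.SafeFor w (fun σ => σ.workHead < B) n
        (.inl R.start, ⟨0, fun _ => blank, 0⟩)) → ∀ c, M.Reaches w c → c.workHead < B := by
  let M : OfflineTM :=
    { Q := R.Q ⊕ Bool
      finite_Q := inferInstance
      Γ := Γ
      finite_Γ := inferInstance
      blank := blank
      start := .inl R.start
      accept := {.inr true}
      δ := fun q s g => R.machineδ q (s, g) }
  let f : (R.Q ⊕ Bool) × TapeStore Γ → M.Cfg := fun c => ⟨c.1, c.2.inputHead, c.2.tape, c.2.workHead⟩
  have hf : ∀ w c, M.next w (f c) = (R.machineNext w c).map f := by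
    intro w c
    simp only [OfflineTM.next, machineNext, Option.map_map, f, M]
    rfl
  refine ⟨M, fun w => ?_, fun w n h c hc => ?_⟩
  · rw [← R.accFrom_machineNext_iff w]
    refine (accFrom_iff (M.next w) (fun c => c.state ∈ M.accept) _).symm.trans ?_
    exact accFrom_map (next' := M.next w) f (hf w) (fun c => Iff.rfl)
      (.inl R.start, ⟨0, fun _ => blank, 0⟩)
  · have key : ∃ c', c = f c' ∧ Relation.ReflTransGen
        (fun c c' => R.machineNext w c = some c') (.inl R.start, ⟨0, fun _ => blank, 0⟩) c' := by
      induction hc with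
      | refl => exact ⟨_, rfl, .refl⟩
      | tail _ h1 ih =>
        obtain ⟨c', rfl, h2⟩ := ih
        rw [hf, Option.map_eq_some_iff] at h1
        obtain ⟨d, h1, rfl⟩ := h1
        exact ⟨d, rfl, h2.tail h1⟩
    obtain ⟨c', rfl, hc'⟩ := key
    exact SafeFor.of_reaches h hc'

/-- The carry runs through the trailing ones and stops at the lowest zero. Induction on its
position: halving turns a last digit one into a carry into the quotient. -/
theorem Nat.testBit_add_one_of_forall {v z : ℕ} (h : ∀ x < z, v.testBit x = true)
    (hz : v.testBit z = false) (x : ℕ) :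
    (v + 1).testBit x = if x < z then false else if x = z then true else v.testBit x := by
  induction z generalizing v x with
  | zero =>
    rw [Nat.testBit_zero] at hz
    cases x with
    | zero => rw [Nat.testBit_zero]; simp at hz ⊢; omega
    | succ x =>
      rw [Nat.testBit_succ, Nat.testBit_succ]
      have : (v + 1) / 2 = v / 2 := by simp at hz; omega
      simp [this]
  | succ z ih =>
    have h0 := h 0 (Nat.succ_pos z)
    rw [Nat.testBit_zero] at h0
    cases x with
    | zero => rw [Nat.testBit_zero]; simp at h0 ⊢; omega
    | succ x =>
      rw [Nat.testBit_succ, Nat.testBit_succ]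
      have : (v + 1) / 2 = v / 2 + 1 := by simp at h0; omega
      rw [this, ih (v := v / 2) (fun x hx => by
        have := h (x + 1) (by omega)
        rwa [Nat.testBit_succ] at this) (by rwa [Nat.testBit_succ] at hz)]
      simp

/-- The borrow runs through the trailing zeros; the digit at `z` keeps `v` positive, so the
subtraction is not truncated. -/
theorem Nat.testBit_sub_one_of_forall {v z : ℕ} (h : ∀ x < z, v.testBit x = false)
    (hz : v.testBit z = true) (x : ℕ) :
    (v - 1).testBit x = if x < z then true else if x = z then false else v.testBit x := by
  induction z generalizing v x with
  | zero =>
    rw [Nat.testBit_zero] at hz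
    cases x with
    | zero => rw [Nat.testBit_zero]; simp at hz ⊢; omega
    | succ x =>
      rw [Nat.testBit_succ, Nat.testBit_succ]
      have : (v - 1) / 2 = v / 2 := by simp at hz; omega
      simp [this]
  | succ z ih =>
    have h0 := h 0 (Nat.succ_pos z)
    rw [Nat.testBit_zero] at h0
    have hv : v ≠ 0 := by rintro rfl; simp at hz
    cases x with
    | zero => rw [Nat.testBit_zero]; simp at h0 ⊢; omega
    | succ x =>
      rw [Nat.testBit_succ, Nat.testBit_succ]
      have : (v - 1) / 2 = v / 2 - 1 := by simp at h0; omega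
      rw [this, ih (v := v / 2) (fun x hx => by
        have := h (x + 1) (by omega)
        rwa [Nat.testBit_succ] at this) (by rwa [Nat.testBit_succ] at hz)]
      simp

instance : Finite TapeSymbol :=
  Finite.of_injective (β := Option (Option Bool))
    (fun s => match s with | .left => none | .right => some none | .letter b => some (some b))
    (by rintro (_ | _ | _) (_ | _ | _) h <;> simp_all)

/-! ### Binary counters on the tracks of a tape -/

namespace Tracks

variable {H : Type}

/-- The alphabet of a tape with a track for each element of `H` and a mark of the first cell;
`none` is the blank. -/
abbrev Cell (H : Type) : Type := Option ((H → Bool) × Bool)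

/-- A tape whose first `U` cells hold the binary digits of the numbers `v a`. -/
def trackTape (U : ℕ) (v : H → ℕ) (x : ℕ) : Cell H :=
  if x < U then some (fun a => (v a).testBit x, decide (x = 0)) else none

/-- The counters have the values `v`, the input head is at `x` and the work head at `0`. -/
def Rep (w : List Bool) (x : ℕ) (v : H → ℕ) (σ : TapeStore (Cell H)) : Prop :=
  -- The number `U` of cells in use never decreases, so the values `v` do not determine it. A cell
  -- beyond the first is opened only when a counter reaches `2 ^ (U - 1)`, for the new `U`; this
  -- keeps `U` logarithmic.
  ∃ U, 1 ≤ U ∧ 2 ^ (U - 1) ≤ w.length + 1 ∧ (∀ a, v a < 2 ^ U) ∧ σ = ⟨x, trackTape U v, 0⟩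

/-- The bound on the position of the work head. -/
abbrev Bounded (w : List Bool) (σ : TapeStore (Cell H)) : Prop :=
  σ.workHead < Nat.log 2 w.length + 3

theorem lt_bound {w : List Bool} {U : ℕ} (h : 2 ^ (U - 1) ≤ w.length + 1) :
    U < Nat.log 2 w.length + 3 := by
  have h1 : U - 1 ≤ Nat.log 2 (w.length + 1) := Nat.le_log_of_pow_le (by norm_num) h
  have h2 : Nat.log 2 (w.length + 1) ≤ Nat.log 2 w.length + 1 := by
    rcases Nat.eq_zero_or_pos w.length with h | h
    · simp [h]
    · rw [← Nat.log_mul_base (by norm_num) h.ne']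
      exact Nat.log_mono_right (by omega)
  omega

variable {w : List Bool}

/-- Move right to the first cell that is blank or has the digit `b` on the track `a`. -/
def scan (a : H) (b : Bool) : Routine (tapeDevice (Cell H)) Unit :=
  Routine.loop (Routine.perform fun v : TapeSymbol × Cell H => match v.2 with
    | none => ((v.2, .stay, .stay), .inr ())
    | some (d, _) => if d a = b then ((v.2, .stay, .stay), .inr ())
      else ((v.2, .stay, .right), .inl ()))

/-- `h'` is void when the cell `z` is blank, so both ways of stopping are covered. -/
theorem computes_scan (a : H) (b : Bool) (x : ℕ) (t : ℕ → Cell H) {y z : ℕ} (hyz : y ≤ z)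
    (hz : z < Nat.log 2 w.length + 3)
    (h : ∀ x, y ≤ x → x < z → ∃ d s, t x = some (d, s) ∧ d a ≠ b)
    (h' : ∀ d s, t z = some (d, s) → d a = b) :
    (scan a b).Computes w (Bounded w) ⟨x, t, y⟩ () ⟨x, t, z⟩ := by
  induction hyz using Nat.decreasingInduction with
  | self =>
    refine Routine.computes_loop_done (Routine.computes_perform (a := (t z, .stay, .stay)) ?_ ?_ hz hz)
    · cases ht : t z with
      | none => simp [ht]
      | some ds => simp [ht, h' ds.1 ds.2 ht]
    · simp [Move.onInput, Move.onTape]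
  | of_succ y hy ih =>
    obtain ⟨d, s, ht, hd⟩ := h y le_rfl hy
    refine Routine.computes_loop_step (σ' := (⟨x, t, y + 1⟩ : TapeStore (Cell H)))
      (Routine.computes_perform (a := (t y, .stay, .right)) ?_ ?_ (hy.trans hz)
        (lt_of_le_of_lt hy hz)) ?_
    · simp [ht, hd]
    · simp [Move.onInput, Move.onTape]
    · exact ih fun x hx => h x (by omega)

/-- Apply a function to the digits of all cells to the left, and return to the first cell. -/
def rewind (f : (H → Bool) → H → Bool) : Routine (tapeDevice (Cell H)) Unit :=
  Routine.loop (Routine.perform fun v : TapeSymbol × Cell H => match v.2 with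
    | none => ((v.2, .stay, .stay), .inr ())
    -- The mark `s` ends the loop; the left move made on the first cell has no effect.
    | some (d, s) => ((some (f d, s), .stay, .left), if s then .inr () else .inl ()))

theorem computes_rewind (f : (H → Bool) → H → Bool) (x : ℕ) (t : ℕ → Cell H) (d : ℕ → H → Bool)
    {y : ℕ} (hy : y < Nat.log 2 w.length + 3) (h : ∀ x ≤ y, t x = some (d x, decide (x = 0))) :
    (rewind f).Computes w (Bounded w) ⟨x, t, y⟩ ()
      ⟨x, fun x => if x ≤ y then some (f (d x), decide (x = 0)) else t x, 0⟩ := by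
  induction y generalizing t with
  | zero =>
    refine Routine.computes_loop_done (Routine.computes_perform
      (a := (some (f (d 0), true), .stay, .left)) ?_ ?_ hy hy)
    · simp [h 0 le_rfl]
    · simp only [Move.onInput, Move.onTape, TapeStore.mk.injEq, true_and, and_true]
      funext x
      rcases Nat.eq_zero_or_pos x with rfl | hx
      · simp
      · simp [hx.ne']
  | succ y ih =>
    have := ih (Function.update t (y + 1) (some (f (d (y + 1)), false))) (by omega) (fun x hx => by
      rw [Function.update_of_ne (by omega)]
      exact h x (by omega))
    refine Routine.computes_loop_step (Routine.computes_perform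
      (a := (some (f (d (y + 1)), false), .stay, .left)) ?_ rfl hy
      (by simp only [Move.onTape, Bounded]; omega)) ?_
    · simp [h (y + 1) le_rfl]
    · simp only [Move.onInput, Move.onTape, Nat.add_sub_cancel]
      refine this.congr_right (congrArg (fun t' => (⟨_, t', 0⟩ : TapeStore (Cell H)))
        (funext fun x => ?_))
      rcases lt_trichotomy x (y + 1) with hx | rfl | hx
      · simp [hx.le, Nat.lt_succ_iff.1 hx]
      · simp
      · simp [hx.not_ge, hx.ne', show ¬ x ≤ y by omega]

variable [DecidableEq H]

/-- Write the digit `c` in place of the last opposite digit on the track `a`, and the opposite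
digits below it. It increments for `c = true`; it decrements for `c = false`, unless the counter
is `0`. -/
def toggle (a : H) (c : Bool) : Routine (tapeDevice (Cell H)) Bool :=
  (scan a (!c)).bind fun _ =>
    (Routine.perform fun v : TapeSymbol × Cell H => match v.2 with
      -- The scan met no digit `!c`. When incrementing, all digits are ones, and a new cell receives
      -- the carry with zeros on the other tracks; when decrementing, the counter is `0` and nothing
      -- is written.
      | none => ((if c then some (fun b => decide (b = a), false) else none, .stay, .left),
          if c then some false else none)
      | some (d, s) => ((some (Function.update d a c, s), .stay, .left), some s)).bind fun
    | none => (rewind id).bind fun _ => Routine.look fun _ => false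
    | some true => Routine.look fun _ => true
    | some false => (rewind fun d => Function.update d a (!c)).bind fun _ =>
        Routine.look fun _ => true

/-- Increment and decrement differ by an exchange of the two digits, so one statement with the
resulting digits given by `hv'` serves for both. -/
theorem computes_toggle_of_found (a : H) (c : Bool) (x : ℕ) {U z : ℕ} {v v' : H → ℕ}
    (hU : U < Nat.log 2 w.length + 3) (hz : z < U) (hbit : (v a).testBit z = !c)
    (hlow : ∀ y < z, (v a).testBit y = c)
    (hv' : ∀ y, (v' a).testBit y = if y < z then !c else if y = z then c else (v a).testBit y)
    (hne : ∀ b, b ≠ a → v' b = v b) :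
    (toggle a c).Computes w (Bounded w) ⟨x, trackTape U v, 0⟩ true ⟨x, trackTape U v', 0⟩ := by
  have ht : ∀ y < U, trackTape U v y = some (fun a => (v a).testBit y, decide (y = 0)) :=
    fun y hy => if_pos hy
  refine (computes_scan (y := 0) (z := z) a (!c) x _ (Nat.zero_le z) (hz.trans hU)
    (fun y _ hy => ⟨_, _, ht y (hy.trans hz), by simp [hlow y hy]⟩)
    (fun d s hd => ?_)).bind ?_
  · rw [ht z hz] at hd
    simp only [Option.some.injEq, Prod.mk.injEq] at hd
    rw [← hd.1]
    exact hbit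
  refine (Routine.computes_perform (a := (some (Function.update (fun a => (v a).testBit z) a c,
    decide (z = 0)), .stay, .left)) (o := some (decide (z = 0)))
    (σ' := (⟨x, Function.update (trackTape U v) z (some (Function.update
      (fun a => (v a).testBit z) a c, decide (z = 0))), z - 1⟩ : TapeStore (Cell H)))
    ?_ rfl (hz.trans hU) ?_).bind ?_
  · simp [ht z hz]
  · simp only [Bounded]; omega
  have key : ∀ y, ¬ y < z → Function.update (trackTape U v) z (some (Function.update
      (fun a => (v a).testBit z) a c, decide (z = 0))) y = trackTape U v' y := by
    intro y hy
    rcases eq_or_ne y z with rfl | hyz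
    · rw [Function.update_self, trackTape, if_pos hz]
      congr 2
      funext b
      rcases eq_or_ne b a with rfl | hb
      · simp [hv']
      · simp [hb, hne]
    · rw [Function.update_of_ne hyz, trackTape, trackTape]
      congr 3
      funext b
      rcases eq_or_ne b a with rfl | hb
      · simp [hv', hy, hyz]
      · simp [hb, hne]
  -- For `z = 0` the left move stays on the cell just written, and `rewind` would overwrite its
  -- digit; hence the branch without it.
  rcases Nat.eq_zero_or_pos z with rfl | hz0
  · rw [show trackTape U v' = _ from (funext fun y => key y (by omega)).symm]
    exact Routine.computes_look rfl (lt_of_le_of_lt (Nat.zero_le _) hU)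
  · rw [show decide (z = 0) = false by simp; omega]
    have hz' : z - 1 < z := by omega
    refine (computes_rewind (y := z - 1) _ x _ (fun y a => (v a).testBit y) (by omega)
      fun y hy => ?_).bind ?_
    · rw [Function.update_of_ne (by omega), ht y (by omega)]
    · refine (Routine.computes_look rfl (Nat.succ_pos _)).congr_left
        (congrArg (fun t' => (⟨_, t', 0⟩ : TapeStore (Cell H))) (funext fun y => ?_))
      by_cases hy : y < z
      · rw [if_pos (by omega), trackTape, if_pos (by omega)]
        congr 2
        funext b
        rcases eq_or_ne b a with rfl | hb
        · simp [hv', hy]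
        · simp [hb, hne]
      · rw [if_neg (by omega), ← key y hy, show decide (z = 0) = false by simp; omega]

/-- The only case in which the used part of the tape grows. By `hv` the digit `U` of the other
counters is zero, as written in the new cell. -/
theorem computes_toggle_of_overflow (a : H) (x : ℕ) {U : ℕ} {v v' : H → ℕ} (hU0 : 1 ≤ U)
    (hU : U < Nat.log 2 w.length + 3) (hlow : ∀ y < U, (v a).testBit y = true)
    (hv : ∀ b, v b < 2 ^ U)
    (hv' : ∀ y, (v' a).testBit y = if y < U then false else if y = U then true else
      (v a).testBit y)
    (hne : ∀ b, b ≠ a → v' b = v b) :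
    (toggle a true).Computes w (Bounded w) ⟨x, trackTape U v, 0⟩ true
      ⟨x, trackTape (U + 1) v', 0⟩ := by
  have ht : ∀ y < U, trackTape U v y = some (fun a => (v a).testBit y, decide (y = 0)) :=
    fun y hy => if_pos hy
  have htU : trackTape U v U = none := if_neg (lt_irrefl _)
  have hU1 : decide (U = 0) = false := by simp; omega
  refine (computes_scan (y := 0) (z := U) a false x _ (Nat.zero_le U) hU
    (fun y _ hy => ⟨_, _, ht y hy, by simp [hlow y hy]⟩)
    (fun d s hd => by simp [htU] at hd)).bind ?_
  refine (Routine.computes_perform (a := (some (fun b => decide (b = a), false), .stay, .left))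
    (o := some false) (σ' := (⟨x, Function.update (trackTape U v) U
      (some (fun b => decide (b = a), false)), U - 1⟩ : TapeStore (Cell H)))
    ?_ rfl hU ?_).bind ?_
  · simp [htU]
  · simp only [Bounded]; omega
  refine (computes_rewind (y := U - 1) _ x _ (fun y a => (v a).testBit y) (by omega)
    fun y hy => ?_).bind ?_
  · rw [Function.update_of_ne (by omega), ht y (by omega)]
  · refine (Routine.computes_look rfl (Nat.succ_pos _)).congr_left
      (congrArg (fun t' => (⟨_, t', 0⟩ : TapeStore (Cell H))) (funext fun y => ?_))
    rcases lt_trichotomy y U with hy | rfl | hy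
    · rw [if_pos (by omega), trackTape, if_pos (by omega)]
      congr 2
      funext b
      rcases eq_or_ne b a with rfl | hb
      · simp [hv', hy]
      · simp [hb, hne]
    · rw [if_neg (by omega), Function.update_self, trackTape, if_pos (by omega), hU1]
      congr 2
      funext b
      rcases eq_or_ne b a with rfl | hb
      · simp [hv']
      · rw [hne b hb, Nat.testBit_lt_two_pow (hv b)]
        simp [hb]
    · rw [if_neg (by omega), Function.update_of_ne (by omega), trackTape, trackTape,
        if_neg (by omega), if_neg (by omega)]

theorem computes_toggle_of_zero (a : H) (x : ℕ) {U : ℕ} {v : H → ℕ} (hU0 : 1 ≤ U)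
    (hU : U < Nat.log 2 w.length + 3) (hlow : v a = 0) :
    (toggle a false).Computes w (Bounded w) ⟨x, trackTape U v, 0⟩ false
      ⟨x, trackTape U v, 0⟩ := by
  have ht : ∀ y < U, trackTape U v y = some (fun a => (v a).testBit y, decide (y = 0)) :=
    fun y hy => if_pos hy
  have htU : trackTape U v U = none := if_neg (lt_irrefl _)
  refine (computes_scan (y := 0) (z := U) a true x _ (Nat.zero_le U) hU
    (fun y _ hy => ⟨_, _, ht y hy, by simp [hlow]⟩)
    (fun d s hd => by simp [htU] at hd)).bind ?_
  refine (Routine.computes_perform (a := (none, .stay, .left))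
    (o := none) (σ' := (⟨x, trackTape U v, U - 1⟩ : TapeStore (Cell H)))
    ?_ ?_ hU ?_).bind ?_
  · simp [htU]
  · rw [TapeStore.mk.injEq]
    exact ⟨rfl, by rw [← htU]; exact Function.update_eq_self _ _, rfl⟩
  · simp only [Bounded]; omega
  refine (computes_rewind (y := U - 1) _ x _ (fun y a => (v a).testBit y) (by omega)
    fun y hy => ht y (by omega)).bind ?_
  refine (Routine.computes_look rfl (Nat.succ_pos _)).congr_left
    (congrArg (fun t' => (⟨_, t', 0⟩ : TapeStore (Cell H))) (funext fun y => ?_))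
  by_cases hy : y < U
  · rw [if_pos (by omega), ht y hy]
    rfl
  · rw [if_neg (by omega)]

theorem exists_first_bit {v U : ℕ} {b : Bool} (h : ∃ x < U, v.testBit x = b) :
    ∃ z < U, v.testBit z = b ∧ ∀ x < z, v.testBit x = !b := by
  classical
  obtain ⟨x, hx, hb⟩ := h
  have h : ∃ x, v.testBit x = b := ⟨x, hb⟩
  refine ⟨Nat.find h, lt_of_le_of_lt (Nat.find_min' h hb) hx, Nat.find_spec h, fun y hy => ?_⟩
  have := Nat.find_min h hy
  cases b <;> simpa using this

theorem computes_inc (a : H) {x : ℕ} {v : H → ℕ} {σ : TapeStore (Cell H)} (hσ : Rep w x v σ)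
    (hv : v a ≤ w.length) :
    ∃ σ', (toggle a true).Computes w (Bounded w) σ true σ' ∧
      Rep w x (Function.update v a (v a + 1)) σ' := by
  obtain ⟨U, hU, hU', hb, rfl⟩ := hσ
  have hB := lt_bound hU'
  by_cases hex : ∃ x < U, (v a).testBit x = false
  · obtain ⟨z, hz, hz1, hz2⟩ := exists_first_bit hex
    have hbit := Nat.testBit_add_one_of_forall hz2 hz1
    refine ⟨_, computes_toggle_of_found (v' := Function.update v a (v a + 1)) a true x hB hz hz1
      (by simpa using hz2) (by simpa using hbit)
      (fun b hb => Function.update_of_ne hb _ _), U, hU, hU', fun b => ?_, rfl⟩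
    rcases eq_or_ne b a with rfl | hb'
    · rw [Function.update_self]
      refine Nat.lt_pow_two_of_testBit _ fun i hi => ?_
      rw [hbit, if_neg (by omega), if_neg (by omega)]
      exact Nat.testBit_lt_two_pow (lt_of_lt_of_le (hb b) (Nat.pow_le_pow_right two_pos hi))
    · rw [Function.update_of_ne hb']
      exact hb b
  · have hlow : ∀ y < U, (v a).testBit y = true := by simpa using hex
    have hbit := Nat.testBit_add_one_of_forall hlow (Nat.testBit_lt_two_pow (hb a))
    refine ⟨_, computes_toggle_of_overflow (v' := Function.update v a (v a + 1)) a x hU hB hlow hb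
      (by simpa using hbit) (fun b hb => Function.update_of_ne hb _ _), U + 1, by omega, ?_,
      fun b => ?_, rfl⟩
    -- The digit `U` of the new value is set. With `v a ≤ w.length` this is the size condition of
    -- `Rep` for `U + 1` cells.
    · have h1 : 2 ^ U ≤ v a + 1 := by
        refine Nat.ge_two_pow_of_testBit ?_
        rw [hbit, if_neg (lt_irrefl _), if_pos rfl]
      rw [Nat.add_sub_cancel]
      omega
    · rw [pow_succ]
      have := hb b
      have := hb a
      rcases eq_or_ne b a with rfl | hb'
      · rw [Function.update_self]; omega
      · rw [Function.update_of_ne hb']; omega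

theorem computes_dec (a : H) {x : ℕ} {v : H → ℕ} {σ : TapeStore (Cell H)} (hσ : Rep w x v σ)
    (hv : v a ≠ 0) :
    ∃ σ', (toggle a false).Computes w (Bounded w) σ true σ' ∧
      Rep w x (Function.update v a (v a - 1)) σ' := by
  obtain ⟨U, hU, hU', hb, rfl⟩ := hσ
  have hB := lt_bound hU'
  have hex : ∃ x < U, (v a).testBit x = true := by
    obtain ⟨i, hi⟩ := Nat.exists_testBit_of_ne_zero hv
    refine ⟨i, ?_, hi⟩
    by_contra h
    rw [Nat.testBit_lt_two_pow (lt_of_lt_of_le (hb a)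
      (Nat.pow_le_pow_right two_pos (not_lt.1 h)))] at hi
    simp at hi
  obtain ⟨z, hz, hz1, hz2⟩ := exists_first_bit hex
  refine ⟨_, computes_toggle_of_found (v' := Function.update v a (v a - 1)) a false x hB hz hz1
    (by simpa using hz2) (by simpa using Nat.testBit_sub_one_of_forall hz2 hz1)
    (fun b hb => Function.update_of_ne hb _ _), U, hU, hU', fun b => ?_, rfl⟩
  have := hb b
  rcases eq_or_ne b a with rfl | hb'
  · rw [Function.update_self]; omega
  · rwa [Function.update_of_ne hb']

theorem computes_dec_zero (a : H) {x : ℕ} {v : H → ℕ} {σ : TapeStore (Cell H)}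
    (hσ : Rep w x v σ) (hv : v a = 0) :
    (toggle a false).Computes w (Bounded w) σ false σ := by
  obtain ⟨U, hU, hU', hb, rfl⟩ := hσ
  exact computes_toggle_of_zero a x hU (lt_bound hU') hv

end Tracks

/-! ### Multihead automata in logarithmic space -/

namespace Tracks

variable {H : Type} {w : List Bool}

/-- Move the input head. -/
def moveInput (m : Move) {O : Type} [Finite O] (o : O) : Routine (tapeDevice (Cell H)) O :=
  Routine.perform fun v : TapeSymbol × Cell H => ((v.2, m, .stay), o)

theorem computes_moveInput (m : Move) {O : Type} [Finite O] (o : O) {x : ℕ} {v : H → ℕ}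
    {σ : TapeStore (Cell H)} (hσ : Rep w x v σ) :
    ∃ σ', (moveInput m o).Computes w (Bounded w) σ o σ' ∧ Rep w (m.onInput w x) v σ' := by
  obtain ⟨U, hU, hU', hb, rfl⟩ := hσ
  refine ⟨_, Routine.computes_perform (a := (trackTape U v 0, m, .stay)) rfl ?_ (Nat.succ_pos _)
    (Nat.succ_pos _), U, hU, hU', hb, rfl⟩
  simp [Move.onTape]

theorem Rep.bounded {x : ℕ} {v : H → ℕ} {σ : TapeStore (Cell H)} (hσ : Rep w x v σ) :
    Bounded w σ := by
  obtain ⟨U, hU, hU', hb, rfl⟩ := hσ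
  exact Nat.succ_pos _

theorem Rep.inputHead {x : ℕ} {v : H → ℕ} {σ : TapeStore (Cell H)} (hσ : Rep w x v σ) :
    σ.inputHead = x := by
  obtain ⟨U, hU, hU', hb, rfl⟩ := hσ
  rfl


/-- Write the mark of the first cell. -/
def initialise : Routine (tapeDevice (Cell H)) Unit :=
  Routine.perform fun _ => ((some (fun _ => false, true), .stay, .stay), ())

theorem computes_initialise :
    ∃ σ', (initialise (H := H)).Computes w (Bounded w) ⟨0, fun _ => none, 0⟩ () σ' ∧
      Rep w 0 (fun _ => 0) σ' := by
  refine ⟨⟨0, trackTape 1 fun _ => 0, 0⟩, Routine.computes_perform rfl ?_ (Nat.succ_pos _)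
    (Nat.succ_pos _), 1, le_rfl, by simp, fun _ => by simp, rfl⟩
  refine congrArg (fun t => (⟨0, t, 0⟩ : TapeStore (Cell H))) (funext fun x => ?_)
  rcases Nat.eq_zero_or_pos x with rfl | hx
  · simp [trackTape]
  · rw [Function.update_of_ne hx.ne', trackTape, if_neg (by omega)]

variable [DecidableEq H]

/-- Move the input head to the right by the value of a counter, which becomes `0`. -/
def sendHead (a : H) : Routine (tapeDevice (Cell H)) Unit :=
  Routine.loop ((toggle a false).bind fun b =>
    if b then moveInput .right (.inl ()) else Routine.look fun _ => .inr ())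

/-- The sum `x + v a` is conserved, and its bound keeps the head from being stopped at the right
end. -/
theorem computes_sendHead (a : H) {x y : ℕ} {v : H → ℕ} {σ : TapeStore (Cell H)}
    (hσ : Rep w x v σ) (hy : x + v a = y) (hy' : y ≤ w.length + 1) :
    ∃ σ', (sendHead a).Computes w (Bounded w) σ () σ' ∧ Rep w y (Function.update v a 0) σ' := by
  generalize hm : v a = m at hy
  induction m generalizing x v σ with
  | zero =>
    refine ⟨σ, Routine.computes_loop_done ((computes_dec_zero a hσ hm).bind
      (Routine.computes_look rfl hσ.bounded)), ?_⟩
    rwa [← hm, Function.update_eq_self, ← hy]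
  | succ m ih =>
    obtain ⟨σ₁, h1, hσ₁⟩ := computes_dec a hσ (by omega)
    obtain ⟨σ₂, h2, hσ₂⟩ := computes_moveInput .right (Sum.inl () : Unit ⊕ Unit) hσ₁
    have e : Move.right.onInput w x = x + 1 := by simp [Move.onInput]; omega
    rw [e] at hσ₂
    obtain ⟨σ₃, h3, hσ₃⟩ := ih hσ₂ (by simp [hm]) (by omega)
    exact ⟨σ₃, Routine.computes_loop_step (h1.bind h2) h3, by simpa using hσ₃⟩

/-- Move the input head back to the left end, and add its position to a counter. -/
def fetchHead (a : H) : Routine (tapeDevice (Cell H)) Unit :=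
  Routine.loop ((Routine.look fun v : TapeSymbol × Cell H => match v.1 with
      | .left => true
      | _ => false).bind fun b =>
    if b then Routine.look fun _ => .inr () else
      (moveInput .left ()).bind fun _ => (toggle a true).bind fun _ =>
        Routine.look fun _ => .inl ())

/-- The same sum is conserved in the other direction. As long as the head is not at the left end it
gives `v a ≤ w.length`, which the increment requires. -/
theorem computes_fetchHead (a : H) {x y : ℕ} {v : H → ℕ} {σ : TapeStore (Cell H)}
    (hσ : Rep w x v σ) (hy : x + v a = y) (hy' : y ≤ w.length + 1) :
    ∃ σ', (fetchHead a).Computes w (Bounded w) σ () σ' ∧ Rep w 0 (Function.update v a y) σ' := by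
  induction x generalizing v σ with
  | zero =>
    refine ⟨σ, Routine.computes_loop_done (Routine.Computes.bind (Routine.computes_look (o := true)
      ?_ hσ.bounded) (Routine.computes_look rfl hσ.bounded)), ?_⟩
    · simp [hσ.inputHead, readTape]
    · rwa [← hy, Nat.zero_add, Function.update_eq_self]
  | succ x ih =>
    obtain ⟨σ₁, h1, hσ₁⟩ := computes_moveInput .left () hσ
    rw [show Move.left.onInput w (x + 1) = x from rfl] at hσ₁
    obtain ⟨σ₂, h2, hσ₂⟩ := computes_inc a hσ₁ (by omega)
    obtain ⟨σ₃, h3, hσ₃⟩ := ih hσ₂ (by rw [Function.update_self]; omega)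
    refine ⟨σ₃, Routine.computes_loop_step (Routine.Computes.bind (Routine.computes_look
      (o := false) ?_ hσ.bounded) (h1.bind (h2.bind (Routine.computes_look rfl hσ₂.bounded)))) h3,
      by simpa using hσ₃⟩
    have h := mt (readTape_eq_left_iff w (x + 1)).1 (Nat.succ_ne_zero x)
    simp only [hσ.inputHead]

/-- Move the head whose position is held by a counter, and return the symbol at its new
position. -/
def moveCounter (a : H) (m : Move) : Routine (tapeDevice (Cell H)) TapeSymbol :=
  (sendHead a).bind fun _ => (moveInput m ()).bind fun _ =>
    (Routine.look fun v : TapeSymbol × Cell H => v.1).bind fun s =>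
      (fetchHead a).bind fun _ => Routine.look fun _ => s

/-- A counter gives no access to the input, so the single input head is sent to the position, moved
and read there, and its position is taken back into the counter. -/
theorem computes_moveCounter (a : H) (m : Move) {v : H → ℕ} {σ : TapeStore (Cell H)}
    (hσ : Rep w 0 v σ) (hv : v a ≤ w.length + 1) :
    ∃ σ', (moveCounter a m).Computes w (Bounded w) σ (readTape w (m.onInput w (v a))) σ' ∧
      Rep w 0 (Function.update v a (m.onInput w (v a))) σ' := by
  obtain ⟨σ₁, h1, hσ₁⟩ := computes_sendHead a hσ (Nat.zero_add _) hv
  obtain ⟨σ₂, h2, hσ₂⟩ := computes_moveInput m () hσ₁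
  obtain ⟨σ₃, h3, hσ₃⟩ := computes_fetchHead a hσ₂ rfl
    (by simpa using Move.onInput_le w m hv)
  refine ⟨σ₃, h1.bind (h2.bind (Routine.Computes.bind (Routine.computes_look rfl hσ₂.bounded)
    (h3.bind (Routine.computes_look ?_ hσ₃.bounded)))), by simpa using hσ₃⟩
  exact congrArg (readTape w) hσ₂.inputHead

/-- Move all heads of a list, and update the symbols at their positions. -/
def moveCounters (m : H → Move) [Finite H] :
    List H → (H → TapeSymbol) → Routine (tapeDevice (Cell H)) (H → TapeSymbol)
  | [], s => Routine.look fun _ => s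
  | a :: l, s => (moveCounter a (m a)).bind fun c => moveCounters m l (Function.update s a c)

theorem computes_moveCounters [Finite H] (m : H → Move) (l : List H) (hl : l.Nodup) {v : H → ℕ}
    {σ : TapeStore (Cell H)} (hσ : Rep w 0 v σ) (hv : ∀ a, v a ≤ w.length + 1) :
    ∃ σ', (moveCounters m l fun a => readTape w (v a)).Computes w (Bounded w) σ
        (fun a => readTape w (if a ∈ l then (m a).onInput w (v a) else v a)) σ' ∧
      Rep w 0 (fun a => if a ∈ l then (m a).onInput w (v a) else v a) σ' := by
  induction l generalizing v σ with
  | nil => exact ⟨σ, Routine.computes_look (by simp) hσ.bounded, by simpa using hσ⟩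
  | cons a l ih =>
    rw [List.nodup_cons] at hl
    obtain ⟨σ₁, h1, hσ₁⟩ := computes_moveCounter a (m a) hσ (hv a)
    obtain ⟨σ₂, h2, hσ₂⟩ := ih hl.2 hσ₁ (fun b => by
      rcases eq_or_ne b a with rfl | hb
      · simpa using Move.onInput_le w (m b) (hv b)
      · simpa [hb] using hv b)
    have e : (fun b => if b ∈ l then (m b).onInput w (Function.update v a ((m a).onInput w (v a)) b)
        else Function.update v a ((m a).onInput w (v a)) b) =
        fun b => if b ∈ a :: l then (m b).onInput w (v b) else v b := by
      funext b
      rcases eq_or_ne b a with rfl | hb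
      · simp [hl.1]
      · simp [hb]
    have e' : (fun b => readTape w (Function.update v a ((m a).onInput w (v a)) b)) =
        Function.update (fun a => readTape w (v a)) a (readTape w ((m a).onInput w (v a))) := by
      funext b
      rcases eq_or_ne b a with rfl | hb
      · simp
      · simp [hb]
    rw [e] at hσ₂
    rw [e'] at h2
    refine ⟨σ₂, h1.bind ?_, hσ₂⟩
    convert h2 using 2
    exact congrArg (readTape w) (congrFun e _).symm

/-- The simulation of one step of a multihead automaton. -/
noncomputable def automatonStep {k : ℕ} (M : TwoWayDFA k) : Option (M.Q × (Fin k → TapeSymbol)) →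
    Routine (tapeDevice (Cell (Fin k))) (Option (M.Q × (Fin k → TapeSymbol)) ⊕ Bool)
  -- The index `none` precedes the simulation, when the blank tape has no mark yet. Later indices
  -- carry the symbols at all heads, which one input head cannot read together.
  | none => initialise.bind fun _ => Routine.look fun _ => .inl (some (M.start, fun _ => .left))
  | some (q, s) => match M.δ q s with
    | none => Routine.look fun _ => .inr (@decide (q ∈ M.accept) (Classical.dec _))
    | some (q', m) => (moveCounters m (List.finRange k) s).bind fun s' =>
        Routine.look fun _ => .inl (some (q', s'))

/-- The transitions of an automaton, after a first step to its initial configuration. -/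
def automatonNext {k : ℕ} (M : TwoWayDFA k) (w : List Bool) :
    Option (M.Q × (Fin k → ℕ)) → Option (Option (M.Q × (Fin k → ℕ)))
  | none => some (some (M.start, fun _ => 0))
  | some c => (M.next w c).map some

theorem accFrom_automatonNext {k : ℕ} (M : TwoWayDFA k) (w : List Bool) :
    AccFrom (automatonNext M w) (fun c => ∃ d, c = some d ∧ d.1 ∈ M.accept) none ↔
      M.Accepts w := by
  have h : AccFrom (automatonNext M w) (fun c => ∃ d, c = some d ∧ d.1 ∈ M.accept)
      (some (M.start, fun _ => 0)) ↔ M.Accepts w :=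
    (accFrom_map (next' := automatonNext M w) some (fun _ => rfl) (fun c => by simp) _).trans
      (accFrom_iff (M.next w) (fun c => c.1 ∈ M.accept) _)
  rw [← h]
  constructor
  · intro h
    cases h with
    | halt h => simp [automatonNext] at h
    | step h h' =>
      simp only [automatonNext, Option.some.injEq] at h
      subst h
      exact h'
  · exact fun h => .step rfl h

instance {k : ℕ} (M : TwoWayDFA k) : Finite M.Q := M.finite_Q

theorem simulates_automatonStep {k : ℕ} (M : TwoWayDFA k) (w : List Bool) :
    Routine.Simulates (automatonStep M) w (Bounded w) (automatonNext M w)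
      (fun c => ∃ d, c = some d ∧ d.1 ∈ M.accept)
      (fun c i σ => match c with
        | none => i = none ∧ σ = ⟨0, fun _ => none, 0⟩
        | some (q, p) => i = some (q, fun a => readTape w (p a)) ∧ Rep w 0 p σ ∧
            ∀ a, p a ≤ w.length + 1) := by
  rintro (_ | ⟨q, p⟩) i σ h
  · obtain ⟨rfl, rfl⟩ := h
    obtain ⟨σ', h1, hσ'⟩ := computes_initialise (H := Fin k) (w := w)
    refine ⟨fun c' hc => ?_, fun h => by simp [automatonNext] at h⟩
    simp only [automatonNext, Option.some.injEq] at hc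
    subst hc
    exact ⟨_, σ', ⟨rfl, hσ', fun _ => Nat.zero_le _⟩,
      h1.bind (Routine.computes_look rfl hσ'.bounded)⟩
  · obtain ⟨rfl, hσ, hp⟩ := h
    simp only [automatonNext, automatonStep, TwoWayDFA.next]
    cases hd : M.δ q fun a => readTape w (p a) with
    | none =>
      refine ⟨by simp, fun _ => ⟨_, σ, ?_, Routine.computes_look rfl hσ.bounded⟩⟩
      simp
    | some r =>
      refine ⟨fun c' hc => ?_, by simp⟩
      simp only [Option.map_some, Option.some.injEq] at hc
      subst hc
      obtain ⟨σ', h1, hσ'⟩ := computes_moveCounters r.2 (List.finRange k)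
        (List.nodup_finRange k) hσ hp
      simp only [List.mem_finRange, if_true] at h1 hσ'
      exact ⟨_, σ', ⟨rfl, hσ', fun a => Move.onInput_le w _ (hp a)⟩,
        h1.bind (Routine.computes_look rfl hσ'.bounded)⟩

end Tracks

theorem twoWayDFAClass_subset_logspace : twoWayDFAClass ⊤ ⊆ Logspace := by
  rintro _ ⟨k, -, -, M, rfl⟩
  obtain ⟨T, hT, hT'⟩ := Routine.exists_offlineTM (none : Tracks.Cell (Fin k))
    (Routine.iter (Tracks.automatonStep M) none)
  -- The constant comes from `Nat.log 2 w.length + 3 ≤ 3 * (Nat.log 2 w.length + 1)`.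
  refine ⟨T, ⟨3, fun w c hc => ?_⟩, ?_⟩
  · have := hT' w _ (fun n => (Tracks.simulates_automatonStep M w).safe none n
      (c := none) ⟨rfl, rfl⟩) c hc
    omega
  · ext w
    refine Iff.trans ?_ (hT w).symm
    refine (Tracks.accFrom_automatonNext M w).symm.trans ?_
    exact (((Tracks.simulates_automatonStep M w).mono fun _ _ => trivial).computes_iff
      (c := none) ⟨rfl, rfl⟩).symm

/-! ### Counters held by several heads -/

namespace HeadCounter

variable {H : Type} {w : List Bool}

/-- The trivial invariant. -/
abbrev Anything {H : Type} (_ : H → ℕ) : Prop := True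

/-- Test the symbol at a head. -/
noncomputable def test (a : H) (s : TapeSymbol) : Routine (headDevice H) Bool :=
  Routine.look fun v => @decide (v a = s) (Classical.dec _)

theorem computes_test (a : H) (s : TapeSymbol) {σ : H → ℕ} {b : Bool}
    (h : readTape w (σ a) = s ↔ b = true) : (test a s).Computes w Anything σ b σ := by
  refine Routine.computes_look ?_ trivial
  rw [Bool.eq_iff_iff, ← h]
  simp

/-- The number whose digits, lowest first, are the positions of the heads of a list. -/
def val (w : List Bool) (σ : H → ℕ) : List H → ℕ
  | [] => 0
  | a :: l => σ a + (w.length + 2) * val w σ l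

theorem val_congr {σ σ' : H → ℕ} {l : List H} (h : ∀ a ∈ l, σ a = σ' a) :
    val w σ l = val w σ' l := by
  induction l with
  | nil => rfl
  | cons a l ih =>
    rw [val, val, h a (by simp), ih fun b hb => h b (by simp [hb])]

theorem val_eq_zero_iff {σ : H → ℕ} {l : List H} : val w σ l = 0 ↔ ∀ a ∈ l, σ a = 0 := by
  induction l with
  | nil => simp [val]
  | cons a l ih => simp [val, ih]

variable [DecidableEq H]

/-- Move one head. -/
def moveHead (a : H) (m : Move) {O : Type} [Finite O] (o : O) : Routine (headDevice H) O :=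
  Routine.perform fun _ => (Function.update (fun _ => Move.stay) a m, o)

theorem computes_moveHead (a : H) (m : Move) {O : Type} [Finite O] (o : O) (σ : H → ℕ) :
    (moveHead a m o).Computes w Anything σ o (Function.update σ a (m.onInput w (σ a))) := by
  refine Routine.computes_perform rfl (funext fun b => ?_) trivial trivial
  rcases eq_or_ne b a with rfl | hb
  · simp
  · simp [hb, Move.onInput]

/-- Move a head to the left end. -/
noncomputable def rewindHead (a : H) : Routine (headDevice H) Unit :=
  Routine.loop ((test a .left).bind fun b =>
    if b then Routine.look fun _ => .inr () else moveHead a .left (.inl ()))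

theorem computes_rewindHead (a : H) (σ : H → ℕ) :
    (rewindHead a).Computes w Anything σ () (Function.update σ a 0) := by
  generalize hx : σ a = x
  induction x generalizing σ with
  | zero =>
    rw [← hx, Function.update_eq_self]
    exact Routine.computes_loop_done ((computes_test a .left (b := true)
      (by simp [readTape_eq_left_iff, hx])).bind (Routine.computes_look rfl trivial))
  | succ x ih =>
    have h := computes_moveHead (w := w) a .left (Sum.inl () : Unit ⊕ Unit) σ
    have h' := ih (Function.update σ a (Move.left.onInput w (σ a))) (by simp [Move.onInput, hx])
    rw [Function.update_idem] at h'
    exact Routine.computes_loop_step ((computes_test a .left (b := false)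
      (by simp [readTape_eq_left_iff, hx])).bind h) h'

/-- Move a head to the right end. -/
noncomputable def forwardHead (a : H) : Routine (headDevice H) Unit :=
  Routine.loop ((test a .right).bind fun b =>
    if b then Routine.look fun _ => .inr () else moveHead a .right (.inl ()))

theorem computes_forwardHead (a : H) (σ : H → ℕ) (hσ : σ a ≤ w.length + 1) :
    (forwardHead a).Computes w Anything σ () (Function.update σ a (w.length + 1)) := by
  generalize hx : w.length + 1 - σ a = x
  induction x generalizing σ with
  | zero =>
    rw [show w.length + 1 = σ a by omega, Function.update_eq_self]
    exact Routine.computes_loop_done ((computes_test a .right (b := true)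
      (by simp [readTape_eq_right_iff]; omega)).bind (Routine.computes_look rfl trivial))
  | succ x ih =>
    have h := computes_moveHead (w := w) a .right (Sum.inl () : Unit ⊕ Unit) σ
    have h' := ih (Function.update σ a (Move.right.onInput w (σ a)))
      (by simp [Move.onInput]) (by simp [Move.onInput]; omega)
    rw [Function.update_idem] at h'
    exact Routine.computes_loop_step ((computes_test a .right (b := false)
      (by simp [readTape_eq_right_iff]; omega)).bind h) h'

/-- Increment the number held by a list of heads. -/
noncomputable def incList : List H → Routine (headDevice H) Unit
  | [] => Routine.look fun _ => ()
  | a :: l => (test a .right).bind fun b =>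
      if b then (rewindHead a).bind fun _ => incList l else moveHead a .right ()

/-- The largest digit in base `|w| + 2` is a head at `◁`; it returns to `▷` and the carry passes to
the next head. `hv` excludes a carry out of the list. -/
theorem computes_incList (l : List H) (hl : l.Nodup) (σ : H → ℕ) (hσ : ∀ a, σ a ≤ w.length + 1)
    (hv : val w σ l + 1 < (w.length + 2) ^ l.length) :
    ∃ σ', (incList l).Computes w Anything σ () σ' ∧ val w σ' l = val w σ l + 1 ∧
      (∀ a ∉ l, σ' a = σ a) ∧ ∀ a, σ' a ≤ w.length + 1 := by
  induction l generalizing σ with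
  | nil => simp [val] at hv
  | cons a l ih =>
    rw [List.nodup_cons] at hl
    by_cases ha : σ a = w.length + 1
    · have hval : val w (Function.update σ a 0) l = val w σ l :=
        val_congr fun b hb => Function.update_of_ne (by rintro rfl; exact hl.1 hb) _ _
      obtain ⟨σ', h1, h2, h3, h4⟩ := ih hl.2 (Function.update σ a 0) (fun b => by
          rcases eq_or_ne b a with rfl | hb
          · simp
          · simpa [hb] using hσ b) (by
          rw [hval]
          rw [val, List.length_cons, pow_succ, ha] at hv
          by_contra hcon
          nlinarith)
      refine ⟨σ', (computes_test a .right (b := true)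
        (by simp [readTape_eq_right_iff, ha])).bind ((computes_rewindHead a σ).bind h1), ?_, ?_, h4⟩
      · rw [val, val, h2, hval, h3 a hl.1, ha, Function.update_self]
        ring
      · intro b hb
        rw [h3 b (by simp at hb; exact hb.2), Function.update_of_ne (by simp at hb; exact hb.1)]
    · have := hσ a
      have e : Move.right.onInput w (σ a) = σ a + 1 := by simp [Move.onInput]; omega
      refine ⟨_, (computes_test a .right (b := false)
        (by simp [readTape_eq_right_iff]; omega)).bind (computes_moveHead a .right () σ), ?_, ?_, ?_⟩
      · rw [val, val, Function.update_self, e, val_congr (σ' := σ) fun b hb =>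
          Function.update_of_ne (by rintro rfl; exact hl.1 hb) _ _]
        ring
      · intro b hb
        rw [Function.update_of_ne (by simp at hb; exact hb.1)]
      · intro b
        rcases eq_or_ne b a with rfl | hb
        · rw [Function.update_self, e]; omega
        · simpa [hb] using hσ b

/-- Decrement the number held by a list of heads. -/
noncomputable def decList : List H → Routine (headDevice H) Unit
  | [] => Routine.look fun _ => ()
  | a :: l => (test a .left).bind fun b =>
      if b then (forwardHead a).bind fun _ => decList l else moveHead a .left ()

theorem computes_decList (l : List H) (hl : l.Nodup) (σ : H → ℕ) (hσ : ∀ a, σ a ≤ w.length + 1)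
    (hv : val w σ l ≠ 0) :
    ∃ σ', (decList l).Computes w Anything σ () σ' ∧ val w σ' l = val w σ l - 1 ∧
      (∀ a ∉ l, σ' a = σ a) ∧ ∀ a, σ' a ≤ w.length + 1 := by
  induction l generalizing σ with
  | nil => simp [val] at hv
  | cons a l ih =>
    rw [List.nodup_cons] at hl
    by_cases ha : σ a = 0
    · have hval : val w (Function.update σ a (w.length + 1)) l = val w σ l :=
        val_congr fun b hb => Function.update_of_ne (by rintro rfl; exact hl.1 hb) _ _
      have hv' : val w σ l ≠ 0 := by
        intro h
        simp [val, h, ha] at hv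
      obtain ⟨σ', h1, h2, h3, h4⟩ := ih hl.2 (Function.update σ a (w.length + 1)) (fun b => by
          rcases eq_or_ne b a with rfl | hb
          · simp
          · simpa [hb] using hσ b) (by rwa [hval])
      refine ⟨σ', (computes_test a .left (b := true)
        (by simp [readTape_eq_left_iff, ha])).bind
          ((computes_forwardHead a σ (hσ a)).bind h1), ?_, ?_, h4⟩
      · rw [val, val, h2, hval, h3 a hl.1, ha, Function.update_self]
        obtain ⟨m, hm⟩ := Nat.exists_eq_succ_of_ne_zero hv'
        rw [hm, Nat.succ_sub_one, Nat.mul_succ]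
        omega
      · intro b hb
        rw [h3 b (by simp at hb; exact hb.2), Function.update_of_ne (by simp at hb; exact hb.1)]
    · have e : Move.left.onInput w (σ a) = σ a - 1 := rfl
      refine ⟨_, (computes_test a .left (b := false)
        (by simp [readTape_eq_left_iff]; omega)).bind (computes_moveHead a .left () σ), ?_, ?_, ?_⟩
      · rw [val, val, Function.update_self, e, val_congr (σ' := σ) fun b hb =>
          Function.update_of_ne (by rintro rfl; exact hl.1 hb) _ _]
        omega
      · intro b hb
        rw [Function.update_of_ne (by simp at hb; exact hb.1)]
      · intro b
        have := hσ b
        rcases eq_or_ne b a with rfl | hb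
        · rw [Function.update_self, e]; omega
        · simpa [hb] using hσ b

end HeadCounter

namespace HeadCounter

/-! ### An input head and three counters -/

/-- One head for the input and three groups of `c` heads. -/
abbrev Heads (c : ℕ) : Type := Option (Fin 3 × Fin c)

/-- The heads of a counter. -/
def group (c : ℕ) (j : Fin 3) : List (Heads c) := (List.finRange c).map fun i => some (j, i)

theorem group_nodup (c : ℕ) (j : Fin 3) : (group c j).Nodup :=
  (List.nodup_finRange c).map fun i i' h => by simpa using h

theorem mem_group {c : ℕ} {j : Fin 3} {a : Heads c} : a ∈ group c j ↔ ∃ i, a = some (j, i) := by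
  simp [group, eq_comm]

theorem group_length (c : ℕ) (j : Fin 3) : (group c j).length = c := by simp [group]

variable {c : ℕ} {w : List Bool}

/-- The input head is at `x` and the counters have the values `v`. -/
def Rep (w : List Bool) (x : ℕ) (v : Fin 3 → ℕ) (σ : Heads c → ℕ) : Prop :=
  (∀ a, σ a ≤ w.length + 1) ∧ σ none = x ∧ ∀ j, val w σ (group c j) = v j

theorem Rep.update {x : ℕ} {v : Fin 3 → ℕ} {σ σ' : Heads c → ℕ} (hσ : Rep w x v σ) {j : Fin 3}
    {n : ℕ} (h1 : val w σ' (group c j) = n) (h2 : ∀ a ∉ group c j, σ' a = σ a)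
    (h3 : ∀ a, σ' a ≤ w.length + 1) : Rep w x (Function.update v j n) σ' := by
  refine ⟨h3, (h2 _ (by simp [mem_group])).trans hσ.2.1, fun i => ?_⟩
  rcases eq_or_ne i j with rfl | hi
  · rw [h1, Function.update_self]
  · rw [Function.update_of_ne hi, ← hσ.2.2 i]
    refine val_congr fun a ha => h2 a fun ha' => hi ?_
    obtain ⟨_, rfl⟩ := mem_group.1 ha
    obtain ⟨_, h⟩ := mem_group.1 ha'
    simp at h
    exact h.1

theorem computes_inc {x : ℕ} {v : Fin 3 → ℕ} {σ : Heads c → ℕ} (hσ : Rep w x v σ) (j : Fin 3)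
    (hv : v j + 1 < (w.length + 2) ^ c) :
    ∃ σ', (incList (group c j)).Computes w Anything σ () σ' ∧
      Rep w x (Function.update v j (v j + 1)) σ' := by
  obtain ⟨σ', h1, h2, h3, h4⟩ := computes_incList (group c j) (group_nodup c j) σ hσ.1
    (by rwa [hσ.2.2, group_length])
  rw [hσ.2.2] at h2
  exact ⟨σ', h1, hσ.update h2 h3 h4⟩

theorem computes_dec {x : ℕ} {v : Fin 3 → ℕ} {σ : Heads c → ℕ} (hσ : Rep w x v σ) (j : Fin 3)
    (hv : v j ≠ 0) :
    ∃ σ', (decList (group c j)).Computes w Anything σ () σ' ∧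
      Rep w x (Function.update v j (v j - 1)) σ' := by
  obtain ⟨σ', h1, h2, h3, h4⟩ := computes_decList (group c j) (group_nodup c j) σ hσ.1
    (by rwa [hσ.2.2])
  rw [hσ.2.2] at h2
  exact ⟨σ', h1, hσ.update h2 h3 h4⟩

/-- Test whether a counter is `0`. -/
noncomputable def isZero (c : ℕ) (j : Fin 3) : Routine (headDevice (Heads c)) Bool :=
  Routine.look fun v => @decide (∀ a ∈ group c j, v a = .left) (Classical.dec _)

theorem computes_isZero {x : ℕ} {v : Fin 3 → ℕ} {σ : Heads c → ℕ} (hσ : Rep w x v σ) (j : Fin 3)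
    {b : Bool} (hb : v j = 0 ↔ b = true) : (isZero c j).Computes w Anything σ b σ := by
  refine Routine.computes_look ?_ trivial
  rw [Bool.eq_iff_iff, ← hb, ← hσ.2.2, val_eq_zero_iff]
  simp [readTape_eq_left_iff]

theorem computes_moveInput {x : ℕ} {v : Fin 3 → ℕ} {σ : Heads c → ℕ} (hσ : Rep w x v σ)
    (m : Move) : ∃ σ', (moveHead none m ()).Computes w Anything σ () σ' ∧
      Rep w (m.onInput w x) v σ' := by
  refine ⟨_, computes_moveHead none m () σ, fun a => ?_, by simp [hσ.2.1], fun j => ?_⟩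
  · rcases eq_or_ne a none with rfl | ha
    · simpa using Move.onInput_le w m (hσ.1 none)
    · simpa [ha] using hσ.1 a
  · rw [← hσ.2.2]
    exact val_congr fun a ha => Function.update_of_ne (by
      rintro rfl
      simp [mem_group] at ha) _ _

/-- Add a constant to a counter. -/
noncomputable def addConst (c : ℕ) (j : Fin 3) : ℕ → Routine (headDevice (Heads c)) Unit
  | 0 => Routine.look fun _ => ()
  | m + 1 => (incList (group c j)).bind fun _ => addConst c j m

theorem computes_addConst {x : ℕ} {v : Fin 3 → ℕ} {σ : Heads c → ℕ} (hσ : Rep w x v σ)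
    (j : Fin 3) (m : ℕ) (hv : v j + m < (w.length + 2) ^ c) :
    ∃ σ', (addConst c j m).Computes w Anything σ () σ' ∧
      Rep w x (Function.update v j (v j + m)) σ' := by
  induction m generalizing v σ with
  | zero => exact ⟨σ, Routine.computes_look rfl trivial, by simpa using hσ⟩
  | succ m ih =>
    obtain ⟨σ₁, h1, hσ₁⟩ := computes_inc hσ j (by omega)
    obtain ⟨σ₂, h2, hσ₂⟩ := ih hσ₁ (by rw [Function.update_self]; omega)
    refine ⟨σ₂, h1.bind h2, ?_⟩
    rwa [Function.update_self, Function.update_idem, add_assoc, add_comm 1 m] at hσ₂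

/-- Add `m` times the counter `i` to the counter `j`, and reset the counter `i`. -/
noncomputable def transfer (c : ℕ) (i j : Fin 3) (m : ℕ) : Routine (headDevice (Heads c)) Unit :=
  Routine.loop ((isZero c i).bind fun b => if b then Routine.look fun _ => .inr () else
    (decList (group c i)).bind fun _ => (addConst c j m).bind fun _ =>
      Routine.look fun _ => .inl ())

theorem computes_transfer {x : ℕ} {v : Fin 3 → ℕ} {σ : Heads c → ℕ} (hσ : Rep w x v σ)
    {i j : Fin 3} (hij : i ≠ j) (m : ℕ) (hv : v j + m * v i < (w.length + 2) ^ c) :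
    ∃ σ', (transfer c i j m).Computes w Anything σ () σ' ∧
      Rep w x (Function.update (Function.update v i 0) j (v j + m * v i)) σ' := by
  generalize hn : v i = n at hv
  induction n generalizing v σ with
  | zero =>
    refine ⟨σ, Routine.computes_loop_done ((computes_isZero hσ i (b := true) (by simp [hn])).bind
      (Routine.computes_look rfl trivial)), ?_⟩
    rw [Nat.mul_zero, Nat.add_zero, ← hn, Function.update_eq_self]
    rwa [Function.update_eq_self]
  | succ n ih =>
    rw [Nat.mul_succ] at hv
    obtain ⟨σ₁, h1, hσ₁⟩ := computes_dec hσ i (by omega)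
    obtain ⟨σ₂, h2, hσ₂⟩ := computes_addConst hσ₁ j m (by
      rw [Function.update_of_ne hij.symm]; omega)
    obtain ⟨σ₃, h3, hσ₃⟩ := ih hσ₂ (by simp [hij, hn]) (by simp [hij.symm]; omega)
    refine ⟨σ₃, Routine.computes_loop_step ((computes_isZero hσ i (b := false)
      (by simp [hn])).bind (h1.bind (h2.bind (Routine.computes_look rfl trivial)))) h3, ?_⟩
    convert hσ₃ using 1
    funext l
    rcases eq_or_ne l j with rfl | hl
    · simp [hij.symm, Nat.mul_succ]; omega
    · rcases eq_or_ne l i with rfl | hl'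
      · simp [hl]
      · simp [hl, hl']

/-- Replace the value `n` of a counter by `b * n + s`, with the help of the last counter. -/
noncomputable def push (c : ℕ) (j : Fin 3) (b s : ℕ) : Routine (headDevice (Heads c)) Unit :=
  (transfer c j 2 b).bind fun _ => (transfer c 2 j 1).bind fun _ => addConst c j s

theorem computes_push {x : ℕ} {v : Fin 3 → ℕ} {σ : Heads c → ℕ} (hσ : Rep w x v σ)
    {j : Fin 3} (hj : j ≠ 2) (h2 : v 2 = 0) (b s : ℕ) (hv : b * v j + s < (w.length + 2) ^ c) :
    ∃ σ', (push c j b s).Computes w Anything σ () σ' ∧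
      Rep w x (Function.update v j (b * v j + s)) σ' := by
  obtain ⟨σ₁, h1, hσ₁⟩ := computes_transfer hσ hj b (by omega)
  obtain ⟨σ₂, h2', hσ₂⟩ := computes_transfer hσ₁ hj.symm 1 (by simp [hj, h2]; omega)
  obtain ⟨σ₃, h3, hσ₃⟩ := computes_addConst hσ₂ j s (by simp [hj, h2]; omega)
  refine ⟨σ₃, h1.bind (h2'.bind h3), ?_⟩
  convert hσ₃ using 1
  funext l
  rcases eq_or_ne l j with rfl | hl
  · simp [hj, h2]
  · rcases eq_or_ne l 2 with rfl | hl'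
    · simp [hl, h2]
    · simp [hl, hl']

/-- Divide a counter by a constant into the last counter, and return the remainder. -/
noncomputable def divide (c : ℕ) (j : Fin 3) (b : ℕ) [NeZero b] :
    Routine (headDevice (Heads c)) (Fin b) :=
  Routine.iter (I := Fin b) (fun r => (isZero c j).bind fun z =>
    if z then Routine.look fun _ => .inr r else (decList (group c j)).bind fun _ =>
      if r.1 + 1 = b then (incList (group c 2)).bind fun _ => Routine.look fun _ => .inl 0
      else Routine.look fun _ => .inl (Fin.ofNat b (r.1 + 1))) 0

/-- The control counts modulo `b` the units taken from the counter `j`, and the counter `2` counts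
the full rounds. Hence the remainder of `v j + r` and the sum `v 2 + (v j + r) / b` are invariant,
which suggests the statement for all `r`. -/
theorem computes_divide_aux {x : ℕ} {v : Fin 3 → ℕ} {σ : Heads c → ℕ} (hσ : Rep w x v σ)
    {j : Fin 3} (hj : j ≠ 2) (b : ℕ) [NeZero b] (r : Fin b)
    (hv : v 2 + (v j + r) / b < (w.length + 2) ^ c) :
    ∃ σ', (Routine.iter (I := Fin b) (fun r => (isZero c j).bind fun z =>
      if z then Routine.look fun _ => .inr r else (decList (group c j)).bind fun _ =>
      if r.1 + 1 = b then (incList (group c 2)).bind fun _ => Routine.look fun _ => .inl 0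
      else Routine.look fun _ => .inl (Fin.ofNat b (r.1 + 1))) r).Computes w Anything σ
        (Fin.ofNat b (v j + r)) σ' ∧
      Rep w x (Function.update (Function.update v j 0) 2 (v 2 + (v j + r) / b)) σ' := by
  have hb : 0 < b := Nat.pos_of_neZero b
  generalize hn : v j = n at hv
  induction n generalizing v σ r with
  | zero =>
    refine ⟨σ, Routine.computes_iter_done ((computes_isZero hσ j (b := true) (by simp [hn])).bind
      ?_), ?_⟩
    · simp only [if_true]
      exact Routine.computes_look (by simp) trivial
    · have e : Function.update v j 0 = v := by rw [← hn, Function.update_eq_self]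
      rwa [Nat.zero_add, Nat.div_eq_of_lt r.2, Nat.add_zero, e, Function.update_eq_self]
  | succ n ih =>
    obtain ⟨σ₁, h1, hσ₁⟩ := computes_dec hσ j (by omega)
    by_cases hr : r.1 + 1 = b
    · have e : (n + 1 + r) / b = n / b + 1 := by
        rw [show n + 1 + r.1 = n + b by omega, Nat.add_div_right _ hb]
      rw [e] at hv ⊢
      obtain ⟨σ₂, h2, hσ₂⟩ := computes_inc hσ₁ 2 (by
        rw [Function.update_of_ne hj.symm]
        exact lt_of_le_of_lt (Nat.add_le_add_left (Nat.le_add_left 1 _) _) hv)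
      obtain ⟨σ₃, h3, hσ₃⟩ := ih hσ₂ 0 (by simp [hj, hn]) (by simp [hj.symm]; omega)
      refine ⟨σ₃, Routine.computes_iter_step (i' := 0) ((computes_isZero hσ j (b := false)
        (by simp [hn])).bind (h1.bind ?_)) (h3.congr_out ?_), ?_⟩
      · rw [if_pos hr]
        exact h2.bind (Routine.computes_look rfl trivial)
      · rw [show n + 1 + r.1 = n + b by omega]
        simp [Fin.ext_iff]
      · convert hσ₃ using 1
        funext l
        rcases eq_or_ne l 2 with rfl | hl
        · simp [hj.symm]; omega
        · rcases eq_or_ne l j with rfl | hl'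
          · simp [hl]
          · simp [hl, hl']
    · have hr' : r.1 + 1 < b := by omega
      have e : (Fin.ofNat b (r.1 + 1)).1 = r.1 + 1 := Nat.mod_eq_of_lt hr'
      obtain ⟨σ₃, h3, hσ₃⟩ := ih hσ₁ (Fin.ofNat b (r.1 + 1)) (by simp [hn])
        (by rw [e, Function.update_of_ne hj.symm]; convert hv using 3; omega)
      rw [e] at h3 hσ₃
      refine ⟨σ₃, Routine.computes_iter_step (i' := Fin.ofNat b (r.1 + 1))
        ((computes_isZero hσ j (b := false)
        (by simp [hn])).bind (h1.bind ?_)) (h3.congr_out ?_), ?_⟩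
      · rw [if_neg hr]
        exact Routine.computes_look rfl trivial
      · congr 1; omega
      · convert hσ₃ using 1
        funext l
        rcases eq_or_ne l 2 with rfl | hl
        · simp only [Function.update_self, Function.update_of_ne hj.symm]
          congr 2; omega
        · rcases eq_or_ne l j with rfl | hl'
          · simp [hl]
          · simp [hl, hl']

/-- Divide a counter by a constant, with the help of the last counter, and return the
remainder. -/
noncomputable def pop (c : ℕ) (j : Fin 3) (b : ℕ) [NeZero b] :
    Routine (headDevice (Heads c)) (Fin b) :=
  (divide c j b).bind fun r => (transfer c 2 j 1).bind fun _ => Routine.look fun _ => r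

theorem computes_pop {x : ℕ} {v : Fin 3 → ℕ} {σ : Heads c → ℕ} (hσ : Rep w x v σ)
    {j : Fin 3} (hj : j ≠ 2) (h2 : v 2 = 0) (b : ℕ) [NeZero b]
    (hv : v j < (w.length + 2) ^ c) :
    ∃ σ', (pop c j b).Computes w Anything σ (Fin.ofNat b (v j)) σ' ∧
      Rep w x (Function.update v j (v j / b)) σ' := by
  have hle : v j / b < (w.length + 2) ^ c := lt_of_le_of_lt (Nat.div_le_self _ _) hv
  obtain ⟨σ₁, h1, hσ₁⟩ := computes_divide_aux hσ hj b 0 (by simpa [h2] using hle)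
  obtain ⟨σ₂, h2', hσ₂⟩ := computes_transfer hσ₁ hj.symm 1 (by simpa [hj, h2] using hle)
  refine ⟨σ₂, Routine.Computes.bind h1 (h2'.bind (Routine.computes_look (by simp) trivial)), ?_⟩
  convert hσ₂ using 1
  funext l
  rcases eq_or_ne l j with rfl | hl
  · simp [hj, h2]
  · rcases eq_or_ne l 2 with rfl | hl'
    · simp [hl, h2]
    · simp [hl, hl']

end HeadCounter

/-! ### A work tape as two stacks coded by numbers -/

namespace OfflineTM

variable (M : OfflineTM)

instance : Finite M.Q := M.finite_Q

instance : Finite M.Γ := M.finite_Γ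

/-- The base of the numbers that encode stacks of symbols. -/
noncomputable abbrev base : ℕ := Nat.card M.Γ + 1

/-- The non-zero digit of a symbol. -/
noncomputable def code (a : M.Γ) : ℕ := (Finite.equivFin M.Γ a).1 + 1

/-- The symbol of a digit; `0` stands for the blank. -/
noncomputable def decode (r : Fin M.base) : M.Γ :=
  if h : r.1 = 0 then M.blank else (Finite.equivFin M.Γ).symm ⟨r.1 - 1, by have : r.1 < Nat.card M.Γ + 1 := r.2; omega⟩

theorem code_lt (a : M.Γ) : M.code a < M.base := Nat.succ_lt_succ (Finite.equivFin M.Γ a).2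

theorem code_pos (a : M.Γ) : 0 < M.code a := Nat.succ_pos _

/-- The number that encodes a stack. -/
noncomputable def stackNum : List M.Γ → ℕ
  | [] => 0
  | a :: l => M.base * stackNum l + M.code a

theorem stackNum_lt (l : List M.Γ) : M.stackNum l < M.base ^ l.length := by
  induction l with
  | nil => simp [stackNum]
  | cons a l ih =>
    have := M.code_lt a
    rw [stackNum, List.length_cons, pow_succ]
    nlinarith

/-- The reason for avoiding the digit `0` in codes: whether the work head is at the left end becomes
a zero test of the left stack. -/
theorem stackNum_eq_zero_iff (l : List M.Γ) : M.stackNum l = 0 ↔ l = [] := by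
  cases l with
  | nil => simp [stackNum]
  | cons a l =>
    have := M.code_pos a
    simp [stackNum]; omega

/-- An empty stack leaves the remainder `0`, read as a blank, so the unvisited part of the tape
needs no storage. -/
theorem decode_stackNum (l : List M.Γ) :
    M.decode (Fin.ofNat M.base (M.stackNum l)) = l.headD M.blank := by
  cases l with
  | nil => simp [stackNum, decode]
  | cons a l =>
    have e : (Fin.ofNat M.base (M.stackNum (a :: l))).1 = M.code a := by
      rw [Fin.val_ofNat, stackNum, Nat.mul_add_mod, Nat.mod_eq_of_lt (M.code_lt a)]
    rw [decode, dif_neg (by rw [e]; exact (M.code_pos a).ne')]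
    simp only [e, code]
    simp

theorem stackNum_div (l : List M.Γ) : M.stackNum l / M.base = M.stackNum l.tail := by
  cases l with
  | nil => simp [stackNum]
  | cons a l =>
    rw [stackNum, Nat.mul_add_div (Nat.succ_pos _), Nat.div_eq_of_lt (M.code_lt a)]
    rfl

open HeadCounter

/-- The simulation of the writing of the symbol `a`, followed by a move of the work head. -/
noncomputable def workStep (c : ℕ) (q : M.Q) (a : M.Γ) :
    Move → Routine (headDevice (Heads c)) (M.Q × M.Γ ⊕ Bool)
  | .stay => Routine.look fun _ => .inl (q, a)
  | .right => (push c 0 M.base (M.code a)).bind fun _ => (pop c 1 M.base).bind fun r =>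
      Routine.look fun _ => .inl (q, M.decode r)
  | .left => (isZero c 0).bind fun z => if z then Routine.look fun _ => .inl (q, a) else
      (push c 1 M.base (M.code a)).bind fun _ => (pop c 0 M.base).bind fun r =>
        Routine.look fun _ => .inl (q, M.decode r)

/-- The simulation of one step: the symbol under the work head is kept in the control, the
counters `0` and `1` hold the parts of the tape to the left and to the right of it. -/
noncomputable def counterStep (c : ℕ) (i : M.Q × M.Γ) :
    Routine (headDevice (Heads c)) (M.Q × M.Γ ⊕ Bool) :=
  (Routine.look fun v : Heads c → TapeSymbol => v none).bind fun s => match M.δ i.1 s i.2 with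
    | none => Routine.look fun _ => .inr (@decide (i.1 ∈ M.accept) (Classical.dec _))
    | some (q, a, mi, mw) => (moveHead none mi ()).bind fun _ => M.workStep c q a mw

/-- The tape consists of the stack `L`, read to the left from the cell before the work head, the
symbol `a`, and the stack `R`, followed by blanks. -/
def Splits (c : M.Cfg) (L : List M.Γ) (a : M.Γ) (R : List M.Γ) : Prop :=
  L.length = c.workHead ∧ c.tape c.workHead = a ∧
    (∀ x y, x + y + 1 = c.workHead → c.tape x = L.getD y M.blank) ∧
    ∀ y, c.tape (c.workHead + 1 + y) = R.getD y M.blank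

variable {M}

theorem Splits.stay {q q' : M.Q} {i i' : ℕ} {t : ℕ → M.Γ} {h : ℕ} {L R : List M.Γ} {a : M.Γ}
    (hs : M.Splits ⟨q, i, t, h⟩ L a R) (a' : M.Γ) :
    M.Splits ⟨q', i', Function.update t h a', h⟩ L a' R := by
  obtain ⟨h1, h2, h3, h4⟩ := hs
  simp only at h1 h2 h3 h4
  refine ⟨h1, by simp, fun x y hxy => ?_, fun y => ?_⟩ <;> simp only at *
  · rw [Function.update_of_ne (by omega), h3 x y hxy]
  · rw [Function.update_of_ne (by omega), h4 y]

theorem Splits.right {q q' : M.Q} {i i' : ℕ} {t : ℕ → M.Γ} {h : ℕ} {L R : List M.Γ} {a : M.Γ}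
    (hs : M.Splits ⟨q, i, t, h⟩ L a R) (a' : M.Γ) :
    M.Splits ⟨q', i', Function.update t h a', h + 1⟩ (a' :: L) (R.headD M.blank) R.tail := by
  obtain ⟨h1, h2, h3, h4⟩ := hs
  simp only at h1 h2 h3 h4
  refine ⟨by simp [h1], ?_, fun x y hxy => ?_, fun y => ?_⟩ <;> simp only at *
  · rw [Function.update_of_ne (by omega), ← Nat.add_zero (h + 1), h4 0]
    cases R <;> simp
  · cases y with
    | zero =>
      obtain rfl : x = h := by omega
      simp
    | succ y =>
      rw [Function.update_of_ne (by omega), h3 x y (by omega)]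
      simp
  · rw [Function.update_of_ne (by omega), show h + 1 + 1 + y = h + 1 + (y + 1) by omega,
      h4 (y + 1)]
    cases R <;> simp

theorem Splits.left {q q' : M.Q} {i i' : ℕ} {t : ℕ → M.Γ} {h : ℕ} {L R : List M.Γ} {a : M.Γ}
    (hs : M.Splits ⟨q, i, t, h + 1⟩ L a R) (a' : M.Γ) :
    M.Splits ⟨q', i', Function.update t (h + 1) a', h⟩ L.tail (L.headD M.blank) (a' :: R) := by
  obtain ⟨h1, h2, h3, h4⟩ := hs
  simp only at h1 h2 h3 h4
  refine ⟨by simp [h1], ?_, fun x y hxy => ?_, fun y => ?_⟩ <;> simp only at *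
  · rw [Function.update_of_ne (by omega), h3 h 0 rfl]
    cases L <;> simp
  · rw [Function.update_of_ne (by omega), h3 x (y + 1) (by omega)]
    cases L <;> simp
  · cases y with
    | zero => simp
    | succ y =>
      rw [Function.update_of_ne (by omega), show h + 1 + (y + 1) = h + 1 + 1 + y by omega, h4 y]
      simp

/-- The values of the three counters. -/
noncomputable def counters (L R : List M.Γ) : Fin 3 → ℕ := ![M.stackNum L, M.stackNum R, 0]

theorem update_counters_left (L L' R : List M.Γ) :
    Function.update (counters L R) 0 (M.stackNum L') = counters L' R := by
  funext i; fin_cases i <;> rfl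

theorem update_counters_right (L R R' : List M.Γ) :
    Function.update (counters L R) 1 (M.stackNum R') = counters L R' := by
  funext i; fin_cases i <;> rfl

/-- The space bound enters as `L.length + R.length < B`. The sum is unchanged by the moves, except
by a right move with `R` empty; then it equals the new position of the work head, which is below `B`
because the configuration is reachable. This is why reachability belongs to the relation. -/
theorem simulates_counterStep (w : List Bool) (c B : ℕ)
    (hB : ∀ d, M.Reaches w d → d.workHead < B)
    (hc : M.base ^ B ≤ (w.length + 2) ^ c) :
    Routine.Simulates (M.counterStep c) w Anything (M.next w) (fun d => d.state ∈ M.accept)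
      (fun d i σ => M.Reaches w d ∧ i.1 = d.state ∧ ∃ L R, M.Splits d L i.2 R ∧
        L.length + R.length < B ∧ Rep w d.inputHead (counters L R) σ) := by
  have bound : ∀ l : List M.Γ, l.length ≤ B → M.stackNum l < (w.length + 2) ^ c := fun l hl =>
    lt_of_lt_of_le (M.stackNum_lt l) ((Nat.pow_le_pow_right (Nat.succ_pos _) hl).trans hc)
  rintro ⟨q, x, t, h⟩ ⟨q₁, a⟩ σ ⟨hreach, hq, L, R, hs, hLR, hσ⟩
  obtain rfl : q₁ = q := hq
  simp only at hσ
  have hview : (Routine.look fun v : Heads c → TapeSymbol => v none : Routine (headDevice (Heads c)) TapeSymbol).Computes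
      w Anything σ (readTape w x) σ :=
    Routine.computes_look (by simp only [hσ.2.1]) trivial
  have ha : t h = a := hs.2.1
  simp only [next, ha]
  cases hd : M.δ q₁ (readTape w x) a with
  | none =>
    refine ⟨by simp, fun _ => ⟨@decide (q₁ ∈ M.accept) (Classical.dec _), σ, by simp,
      hview.bind ?_⟩⟩
    simp only [hd]
    exact Routine.computes_look rfl trivial
  | some r =>
    obtain ⟨q', a', mi, mw⟩ := r
    refine ⟨fun c' hc' => ?_, by simp⟩
    simp only [Option.map_some, Option.some.injEq] at hc'
    have hreach' : M.Reaches w c' := hreach.tail (by simp [next, ha, hd, hc'])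
    have hB' := hB _ hreach'
    obtain ⟨σ₁, h1, hσ₁⟩ := computes_moveInput hσ mi
    subst hc'
    suffices H : ∃ (i' : M.Q × M.Γ) (σ' : Heads c → ℕ), (i'.1 = q' ∧ ∃ L R,
        M.Splits ⟨q', mi.onInput w x, Function.update t h a', mw.onTape h⟩ L i'.2 R ∧
        L.length + R.length < B ∧ Rep w (mi.onInput w x) (counters L R) σ') ∧
        (M.workStep c q' a' mw).Computes w Anything σ₁ (.inl i') σ' by
      obtain ⟨i', σ', h2, h3⟩ := H
      refine ⟨i', σ', ⟨hreach', h2⟩, hview.bind ?_⟩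
      simp only [hd]
      exact h1.bind h3
    cases mw with
    | stay => exact ⟨(q', a'), σ₁, ⟨rfl, L, R, hs.stay a', hLR, hσ₁⟩, Routine.computes_look rfl trivial⟩
    | right =>
      have hL : L.length = h := hs.1
      simp only [Move.onTape] at hB'
      have e := update_counters_left L (a' :: L) R
      obtain ⟨σ₂, h2, hσ₂⟩ := computes_push hσ₁ (j := 0) (by decide) rfl M.base (M.code a')
        (bound (a' :: L) (by simp; omega))
      rw [show M.base * counters L R 0 + M.code a' = M.stackNum (a' :: L) from rfl, e] at hσ₂
      obtain ⟨σ₃, h3, hσ₃⟩ := computes_pop hσ₂ (j := 1) (by decide) rfl M.base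
        (bound R (by omega))
      rw [show counters (a' :: L) R 1 = M.stackNum R from rfl] at h3 hσ₃
      rw [stackNum_div, update_counters_right] at hσ₃
      exact ⟨(q', _), σ₃, ⟨rfl, _, _, hs.right a', by simp; omega, hσ₃⟩, h2.bind (h3.bind
        (Routine.computes_look (by rw [decode_stackNum]; rfl) trivial))⟩
    | left =>
      have hL : L.length = h := hs.1
      have h0 : counters L R 0 = M.stackNum L := rfl
      cases h with
      | zero =>
        refine ⟨(q', a'), σ₁, ⟨rfl, L, R, hs.stay a', hLR, hσ₁⟩, ?_⟩
        refine (computes_isZero hσ₁ 0 (b := true) ?_).bind (Routine.computes_look rfl trivial)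
        rw [h0, stackNum_eq_zero_iff, ← List.length_eq_zero_iff]
        simp [hL]
      | succ h =>
        have e := update_counters_right L R (a' :: R)
        obtain ⟨σ₂, h2, hσ₂⟩ := computes_push hσ₁ (j := 1) (by decide) rfl M.base (M.code a')
          (bound (a' :: R) (by simp; omega))
        rw [show M.base * counters L R 1 + M.code a' = M.stackNum (a' :: R) from rfl, e] at hσ₂
        obtain ⟨σ₃, h3, hσ₃⟩ := computes_pop hσ₂ (j := 0) (by decide) rfl M.base
          (bound L (by omega))
        rw [show counters L (a' :: R) 0 = M.stackNum L from rfl] at h3 hσ₃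
        rw [stackNum_div, update_counters_left] at hσ₃
        refine ⟨(q', _), σ₃, ⟨rfl, _, _, hs.left a', by simp; omega, hσ₃⟩,
          (computes_isZero hσ₁ 0 (b := false) ?_).bind (h2.bind (h3.bind
          (Routine.computes_look (by rw [decode_stackNum]; rfl) trivial)))⟩
        rw [h0, stackNum_eq_zero_iff, ← List.length_eq_zero_iff]
        simp [hL]

end OfflineTM

/-- Stacks of logarithmic height over a fixed alphabet have polynomially many values, so the number
of heads does not depend on the word. The exponent comes from `b ≤ 2 ^ b` and `2 ^ (Nat.log 2 n + 1)
≤ (n + 2) ^ 2`. -/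
theorem pow_log_le_pow (b C n : ℕ) :
    b ^ (C * (Nat.log 2 n + 1)) ≤ (n + 2) ^ (2 * (b * C)) := by
  have h1 : 2 ^ (Nat.log 2 n + 1) ≤ (n + 2) ^ 2 := by
    rw [pow_succ]
    rcases Nat.eq_zero_or_pos n with rfl | hn
    · simp
    · have := Nat.pow_log_le_self 2 hn.ne'
      nlinarith
  calc b ^ (C * (Nat.log 2 n + 1)) ≤ (2 ^ b) ^ (C * (Nat.log 2 n + 1)) :=
        Nat.pow_le_pow_left Nat.lt_two_pow_self.le _
    _ = (2 ^ (Nat.log 2 n + 1)) ^ (b * C) := by rw [← pow_mul, ← pow_mul]; congr 1; ring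
    _ ≤ ((n + 2) ^ 2) ^ (b * C) := Nat.pow_le_pow_left h1 _
    _ = _ := by rw [← pow_mul]

open HeadCounter in
theorem logspace_subset_twoWayDFAClass : Logspace ⊆ twoWayDFAClass ⊤ := by
  rintro _ ⟨M, ⟨C, hC⟩, rfl⟩
  obtain ⟨A, hA⟩ := Routine.exists_twoWayDFA
    (Routine.iter (M.counterStep (2 * (M.base * C))) (M.start, M.blank))
  refine ⟨_, Fintype.card_pos, le_top, A, ?_⟩
  ext w
  refine (hA w).trans ?_
  rw [(OfflineTM.simulates_counterStep w _ _ (fun d hd => hC w d hd) (pow_log_le_pow _ _ _)).computes_iff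
    (c := M.initial)]
  · exact accFrom_iff (M.next w) (fun d => d.state ∈ M.accept) _
  -- The space bound at the initial configuration excludes `C = 0`.
  · have h0 : 0 < C * (Nat.log 2 w.length + 1) :=
      lt_of_le_of_lt (Nat.zero_le _) (hC w M.initial .refl)
    refine ⟨.refl, rfl, [], [], ⟨rfl, rfl, fun x y h => by simp [OfflineTM.initial] at h,
      fun y => rfl⟩, h0, fun _ => Nat.zero_le _, rfl, fun j => ?_⟩
    rw [show OfflineTM.counters (M := M) [] [] j = 0 by fin_cases j <;> rfl, val_eq_zero_iff]
    exact fun _ _ => rfl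

theorem twoWayDFAClass_top : twoWayDFAClass ⊤ = Logspace :=
  Set.Subset.antisymm twoWayDFAClass_subset_logspace logspace_subset_twoWayDFAClass

/-! ### One head: the regular languages -/

namespace TwoWayDFA

variable (M : TwoWayDFA 1)

/-- The successor of a configuration with one head. -/
def nextOne (w : List Bool) (c : M.Q × ℕ) : Option (M.Q × ℕ) :=
  (M.δ c.1 fun _ => readTape w c.2).map fun r => (r.1, (r.2 0).onInput w c.2)

theorem accepts_iff_accFrom_nextOne (w : List Bool) :
    M.Accepts w ↔ AccFrom (M.nextOne w) (fun c => c.1 ∈ M.accept) (M.start, 0) := by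
  refine (accFrom_iff (M.next w) (fun c => c.1 ∈ M.accept) _).symm.trans ?_
  refine accFrom_map (next' := M.next w) (fun c : M.Q × ℕ => (c.1, fun _ : Fin 1 => c.2)) ?_
    (fun c => Iff.rfl) (M.start, 0)
  rintro ⟨q, p⟩
  simp only [next, nextOne, Option.map_map]
  congr 1
  funext r
  simp only [Function.comp, Prod.mk.injEq, true_and]
  funext a
  rw [Subsingleton.elim a 0]

/-- The runs inside of the first `|u| + 1` cells: acceptance (`none`) or a first exit to the
right, in some state. -/
inductive Excursion (u : List Bool) : M.Q × ℕ → Option M.Q → Prop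
  | halt {c} : c.2 ≤ u.length → M.nextOne u c = none → c.1 ∈ M.accept → Excursion u c none
  | exit {c q} : c.2 ≤ u.length → M.nextOne u c = some (q, u.length + 1) → Excursion u c (some q)
  | step {c c' o} : c.2 ≤ u.length → M.nextOne u c = some c' → Excursion u c' o → Excursion u c o

theorem readTape_append_left {u x : List Bool} {p : ℕ} (hp : p ≤ u.length) :
    readTape (u ++ x) p = readTape u p := by
  cases p with
  | zero => rfl
  | succ p => simp only [readTape]; rw [List.getElem?_append_left hp]

theorem readTape_append_right {u x : List Bool} {j : ℕ} (hj : 1 ≤ j) :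
    readTape (u ++ x) (u.length + j) = readTape x j := by
  cases j with
  | zero => omega
  | succ j =>
    rw [← add_assoc]
    simp only [readTape]
    rw [List.getElem?_append_right (by omega), Nat.add_sub_cancel_left]

variable {M}

/-- From a cell `≤ |u|` the right end marker is not read, and a right move is not stopped, with or
without `x`. -/
theorem nextOne_append_left {u : List Bool} (x : List Bool) {c : M.Q × ℕ} (hp : c.2 ≤ u.length) :
    M.nextOne (u ++ x) c = M.nextOne u c := by
  simp only [nextOne, readTape_append_left hp]
  congr 1
  funext r
  cases r.2 0 <;> simp [Move.onInput]; omega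

/-- The cell `|u|` plays the part of the cell `0` of `x`. It holds another symbol, so it may be
entered but not read, whence `1 ≤ j`. -/
theorem nextOne_append_right (u x : List Bool) (q : M.Q) {j : ℕ} (hj : 1 ≤ j) :
    M.nextOne (u ++ x) (q, u.length + j) =
      (M.nextOne x (q, j)).map fun c => (c.1, u.length + c.2) := by
  simp only [nextOne, readTape_append_right hj, Option.map_map]
  congr 1
  funext r
  simp only [Function.comp]
  cases r.2 0 <;> simp [Move.onInput] <;> omega

theorem nextOne_le {w : List Bool} {c c' : M.Q × ℕ} (h : M.nextOne w c = some c') :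
    c'.2 ≤ c.2 + 1 := by
  simp only [nextOne, Option.map_eq_some_iff] at h
  obtain ⟨r, -, rfl⟩ := h
  cases r.2 0 <;> simp [Move.onInput]
  omega

/-- Acceptance of the input `w` from a configuration. -/
abbrev AcceptsFrom (M : TwoWayDFA 1) (w : List Bool) (c : M.Q × ℕ) : Prop :=
  AccFrom (M.nextOne w) (fun c => c.1 ∈ M.accept) c

theorem Excursion.acceptsFrom {v : List Bool} (x : List Bool) {c : M.Q × ℕ} {o : Option M.Q}
    (h : M.Excursion v c o) (ho : ∀ q ∈ o, M.AcceptsFrom (v ++ x) (q, v.length + 1)) :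
    M.AcceptsFrom (v ++ x) c := by
  induction h with
  | halt h1 h2 h3 => exact .halt (by rwa [nextOne_append_left x h1 ]) h3
  | exit h1 h2 =>
    exact .step (by rwa [nextOne_append_left x h1 ]) (ho _ rfl)
  | step h1 h2 _ ih => exact .step (by rwa [nextOne_append_left x h1 ]) (ih ho)

/-- A computation on `u ++ x` is cut where it crosses the boundary. Steps inside of `x` are copied,
and after each re-entry, at the last cell of `u`, the excursion is replaced by one in `v` with the
same outcome. The first claim keeps the excursion in `u`, as its starting cell need not correspond
to one of `v`. -/
theorem AcceptsFrom.transport {u v x : List Bool}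
    (huv : ∀ q o, M.Excursion u (q, u.length) o → M.Excursion v (q, v.length) o)
    {c : M.Q × ℕ} (h : M.AcceptsFrom (u ++ x) c) :
    (c.2 ≤ u.length → ∃ o, M.Excursion u c o ∧
      ∀ q ∈ o, M.AcceptsFrom (v ++ x) (q, v.length + 1)) ∧
    ∀ j, 1 ≤ j → c.2 = u.length + j → M.AcceptsFrom (v ++ x) (c.1, v.length + j) := by
  induction h with
  | @halt c h1 h2 =>
    refine ⟨fun hc => ⟨none, .halt hc ?_ h2, by simp⟩, fun j hj hc => .halt ?_ h2⟩
    · rwa [nextOne_append_left x hc] at h1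
    · obtain ⟨q, p⟩ := c
      simp only at hc
      subst hc
      rw [nextOne_append_right u x q hj, Option.map_eq_none_iff] at h1
      rw [nextOne_append_right v x q hj, h1]
      rfl
  | @step c c' h1 _ ih =>
    obtain ⟨ih1, ih2⟩ := ih
    refine ⟨fun hc => ?_, fun j hj hc => ?_⟩
    · rw [nextOne_append_left x hc] at h1
      have hle := nextOne_le h1
      by_cases hc' : c'.2 ≤ u.length
      · obtain ⟨o, ho, ho'⟩ := ih1 hc'
        exact ⟨o, .step hc h1 ho, ho'⟩
      · have e : c' = (c'.1, u.length + 1) := Prod.ext rfl (by simp only; omega)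
        refine ⟨some c'.1, .exit hc (by rw [h1, ← e]), fun q hq => ?_⟩
        simp only [Option.mem_def, Option.some.injEq] at hq
        subst hq
        exact ih2 1 le_rfl (by omega)
    · obtain ⟨q, p⟩ := c
      simp only at hc
      subst hc
      rw [nextOne_append_right u x q hj, Option.map_eq_some_iff] at h1
      obtain ⟨⟨q', j'⟩, h1, rfl⟩ := h1
      refine .step (c' := (q', v.length + j')) (by rw [nextOne_append_right v x q hj, h1]; rfl) ?_
      rcases Nat.eq_zero_or_pos j' with rfl | hj'
      · obtain ⟨o, ho, ho'⟩ := ih1 le_rfl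
        exact (huv q' o ho).acceptsFrom x ho'
      · exact ih2 j' hj' rfl

instance : Finite M.Q := M.finite_Q

/-- By Myhill and Nerode it suffices to have finitely many left quotients. The quotient by `u`
depends only on the outcomes of the excursions in `u` from the start and from the last cell, which
form an element of a finite type; a loop inside of `u` has no outcome. -/
theorem isRegular_language (M : TwoWayDFA 1) : M.language.IsRegular := by
  apply Language.IsRegular.of_finite_range_leftQuotient
  let D : List Bool → Set (Option M.Q) × (M.Q → Set (Option M.Q)) := fun u =>
    ({o | M.Excursion u (M.start, 0) o}, fun q => {o | M.Excursion u (q, u.length) o})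
  have key : ∀ u v, D u = D v → M.language.leftQuotient u ≤ M.language.leftQuotient v := by
    intro u v huv x hx
    rw [Prod.ext_iff] at huv
    refine (M.accepts_iff_accFrom_nextOne (v ++ x)).2 ?_
    have hx : M.AcceptsFrom (u ++ x) (M.start, 0) := (M.accepts_iff_accFrom_nextOne _).1 hx
    obtain ⟨o, ho, ho'⟩ := (hx.transport (v := v) fun q o h => by
      have : o ∈ (D u).2 q := h
      rwa [huv.2] at this).1 (Nat.zero_le _)
    have ho : o ∈ (D u).1 := ho
    rw [huv.1] at ho
    exact Excursion.acceptsFrom x ho ho'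
  classical
  -- A word with the given outcomes; `[]` is a default for data that no word realises.
  let s : Set (Option M.Q) × (M.Q → Set (Option M.Q)) → List Bool := fun d =>
    if h : ∃ u, D u = d then h.choose else []
  refine (Set.finite_range (M.language.leftQuotient ∘ s)).subset ?_
  rintro _ ⟨u, rfl⟩
  refine ⟨D u, ?_⟩
  have h : ∃ v, D v = D u := ⟨u, rfl⟩
  have e : D (s (D u)) = D u := by
    simp only [s, dif_pos h]
    exact h.choose_spec
  exact le_antisymm (key _ _ e) (key _ _ e.symm)

/-- The two-way automaton that reads its input from left to right. -/
def ofDFA {σ : Type} [Finite σ] (N : DFA Bool σ) : TwoWayDFA 1 where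
  Q := σ
  finite_Q := inferInstance
  start := N.start
  accept := N.accept
  δ := fun q s => match s 0 with
    | .left => some (q, fun _ => .right)
    | .letter b => some (N.step q b, fun _ => .right)
    | .right => none

theorem ofDFA_acceptsFrom_iff {σ : Type} [Finite σ] (N : DFA Bool σ) (w : List Bool) (j : ℕ)
    (hj : j ≤ w.length) (q : σ) :
    (ofDFA N).AcceptsFrom w (q, j + 1) ↔ N.evalFrom q (w.drop j) ∈ N.accept := by
  induction hj using Nat.decreasingInduction generalizing q with
  | self =>
    have hn : (ofDFA N).nextOne w (q, w.length + 1) = none := by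
      simp [nextOne, ofDFA, readTape]
    rw [List.drop_length, DFA.evalFrom_nil]
    exact accFrom_iff_of_halt hn
  | of_succ j hj ih =>
    have hn : (ofDFA N).nextOne w (q, j + 1) = some (N.step q w[j], j + 1 + 1) := by
      simp [nextOne, ofDFA, readTape, List.getElem?_eq_getElem hj, Move.onInput]
      omega
    rw [List.drop_eq_getElem_cons hj, DFA.evalFrom_cons, ← ih]
    exact accFrom_iff_of_step hn

theorem language_ofDFA {σ : Type} [Finite σ] (N : DFA Bool σ) :
    (ofDFA N).language = N.accepts := by
  ext w
  refine ((ofDFA N).accepts_iff_accFrom_nextOne w).trans ?_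
  have hn : (ofDFA N).nextOne w (N.start, 0) = some (N.start, 0 + 1) := by
    simp [nextOne, ofDFA, readTape, Move.onInput]
  have h0 := ofDFA_acceptsFrom_iff N w 0 (Nat.zero_le _) N.start
  rw [List.drop_zero] at h0
  exact (accFrom_iff_of_step hn).trans h0

end TwoWayDFA

theorem twoWayDFAClass_one : twoWayDFAClass 1 = {L | L.IsRegular} := by
  ext L
  constructor
  · rintro ⟨k, h1, h2, M, rfl⟩
    obtain rfl : k = 1 := le_antisymm (by exact_mod_cast h2) h1
    exact M.isRegular_language
  · rintro ⟨σ, _, N, rfl⟩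
    exact ⟨1, le_rfl, le_rfl, TwoWayDFA.ofDFA N, TwoWayDFA.language_ofDFA N⟩

/-- Two deterministic transition systems have the same acceptance if each step of one of them is
simulated by at least one step of the other. -/
theorem accFrom_iff_of_simulation {C D : Type*} {next : C → Option C} {acc : C → Prop}
    {next' : D → Option D} {acc' : D → Prop} {Rel : C → D → Prop}
    (hnone : ∀ c d, Rel c d → next' d = none → next c = none ∧ (acc c ↔ acc' d))
    (hsome : ∀ c d d', Rel c d → next' d = some d' →
      ∃ c', Relation.TransGen (fun c c' => next c = some c') c c' ∧ Rel c' d')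
    {c : C} {d : D} (h : Rel c d) : AccFrom next acc c ↔ AccFrom next' acc' d := by
  constructor
  · intro hc
    -- One step of `D` corresponds to several steps of `C`. The induction on the accepting run of
    -- `C` therefore carries the next configuration `c₁` on that run that is related to some `d`.
    suffices H : ∀ d c₁, Relation.ReflTransGen (fun c c' => next c = some c') c c₁ → Rel c₁ d →
        AccFrom next' acc' d from H d c .refl h
    clear h d
    induction hc with
    | @halt c h1 h2 =>
      intro d c₁ hr h
      rcases hr.cases_head with rfl | ⟨c₂, h3, -⟩
      · cases hd : next' d with
        | none => exact .halt hd ((hnone _ _ h hd).2.1 h2)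
        | some d' =>
          obtain ⟨c', ht, -⟩ := hsome _ _ _ h hd
          obtain ⟨c₂, h3, -⟩ := Relation.TransGen.head'_iff.1 ht
          simp [h1] at h3
      · simp [h1] at h3
    | @step c c₂ h1 _ ih =>
      intro d c₁ hr h
      rcases hr.cases_head with rfl | ⟨c₃, h3, h4⟩
      · cases hd : next' d with
        | none => simp [(hnone _ _ h hd).1] at h1
        | some d' =>
          obtain ⟨c', ht, hR⟩ := hsome _ _ _ h hd
          obtain ⟨c₃, h3, h4⟩ := Relation.TransGen.head'_iff.1 ht
          rw [h1, Option.some.injEq] at h3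
          subst h3
          exact .step hd (ih d' c' h4 hR)
      · rw [h1, Option.some.injEq] at h3
        subst h3
        exact ih d c₁ h4 h
  · intro hd
    induction hd generalizing c with
    | halt h1 h2 => exact .halt (hnone _ _ h h1).1 ((hnone _ _ h h1).2.2 h2)
    | step h1 _ ih =>
      obtain ⟨c', ht, hR⟩ := hsome _ _ _ h h1
      have := ih hR
      clear h
      induction ht using Relation.TransGen.head_induction_on with
      | single h => exact .step h this
      | head h _ ih' => exact .step h ih'

/-! ### Automata on a circular tape -/

/-- What a circular automaton does: it halts, or it goes to a state and moves a head to the right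
(`true`) or to the left (`false`), provided that the head is at a given symbol. -/
inductive CircularAction (Q : Type) (k : ℕ)
  | accept
  | reject
  | go (q : Q) (a : Fin k) (s : Option Bool) (right : Bool)

/-- Automata with `k` heads on the circular tape `⋆ w₁ … w_n`, which read the symbol at the head
that has moved last. -/
structure CircularAutomaton (k : ℕ) where
  Q : Type
  finite_Q : Finite Q
  start : Q
  δ : Q → Option Bool → CircularAction Q k

namespace CircularAutomaton

variable {k : ℕ} (A : CircularAutomaton k)

instance : Finite A.Q := A.finite_Q

/-- A configuration: the state, the head that has moved last, and the positions. -/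
abbrev Cfg (w : List Bool) : Type := A.Q × Fin k × (Fin k → Fin (w.length + 1))

/-- The neighbours of a position. -/
def neighbour {N : ℕ} [NeZero N] (right : Bool) (j : Fin N) : Fin N :=
  if right then j + 1 else j - 1

/-- The action in a configuration. -/
def action (w : List Bool) (c : A.Cfg w) : CircularAction A.Q k :=
  A.δ c.1 (symbolAt w (c.2.2 c.2.1))

/-- The successor of a configuration. -/
def next (w : List Bool) (c : A.Cfg w) : Option (A.Cfg w) :=
  match A.action w c with
  -- A wrong announcement halts without accepting.
  | .go q a s r => if symbolAt w (c.2.2 a) = s then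
      some (q, a, Function.update c.2.2 a (neighbour r (c.2.2 a))) else none
  | _ => none

/-- The accepting configurations. -/
def Acc (w : List Bool) (c : A.Cfg w) : Prop := A.action w c = .accept

/-- Acceptance of a word. -/
def Accepts [NeZero k] (w : List Bool) : Prop :=
  AccFrom (A.next w) (A.Acc w) (A.start, 0, fun _ => 0)

/-- The symbol of the linear tape for a symbol of the circular tape. -/
def toTape : Option Bool → TapeSymbol
  | none => .left
  | some b => .letter b

/-- The symbol of the circular tape for a symbol of the linear tape. -/
def ofTape : TapeSymbol → Option Bool
  | .letter b => some b
  | _ => none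

theorem readTape_fin (w : List Bool) (j : Fin (w.length + 1)) :
    readTape w j = toTape (symbolAt w j) := by
  induction j using Fin.cases with
  | zero => rfl
  | succ j => simp [readTape, symbolAt, toTape]

theorem ofTape_toTape (s : Option Bool) : ofTape (toTape s) = s := by cases s <;> rfl

theorem toTape_injective : Function.Injective toTape :=
  Function.LeftInverse.injective ofTape_toTape

open HeadCounter

/-- The simulation of a move on the circular tape. -/
noncomputable def moveCircular (a : Fin k) : Bool → Routine (headDevice (Fin k)) Unit
  | true => (moveHead a .right ()).bind fun _ => (test a .right).bind fun b =>
      if b then rewindHead a else Routine.look fun _ => ()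
  | false => (test a .left).bind fun b =>
      if b then (forwardHead a).bind fun _ => moveHead a .left () else moveHead a .left ()

/-- The circular positions are `0, …, |w|` on the linear tape; the cell of `◁` is only passed
through when a head goes round the cycle. -/
theorem computes_moveCircular (w : List Bool) (a : Fin k) (r : Bool)
    (p : Fin k → Fin (w.length + 1)) :
    (moveCircular a r).Computes w Anything (fun b => (p b : ℕ)) ()
      (fun b => (Function.update p a (neighbour r (p a)) b : ℕ)) := by
  have hlt := (p a).2
  have upd : ∀ (j : Fin (w.length + 1)) (x : ℕ), x = j → (fun b => (Function.update p a j b : ℕ)) =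
      Function.update (fun b => (p b : ℕ)) a x := by
    rintro j _ rfl
    funext b
    rcases eq_or_ne b a with rfl | hb
    · simp
    · simp [hb]
  cases r with
  | true =>
    have e : Move.right.onInput w (p a) = p a + 1 := by simp [Move.onInput]; omega
    have h := computes_moveHead (w := w) a .right () fun b => (p b : ℕ)
    rw [e] at h
    refine h.bind ?_
    by_cases hp : (p a : ℕ) = w.length
    · refine (computes_test a .right (b := true) (by simp [readTape_eq_right_iff, hp])).bind ?_
      refine (computes_rewindHead a _).congr_right ?_
      rw [Function.update_idem, upd _ 0]
      have : p a = Fin.last _ := Fin.ext hp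
      simp [neighbour, this]
    · refine (computes_test a .right (b := false)
        (by simp [readTape_eq_right_iff]; omega)).bind ?_
      refine (Routine.computes_look rfl trivial).congr_right (upd _ _ ?_).symm
      rw [neighbour, if_pos rfl, Fin.val_add_one_of_lt]
      rw [Fin.lt_def, Fin.val_last]
      omega
  | false =>
    by_cases hp : (p a : ℕ) = 0
    · refine (computes_test a .left (b := true) (by simp [readTape_eq_left_iff, hp])).bind ?_
      refine (computes_forwardHead a _ hlt.le).bind ?_
      refine (computes_moveHead a .left () _).congr_right ?_
      rw [Function.update_idem, Function.update_self, upd _ w.length]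
      · rfl
      · have : p a = 0 := Fin.ext hp
        simp [neighbour, this, Fin.coe_neg_one]
    · refine (computes_test a .left (b := false) (by simp [readTape_eq_left_iff, hp])).bind ?_
      refine (computes_moveHead a .left () _).congr_right (upd _ _ ?_).symm
      rw [neighbour, if_neg (by simp), Fin.val_sub_one_of_ne_zero]
      · rfl
      · intro h
        simp [h] at hp

/-- The simulation of one step of a circular automaton. -/
noncomputable def circularStep (i : A.Q × Fin k) :
    Routine (headDevice (Fin k)) (A.Q × Fin k ⊕ Bool) :=
  (Routine.look fun v : Fin k → TapeSymbol => ofTape (v i.2)).bind fun s => match A.δ i.1 s with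
    | .accept => Routine.look fun _ => .inr true
    | .reject => Routine.look fun _ => .inr false
    | .go q a s r => (test a (toTape s)).bind fun b =>
        if b then (moveCircular a r).bind fun _ => Routine.look fun _ => .inl (q, a)
        else Routine.look fun _ => .inr false

theorem simulates_circularStep (w : List Bool) :
    Routine.Simulates A.circularStep w Anything (A.next w) (A.Acc w)
      (fun c i σ => i = (c.1, c.2.1) ∧ σ = fun b => (c.2.2 b : ℕ)) := by
  rintro ⟨q, a, p⟩ _ _ ⟨rfl, rfl⟩
  have hview : (Routine.look fun v : Fin k → TapeSymbol => ofTape (v a) :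
      Routine (headDevice (Fin k)) (Option Bool)).Computes w Anything (fun b => (p b : ℕ))
      (symbolAt w (p a)) (fun b => (p b : ℕ)) :=
    Routine.computes_look (by simp only [readTape_fin, ofTape_toTape]) trivial
  simp only [next, Acc, action]
  cases hd : A.δ q (symbolAt w (p a)) with
  | accept =>
    refine ⟨by simp, fun _ => ⟨true, fun b => (p b : ℕ), by simp, hview.bind ?_⟩⟩
    simp only [hd]
    exact Routine.computes_look rfl trivial
  | reject =>
    refine ⟨by simp, fun _ => ⟨false, fun b => (p b : ℕ), by simp, hview.bind ?_⟩⟩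
    simp only [hd]
    exact Routine.computes_look rfl trivial
  | go q' a' s r =>
    by_cases hs : symbolAt w (p a') = s
    · simp only [hs, if_true]
      refine ⟨fun c' hc' => ?_, by simp⟩
      simp only [Option.some.injEq] at hc'
      subst hc'
      refine ⟨_, _, ⟨rfl, rfl⟩, hview.bind ?_⟩
      simp only [hd]
      exact (computes_test a' _ (b := true) (by simp [readTape_fin, hs])).bind
        ((computes_moveCircular w a' r p).bind (Routine.computes_look rfl trivial))
    · simp only [hs, if_false]
      refine ⟨by simp, fun _ => ⟨false, fun b => (p b : ℕ), by simp, hview.bind ?_⟩⟩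
      simp only [hd]
      exact (computes_test a' _ (b := false)
        (by simp [readTape_fin, toTape_injective.eq_iff, hs])).bind
          (Routine.computes_look rfl trivial)

/-- A circular automaton is simulated by a two-way automaton with the same number of heads. -/
theorem exists_twoWayDFA [NeZero k] :
    ∃ M : TwoWayDFA k, ∀ w, M.Accepts w ↔ A.Accepts w := by
  have h := (Routine.iter A.circularStep (A.start, 0)).exists_twoWayDFA
  rw [Fintype.card_fin] at h
  obtain ⟨M, hM⟩ := h
  refine ⟨M, fun w => (hM w).trans ?_⟩
  exact (A.simulates_circularStep w).computes_iff (c := (A.start, 0, fun _ => 0)) ⟨rfl, rfl⟩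

end CircularAutomaton

/-! ### Two-way automata as circular automata -/

namespace TwoWayDFA

open CircularAutomaton

section Agenda

variable {k : ℕ} {w : List Bool}

/-- Move one head by one cell of the linear tape. -/
def moveOne (p : Fin k → ℕ) (m : Fin k × Bool) : Fin k → ℕ :=
  Function.update p m.1 (if m.2 then p m.1 + 1 else p m.1 - 1)

/-- The moves of a list do not leave the linear tape. -/
def Legal (w : List Bool) : List (Fin k × Bool) → (Fin k → ℕ) → Prop
  | [], _ => True
  | m :: l, p => (if m.2 then p m.1 ≤ w.length else 1 ≤ p m.1) ∧ Legal w l (moveOne p m)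

theorem legal_append {l l' : List (Fin k × Bool)} {p : Fin k → ℕ} (h : Legal w l p)
    (h' : Legal w l' (l.foldl moveOne p)) : Legal w (l ++ l') p := by
  induction l generalizing p with
  | nil => exact h'
  | cons m l ih => exact ⟨h.1, ih h.2 h'⟩

/-- A proper move of a head. -/
def properMove : Move → TapeSymbol → Option Bool
  | .left, .left => none
  | .left, _ => some false
  | .right, .right => none
  | .right, _ => some true
  | .stay, _ => none

/-- Two moves of a head that cancel. -/
def idleMoves (a : Fin k) : TapeSymbol → List (Fin k × Bool)
  | .right => [(a, false), (a, true)]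
  | _ => [(a, true), (a, false)]

/-- The proper moves of the heads of a list. -/
def properMoves (s : Fin k → TapeSymbol) (m : Fin k → Move) : List (Fin k) → List (Fin k × Bool)
  | [] => []
  | a :: l => match properMove (m a) (s a) with
    | none => properMoves s m l
    | some r => (a, r) :: properMoves s m l

theorem length_properMoves (s : Fin k → TapeSymbol) (m : Fin k → Move) (l : List (Fin k)) :
    (properMoves s m l).length ≤ l.length := by
  induction l with
  | nil => simp [properMoves]
  | cons a l ih =>
    rw [properMoves]
    split <;> simp <;> omega

theorem properMove_spec (w : List Bool) (m : Move) {p : ℕ} (hp : p ≤ w.length + 1) :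
    match properMove m (readTape w p) with
    | none => m.onInput w p = p
    | some true => p ≤ w.length ∧ m.onInput w p = p + 1
    | some false => 1 ≤ p ∧ m.onInput w p = p - 1 := by
  have hl := readTape_eq_left_iff w p
  have hr := readTape_eq_right_iff w p
  cases m <;> cases hs : readTape w p <;> simp [hs, properMove, Move.onInput] at hl hr ⊢ <;> omega

/-- Since the list has no duplicates, the recorded symbol of a head is still correct when its move
is made. -/
theorem properMoves_spec (m : Fin k → Move) (s : Fin k → TapeSymbol) (l : List (Fin k))
    (hl : l.Nodup) (p : Fin k → ℕ) (hp : ∀ a, p a ≤ w.length + 1)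
    (hs : ∀ a ∈ l, s a = readTape w (p a)) :
    Legal w (properMoves s m l) p ∧ (properMoves s m l).foldl moveOne p =
      fun a => if a ∈ l then (m a).onInput w (p a) else p a := by
  induction l generalizing p with
  | nil => exact ⟨trivial, by simp [properMoves]⟩
  | cons a l ih =>
    rw [List.nodup_cons] at hl
    have hsp := properMove_spec w (m a) (hp a)
    rw [← hs a (by simp)] at hsp
    cases hm : properMove (m a) (s a) with
    | none =>
      rw [hm] at hsp
      simp only at hsp
      obtain ⟨h1, h2⟩ := ih hl.2 p hp fun b hb => hs b (by simp [hb])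
      simp only [properMoves, hm]
      refine ⟨h1, h2.trans (funext fun b => ?_)⟩
      rcases eq_or_ne b a with rfl | hb
      · simp [hl.1, hsp]
      · simp [hb]
    | some r =>
      rw [hm] at hsp
      have hle := Move.onInput_le w (m a) (hp a)
      have e : moveOne p (a, r) = Function.update p a ((m a).onInput w (p a)) := by
        cases r <;> simp only at hsp <;> rw [hsp.2] <;> rfl
      simp only [properMoves, hm]
      obtain ⟨h1, h2⟩ := ih hl.2 (Function.update p a ((m a).onInput w (p a))) (fun b => by
        rcases eq_or_ne b a with rfl | hb
        · simpa using hle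
        · simpa [hb] using hp b) (fun b hb => by
        rw [Function.update_of_ne (by rintro rfl; exact hl.1 hb)]
        exact hs b (by simp [hb]))
      refine ⟨⟨?_, by rwa [e]⟩, ?_⟩
      · cases r <;> simp only at hsp <;> exact hsp.1
      · rw [List.foldl_cons, e, h2]
        funext b
        rcases eq_or_ne b a with rfl | hb
        · simp [hl.1]
        · simp [hb]

/-- At `◁` the first move is to the left, elsewhere to the right, so no end of the tape is met. -/
theorem idleMoves_spec (a : Fin k) (p : Fin k → ℕ) (hp : p a ≤ w.length + 1) :
    Legal w (idleMoves a (readTape w (p a))) p ∧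
      (idleMoves a (readTape w (p a))).foldl moveOne p = p := by
  have hr := readTape_eq_right_iff w (p a)
  have key : ∀ x y, (Function.update (Function.update p a x) a y : Fin k → ℕ) =
      Function.update p a y := fun x y => Function.update_idem _ _ _
  cases hs : readTape w (p a) <;> simp only [hs] at hr <;>
    simp [idleMoves, Legal, moveOne] at hr ⊢
  · omega
  · have e : p a - 1 + 1 = p a := by omega
    simp [e]
    omega
  · omega

/-- The moves of a step of an automaton, preceded by two moves that cancel. -/
def agenda [NeZero k] (s : Fin k → TapeSymbol) (m : Fin k → Move) : List (Fin k × Bool) :=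
  idleMoves 0 (s 0) ++ properMoves s m (List.finRange k)

theorem agenda_spec [NeZero k] (m : Fin k → Move) (p : Fin k → ℕ)
    (hp : ∀ a, p a ≤ w.length + 1) :
    Legal w (agenda (fun a => readTape w (p a)) m) p ∧
      (agenda (fun a => readTape w (p a)) m).foldl moveOne p =
        fun a => (m a).onInput w (p a) := by
  obtain ⟨h1, h2⟩ := idleMoves_spec (w := w) (0 : Fin k) p (hp 0)
  obtain ⟨h3, h4⟩ := properMoves_spec (w := w) m _ (List.finRange k) (List.nodup_finRange k) p hp
    fun a _ => rfl
  refine ⟨legal_append h1 (by rwa [h2]), ?_⟩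
  rw [agenda, List.foldl_append, h2, h4]
  simp

/-- The bound makes the set of pending lists, and so the set of states, finite. -/
theorem length_agenda [NeZero k] (s : Fin k → TapeSymbol) (m : Fin k → Move) :
    (agenda s m).length ≤ k + 2 := by
  have h := length_properMoves s m (List.finRange k)
  rw [List.length_finRange] at h
  have h' : (idleMoves (0 : Fin k) (s 0)).length = 2 := by cases s 0 <;> rfl
  rw [agenda, List.length_append, h']
  omega

/-- This is the purpose of the cancelling moves: a circular automaton moves a head in each
transition, while all heads of a two-way automaton may stay. -/
theorem agenda_ne_nil [NeZero k] (s : Fin k → TapeSymbol) (m : Fin k → Move) :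
    agenda s m ≠ [] := by
  rw [agenda]
  cases s 0 <;> simp [idleMoves]

end Agenda

variable {k : ℕ} (M : TwoWayDFA k)

/-- The lists of moves that are still to be made in the simulation of a step. -/
abbrev Pending (k : ℕ) : Type := {l : List (Fin k × Bool) // l.length ≤ k + 2}

instance (k : ℕ) : Finite (Pending k) := List.finite_length_le _ _

/-- The symbols at the heads, after a move of a head to the symbol `s`. -/
def recordSymbol (t : Fin k → TapeSymbol) (s : Option Bool) :
    Option (Fin k × Bool) → Fin k → TapeSymbol
  | none => t
  | some (a, r) => Function.update t a (match s with
    | some b => .letter b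
    | none => if r then .right else .left)

/-- Make the first move of a list. -/
def firstMove (q : M.Q) (t : Fin k → TapeSymbol) : Pending k →
    CircularAction (M.Q × (Fin k → TapeSymbol) × Option (Fin k × Bool) × Pending k) k
  | ⟨[], _⟩ => .reject
  | ⟨m :: l, h⟩ => .go (q, t, some m, ⟨l, (Nat.le_succ _).trans h⟩) m.1 (ofTape (t m.1)) m.2

open Classical in
/-- The circular automaton that simulates a two-way automaton. Its states record the symbols of
the linear tape at the heads, the last move, and the moves that remain to be made. -/
noncomputable def toCircular [NeZero k] : CircularAutomaton k where
  Q := M.Q × (Fin k → TapeSymbol) × Option (Fin k × Bool) × Pending k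
  finite_Q := by
    have := M.finite_Q
    infer_instance
  start := (M.start, fun _ => .left, none, ⟨[], Nat.zero_le _⟩)
  δ := fun c s => match c.2.2.2 with
    | ⟨[], _⟩ => match M.δ c.1 (recordSymbol c.2.1 s c.2.2.1) with
      | none => if c.1 ∈ M.accept then .accept else .reject
      | some (q, m) => M.firstMove q (recordSymbol c.2.1 s c.2.2.1)
          ⟨agenda (recordSymbol c.2.1 s c.2.2.1) m, length_agenda _ _⟩
    | l => M.firstMove c.1 (recordSymbol c.2.1 s c.2.2.1) l

variable {M} [NeZero k] {w : List Bool}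

/-- A configuration of the circular automaton represents a configuration of the two-way automaton
and a list of pending moves. -/
def Represents (c : M.toCircular.Cfg w) (q : M.Q) (l : List (Fin k × Bool)) (p : Fin k → ℕ) :
    Prop :=
  c.1.1 = q ∧ c.1.2.2.2.1 = l ∧ (∀ a, p a ≤ w.length + 1) ∧
    (∀ a, (c.2.2 a : ℕ) = p a % (w.length + 1)) ∧
    recordSymbol c.1.2.1 (symbolAt w (c.2.2 c.2.1)) c.1.2.2.1 = fun a => readTape w (p a)

/-- Positions are reduced modulo `|w| + 1`, and both end markers lie over `⋆`. -/
theorem ofTape_readTape {p : ℕ} (hp : p ≤ w.length + 1) (j : Fin (w.length + 1))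
    (hj : (j : ℕ) = p % (w.length + 1)) : symbolAt w j = ofTape (readTape w p) := by
  rcases Nat.lt_or_ge p (w.length + 1) with h | h
  · rw [Nat.mod_eq_of_lt h] at hj
    rw [← hj, readTape_fin, ofTape_toTape]
  · obtain rfl : p = w.length + 1 := le_antisymm hp h
    rw [Nat.mod_self] at hj
    obtain rfl : j = 0 := Fin.ext hj
    rw [(readTape_eq_right_iff w _).2 le_rfl]
    rfl

theorem neighbour_val {p : ℕ} {r : Bool} (hp : if r then p ≤ w.length else 1 ≤ p)
    (hp' : p ≤ w.length + 1) (j : Fin (w.length + 1)) (hj : (j : ℕ) = p % (w.length + 1)) :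
    (neighbour r j : ℕ) = (if r then p + 1 else p - 1) % (w.length + 1) := by
  have hj' := j.2
  cases r with
  | true =>
    simp only [if_true] at hp ⊢
    rw [neighbour, if_pos rfl, Fin.val_add, hj]
    simp
  | false =>
    simp only [Bool.false_eq_true, if_false] at hp ⊢
    rw [neighbour, if_neg (by simp)]
    rcases Nat.lt_or_ge p (w.length + 1) with h | h
    · rw [Nat.mod_eq_of_lt h] at hj
      rw [Fin.val_sub_one_of_ne_zero (by intro h0; rw [h0] at hj; simp at hj; omega), hj,
        Nat.mod_eq_of_lt (by omega)]
    · obtain rfl : p = w.length + 1 := le_antisymm hp' h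
      rw [Nat.mod_self] at hj
      obtain rfl : j = 0 := Fin.ext hj
      simp [Fin.coe_neg_one]

/-- The direction of the last move tells apart the two end markers over `⋆`: reached by a right move
it is `◁`, by a left move `▷`. -/
theorem readTape_moved {p : ℕ} {r : Bool} (hp : if r then p ≤ w.length else 1 ≤ p)
    (hp' : p ≤ w.length + 1) (j : Fin (w.length + 1))
    (hj : (j : ℕ) = (if r then p + 1 else p - 1) % (w.length + 1)) :
    (match symbolAt w j with
    | some b => TapeSymbol.letter b
    | none => if r then .right else .left) = readTape w (if r then p + 1 else p - 1) := by
  have hle : (if r then p + 1 else p - 1) ≤ w.length + 1 := by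
    cases r <;> simp at hp ⊢ <;> omega
  have h := ofTape_readTape hle j hj
  have hl := readTape_eq_left_iff w (if r then p + 1 else p - 1)
  have hr := readTape_eq_right_iff w (if r then p + 1 else p - 1)
  rw [h]
  cases hs : readTape w (if r then p + 1 else p - 1) with
  | letter b => simp [ofTape]
  | left =>
    rw [hs] at hl
    cases r
    · simp [ofTape]
    · simp at hl
  | right =>
    rw [hs] at hr
    cases r
    · simp at hr; omega
    · simp [ofTape]

/-- The symbol that the circular move must announce is known from the recorded symbols of the linear
tape. -/
theorem next_of_firstMove {c : M.toCircular.Cfg w} {q : M.Q} {m : Fin k × Bool}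
    {l : List (Fin k × Bool)} {hl : (m :: l).length ≤ k + 2} {p : Fin k → ℕ}
    (hp : ∀ a, p a ≤ w.length + 1) (hpos : ∀ a, (c.2.2 a : ℕ) = p a % (w.length + 1))
    (hm : if m.2 then p m.1 ≤ w.length else 1 ≤ p m.1)
    (h : M.toCircular.action w c = M.firstMove q (fun a => readTape w (p a)) ⟨m :: l, hl⟩) :
    ∃ c', M.toCircular.next w c = some c' ∧ Represents c' q l (moveOne p m) := by
  obtain ⟨a, r⟩ := m
  simp only at hm
  have hn : ∀ b, ((Function.update c.2.2 a (neighbour r (c.2.2 a)) b : Fin _) : ℕ) =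
      moveOne p (a, r) b % (w.length + 1) := by
    intro b
    rcases eq_or_ne b a with rfl | hb
    · simpa [moveOne] using neighbour_val hm (hp b) _ (hpos b)
    · simpa [moveOne, hb] using hpos b
  refine ⟨((q, fun a => readTape w (p a), some (a, r), ⟨l, (Nat.le_succ _).trans hl⟩), a,
    Function.update c.2.2 a (neighbour r (c.2.2 a))), ?_, rfl, rfl, fun b => ?_, hn, ?_⟩
  · rw [CircularAutomaton.next, h]
    simp only [firstMove]
    rw [if_pos (ofTape_readTape (hp a) _ (hpos a))]
  · rcases eq_or_ne b a with rfl | hb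
    · have := hp b
      cases r <;> simp [moveOne] at hm ⊢ <;> omega
    · simpa [moveOne, hb] using hp b
  · funext b
    simp only [recordSymbol]
    rcases eq_or_ne b a with rfl | hb
    · rw [Function.update_self]
      have := readTape_moved hm (hp b) _ (by simpa [moveOne] using hn b)
      simpa [moveOne] using this
    · simp [moveOne, hb]

theorem Represents.next_cons {c : M.toCircular.Cfg w} {q : M.Q} {m : Fin k × Bool}
    {l : List (Fin k × Bool)} {p : Fin k → ℕ} (h : Represents c q (m :: l) p)
    (hm : Legal w (m :: l) p) :
    ∃ c', M.toCircular.next w c = some c' ∧ Represents c' q l (moveOne p m) := by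
  obtain ⟨⟨q, t, m', ⟨l', hl'⟩⟩, a, pos⟩ := c
  obtain ⟨rfl, rfl, h3, h4, h5⟩ := h
  refine next_of_firstMove (hl := hl') h3 h4 hm.1 ?_
  simp only [CircularAutomaton.action, toCircular]
  rw [h5]

theorem Represents.reach {c : M.toCircular.Cfg w} {q : M.Q} {l : List (Fin k × Bool)}
    {p : Fin k → ℕ} (h : Represents c q l p) (hl : Legal w l p) :
    ∃ c', Relation.ReflTransGen (fun c c' => M.toCircular.next w c = some c') c c' ∧
      Represents c' q [] (l.foldl moveOne p) := by
  induction l generalizing c p with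
  | nil => exact ⟨c, .refl, h⟩
  | cons m l ih =>
    obtain ⟨c₁, h1, h2⟩ := h.next_cons hl
    obtain ⟨c₂, h3, h4⟩ := ih h2 hl.2
    exact ⟨c₂, .head h1 h3, h4⟩

theorem accepts_toCircular (M : TwoWayDFA k) (w : List Bool) :
    M.toCircular.Accepts w ↔ M.Accepts w := by
  refine Iff.trans ?_ (accFrom_iff (M.next w) (fun c => c.1 ∈ M.accept) _)
  refine accFrom_iff_of_simulation
    (Rel := fun (c : M.toCircular.Cfg w) d => Represents c d.1 [] d.2) ?_ ?_ ?_
  · rintro ⟨⟨q, t, m, ⟨l, hl⟩⟩, a, pos⟩ ⟨q', p⟩ ⟨rfl, rfl, h3, h4, h5⟩ hn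
    simp only [next, Option.map_eq_none_iff] at hn
    simp only at h5
    simp only [CircularAutomaton.next, CircularAutomaton.Acc, CircularAutomaton.action, toCircular,
      h5, hn]
    by_cases hq : q ∈ M.accept <;> simp [hq]
  · rintro ⟨⟨q, t, m, ⟨l, hl⟩⟩, a, pos⟩ ⟨q', p⟩ d' ⟨rfl, rfl, h3, h4, h5⟩ hn
    simp only [next, Option.map_eq_some_iff] at hn
    simp only at h5
    obtain ⟨⟨q', mv⟩, hn, rfl⟩ := hn
    obtain ⟨hlegal, hfold⟩ := agenda_spec mv p h3
    obtain ⟨m₁, l₁, hag⟩ := List.exists_cons_of_ne_nil (agenda_ne_nil (fun a => readTape w (p a)) mv)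
    have hlen := length_agenda (fun a => readTape w (p a)) mv
    rw [hag] at hlegal hfold hlen
    obtain ⟨c₁, hc₁, hR⟩ := next_of_firstMove (M := M) (w := w) (q := q')
      (c := ((q, t, m, ⟨[], hl⟩), a, pos)) (hl := hlen) h3 h4 hlegal.1 (by
        simp only [CircularAutomaton.action, toCircular, h5, hn]
        congr 1
        exact Subtype.ext hag)
    obtain ⟨c₂, hc₂, hR'⟩ := hR.reach hlegal.2
    refine ⟨c₂, Relation.TransGen.head'_iff.2 ⟨c₁, hc₁, hc₂⟩, ?_⟩
    rw [← List.foldl_cons, hfold] at hR'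
    exact hR'
  · exact ⟨rfl, rfl, fun _ => Nat.zero_le _, fun _ => rfl, rfl⟩

end TwoWayDFA

/-! ### The computation of a program on a word -/

/-- A transition relation that halts at the points `Done` is equivalent to a deterministic
transition system that it simulates step by step. -/
theorem accFrom_iff_of_bisimulation {C X : Type*} {next : C → Option C} {acc : C → Prop}
    {Done : X → Prop} {Step : X → X → Prop} {Rel : C → X → Prop}
    (hdone : ∀ c x, Rel c x → (Done x ↔ next c = none ∧ acc c))
    (hnext : ∀ c x c', Rel c x → next c = some c' → ∃ x', Step x x' ∧ Rel c' x')
    (hstep : ∀ c x x', Rel c x → Step x x' → ∃ c', next c = some c' ∧ Rel c' x')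
    {c : C} {x : X} (h : Rel c x) :
    (∃ x', Relation.ReflTransGen Step x x' ∧ Done x') ↔ AccFrom next acc c := by
  constructor
  · rintro ⟨x', hx, hx'⟩
    induction hx using Relation.ReflTransGen.head_induction_on generalizing c with
    | refl => exact .halt ((hdone _ _ h).1 hx').1 ((hdone _ _ h).1 hx').2
    | head h1 _ ih =>
      obtain ⟨c', h2, h3⟩ := hstep _ _ _ h h1
      exact .step h2 (ih h3)
  · intro hc
    induction hc generalizing x with
    | halt h1 h2 => exact ⟨x, .refl, (hdone _ _ h).2 ⟨h1, h2⟩⟩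
    | step h1 _ ih =>
      obtain ⟨x', h2, h3⟩ := hnext _ _ _ h h1
      obtain ⟨y, h4, h5⟩ := ih h3
      exact ⟨y, .head h2 h4, h5⟩

theorem ListVertex.index_injective : Function.Injective ListVertex.index := by
  rintro ⟨_ | _ | _, _ | _⟩ ⟨_ | _ | _, _ | _⟩ h <;> simp [ListVertex.index] at h ⊢

theorem ListVertex.index_ne_acceptIndex (v : ListVertex) : v.index ≠ acceptIndex := by
  obtain ⟨_ | _ | _, _ | _⟩ := v <;> simp [ListVertex.index, acceptIndex]

theorem mem_listSpace_iff {p : Pt} : p ∈ listSpace ↔ ∃ v : ListVertex, p.1 = v.index := by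
  simp only [listSpace, Set.mem_iUnion, unitSegment, Set.mem_ofPred_eq]

theorem notMem_listSpace_of_accept {p : Pt} (h : p.1 = acceptIndex) : p ∉ listSpace := fun h' => by
  obtain ⟨v, hv⟩ := mem_listSpace_iff.1 h'
  exact v.index_ne_acceptIndex (hv.symm.trans h)

open CircularAutomaton

/-- The address of a number. -/
def Splitting.address {N : ℕ} (S : Splitting N) (u : unitInterval) : Fin N := (S.locate u).1

/-- The number with the same position as a given one in another address. -/
def Splitting.move {N : ℕ} (S : Splitting N) (j : Fin N) (u : unitInterval) : unitInterval :=
  S.point (j, (S.locate u).2)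

/-- The edges of the representation of a word: at an out-vertex, `r = true`, to the in-vertex
of the next position, and at an in-vertex, `r = false`, to the out-vertex of the previous one. -/
def WordStep (w : List Bool) (S : Splitting (w.length + 1)) (p p' : Pt) : Prop :=
  ∃ r : Bool, p.1 = ListVertex.index (symbolAt w (S.address (p.2 0)), !r) ∧
    p' = (ListVertex.index (symbolAt w (neighbour r (S.address (p.2 0))), r),
      Function.update p.2 0 (S.move (neighbour r (S.address (p.2 0))) (p.2 0)))

/-- At the address `j` start the forward edge of index `j` and the backward edge of index `j - 1`.
-/
theorem wordStep_iff (w : List Bool) (S : Splitting (w.length + 1)) (p p' : Pt) :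
    WordStep w S p p' ↔
      ∃ e, p ∈ (wordGraphing w S).src e ∧ (wordGraphing w S).real e p = p' := by
  constructor
  · rintro ⟨r, h, rfl⟩
    cases r with
    | true => exact ⟨(S.address (p.2 0), true), ⟨h, rfl⟩, rfl⟩
    | false =>
      refine ⟨(S.address (p.2 0) - 1, false), ?_, rfl⟩
      show p ∈ S.cell _ _
      rw [sub_add_cancel]
      exact ⟨h, rfl⟩
  · rintro ⟨⟨j, r⟩, h, rfl⟩
    cases r with
    | true =>
      obtain ⟨h1, rfl⟩ := h
      exact ⟨true, h1, rfl⟩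
    | false =>
      obtain ⟨h1, h2⟩ := h
      have h2 : S.address (p.2 0) = j + 1 := h2
      refine ⟨false, by rw [h2]; exact h1, ?_⟩
      rw [neighbour, if_neg (by simp), h2, add_sub_cancel_right]
      rfl

namespace Program

variable {m : Microcosm} (P : Program m) (w : List Bool) (S : Splitting (w.length + 1))

/-- The edges of the graphing of a program. -/
def EdgeStep (s s' : P.D × Pt) : Prop :=
  ∃ e, P.graphing.dom e = s.1 ∧ P.graphing.cod e = s'.1 ∧ s.2 ∈ P.graphing.src e ∧
    P.graphing.real e s.2 = s'.2

/-- An edge of the program, followed by an edge of the word. -/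
def Step (s s' : P.D × Pt) : Prop :=
  ∃ p, P.EdgeStep s (s'.1, p) ∧ WordStep w S p s'.2

/-- An edge of the program leads to the final state and to the segment "accept". -/
def Done (s : P.D × Pt) : Prop :=
  ∃ p : Pt, P.EdgeStep s (P.init, p) ∧ p.1 = acceptIndex

variable {w S}

/-- By alternation the path consists of pairs of a program edge and a word edge, followed by one
program edge: word edges end in `listSpace`, away from "accept". -/
theorem reaches_of_path (π : List (P.graphing.E ⊕ (wordGraphing w S).E)) {d : P.D} {p : Pt}
    (hπ : π.IsChain (fun a b => a.isLeft ≠ b.isLeft)) (hhead : ∃ e, π.head? = some (.inl e))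
    (hsrc : p ∈ Graphing.pathSrc P.graphing (wordGraphing w S) π (d, ()))
    (hcod : Graphing.pathCod P.graphing (wordGraphing w S) π (d, ()) = (P.init, ()))
    (hreal : (Graphing.pathReal P.graphing (wordGraphing w S) π p).1 = acceptIndex) :
    ∃ s, Relation.ReflTransGen (P.Step w S) (d, p) s ∧ P.Done s := by
  match π, hhead with
  | [.inl e], _ =>
    obtain ⟨h1, h2, -⟩ := hsrc
    exact ⟨_, .refl, _, ⟨e, h1, (Prod.ext_iff.1 hcod).1, h2, rfl⟩, hreal⟩
  | .inl e :: .inl e' :: π, _ => simp at hπ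
  | [.inl e, .inr g], _ =>
    obtain ⟨h1, h2, h3, h4, -⟩ := hsrc
    exact absurd ((wordGraphing w S).mapsTo g h4) (notMem_listSpace_of_accept hreal)
  | .inl e :: .inr g :: .inr g' :: π, _ => simp at hπ
  | .inl e :: .inr g :: .inl e' :: π, _ =>
    obtain ⟨h1, h2, h3, h4, h5⟩ := hsrc
    obtain ⟨s, hs, hs'⟩ := reaches_of_path (.inl e' :: π)
      (by rw [List.isChain_cons_cons, List.isChain_cons_cons] at hπ; exact hπ.2.2) ⟨e', rfl⟩ h5
      hcod hreal
    exact ⟨s, .head ⟨_, ⟨e, h1, rfl, h2, rfl⟩, (wordStep_iff ..).2 ⟨g, h4, rfl⟩⟩ hs, hs'⟩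

theorem path_of_reaches {s s' : P.D × Pt} (h : Relation.ReflTransGen (P.Step w S) s s')
    (h' : P.Done s') : ∃ π : List (P.graphing.E ⊕ (wordGraphing w S).E),
      π.IsChain (fun a b => a.isLeft ≠ b.isLeft) ∧ (∃ e, π.head? = some (.inl e)) ∧
      s.2 ∈ Graphing.pathSrc P.graphing (wordGraphing w S) π (s.1, ()) ∧
      Graphing.pathCod P.graphing (wordGraphing w S) π (s.1, ()) = (P.init, ()) ∧
      (Graphing.pathReal P.graphing (wordGraphing w S) π s.2).1 = acceptIndex := by
  induction h using Relation.ReflTransGen.head_induction_on with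
  | refl =>
    obtain ⟨p, ⟨e, h1, h2, h3, rfl⟩, h5⟩ := h'
    exact ⟨[.inl e], by simp, ⟨e, rfl⟩, ⟨h1, h3, trivial⟩, Prod.ext h2 rfl, h5⟩
  | head h _ ih =>
    obtain ⟨p, ⟨e, h1, h2, h3, rfl⟩, h5⟩ := h
    obtain ⟨g, h6, h7⟩ := (wordStep_iff ..).1 h5
    obtain ⟨π, h8, ⟨e', h9⟩, h10, h11, h12⟩ := ih
    obtain ⟨π, rfl⟩ : ∃ π', π = .inl e' :: π' := by
      cases π with
      | nil => simp at h9
      | cons a π => simp at h9; exact ⟨π, by rw [h9]⟩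
    simp only at h2 h7
    refine ⟨.inl e :: .inr g :: .inl e' :: π, ?_, ⟨e, rfl⟩, ⟨h1, h3, rfl, h6, ?_⟩, ?_, ?_⟩
    · rw [List.isChain_cons_cons, List.isChain_cons_cons]
      exact ⟨by simp, by simp, h8⟩
    · rw [h7, h2]; exact h10
    · rw [← h11, ← h2]; rfl
    · rw [← h12, ← h7]; rfl

/-- No word edge starts at "accept", so paths begin with a program edge; and "accept" lies outside
of the cut, so the restriction of the execution is automatic. -/
theorem acceptsAt_iff (x : Cube) :
    P.AcceptsAt w S x ↔
      ∃ s, Relation.ReflTransGen (P.Step w S) (P.init, (acceptIndex, x)) s ∧ P.Done s := by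
  have hcut : ∀ p : Pt, p.1 = acceptIndex →
      p ∉ P.graphing.carrier ∩ (wordGraphing w S).carrier := fun p hp h =>
    notMem_listSpace_of_accept hp h.2
  constructor
  · rintro ⟨⟨⟨π, hne, hπ⟩, d⟩, h1, h2, h3, h4⟩
    obtain rfl : d = (P.init, ()) := h1
    refine P.reaches_of_path π hπ ?_ h3.1 h2 h4
    match π, hne with
    | .inl e :: π, _ => exact ⟨e, rfl⟩
    | .inr g :: π, _ =>
      exact absurd ((wordGraphing w S).src_subset g h3.1.2.1) (notMem_listSpace_of_accept rfl)
  · rintro ⟨s, h, h'⟩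
    obtain ⟨π, h1, ⟨e, h2⟩, h3, h4, h5⟩ := P.path_of_reaches h h'
    exact ⟨⟨⟨π, by rintro rfl; simp at h2, h1⟩, (P.init, ())⟩, rfl, h4,
      ⟨h3, hcut _ rfl, hcut _ h5⟩, h5⟩

end Program

/-! ### Splittings of the unit interval -/

namespace Splitting

variable {N : ℕ} (S : Splitting N)

theorem measurable_address : Measurable S.address := measurable_fst.comp S.measurable_locate

theorem ae_locate_point :
    ∀ᵐ q ∂((N : ENNReal)⁻¹ • (Measure.count : Measure (Fin N)).prod
      (volume : Measure unitInterval)), S.locate (S.point q) = q :=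
  Measure.ae_smul_measure S.locate_point _

theorem measurePreserving_locate : MeasurePreserving S.locate volume
    ((N : ENNReal)⁻¹ • (Measure.count : Measure (Fin N)).prod (volume : Measure unitInterval)) := by
  refine ⟨S.measurable_locate, ?_⟩
  conv_lhs => rw [← S.measurePreserving_point.map_eq]
  rw [Measure.map_map S.measurable_locate S.measurePreserving_point.measurable]
  exact (Measure.map_congr (g := id) S.ae_locate_point).trans Measure.map_id

theorem ae_point_locate : ∀ᵐ u, S.point (S.locate u) = u := by
  have hm : Measurable fun u => S.point (S.locate u) :=
    S.measurePreserving_point.measurable.comp S.measurable_locate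
  rw [← S.measurePreserving_point.map_eq]
  refine (ae_map_iff S.measurePreserving_point.aemeasurable
    (measurableSet_eq_fun hm measurable_id)).2 ?_
  filter_upwards [S.ae_locate_point] with q hq
  rw [hq]
  rfl

/-- Numbers whose position is located correctly in each address. -/
def Regular (u : unitInterval) : Prop :=
  S.point (S.locate u) = u ∧ ∀ j, S.locate (S.move j u) = (j, (S.locate u).2)

/-- As there are finitely many addresses, almost every position is located correctly in all of them;
this set of positions is pulled back along `locate`. -/
theorem ae_regular : ∀ᵐ u, S.Regular u := by
  refine S.ae_point_locate.and ?_
  have h1 : ∀ᵐ v : unitInterval, ∀ j : Fin N, S.locate (S.point (j, v)) = (j, v) := by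
    rw [ae_all_iff]
    intro j
    have h := Measure.ae_ae_of_ae_prod S.locate_point
    rw [Measure.ae_count_iff] at h
    exact h j
  have h2 : ∀ᵐ q ∂((Measure.count : Measure (Fin N)).prod (volume : Measure unitInterval)),
      ∀ j : Fin N, S.locate (S.point (j, q.2)) = (j, q.2) :=
    Measure.quasiMeasurePreserving_snd.ae h1
  have h3 := S.measurePreserving_locate.quasiMeasurePreserving.ae
    (Measure.ae_smul_measure h2 (N : ENNReal)⁻¹)
  exact h3

variable {S} {u : unitInterval}

theorem Regular.address_move (h : S.Regular u) (j : Fin N) : S.address (S.move j u) = j := by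
  rw [address, h.2]

theorem Regular.move_move (h : S.Regular u) (i j : Fin N) :
    S.move i (S.move j u) = S.move i u := by
  rw [move, h.2]
  rfl

theorem Regular.move_address (h : S.Regular u) : S.move (S.address u) u = u := h.1

theorem Regular.move (h : S.Regular u) (j : Fin N) : S.Regular (S.move j u) := by
  refine ⟨?_, fun i => ?_⟩
  · rw [h.2]; rfl
  · rw [h.move_move, h.2, h.2]

variable (S)

theorem volume_address (j : Fin N) : volume {u | S.address u = j} = (N : ENNReal)⁻¹ := by
  have h : {u | S.address u = j} = S.locate ⁻¹' ({j} ×ˢ Set.univ) := by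
    ext u; simp [address]
  rw [h, S.measurePreserving_locate.measure_preimage
    ((measurableSet_singleton j).prod MeasurableSet.univ).nullMeasurableSet]
  simp [Measure.prod_prod]

end Splitting

theorem ae_cube {p : unitInterval → Prop} (h : ∀ᵐ u, p u) : ∀ᵐ x ∂cubeMeasure, ∀ a, p (x a) := by
  rw [ae_all_iff]
  intro a
  exact (measurePreserving_eval_infinitePi (fun _ : ℕ => (volume : Measure unitInterval))
    a).quasiMeasurePreserving.ae h

theorem Program.entry_eq {m : Microcosm} (P : Program m) (w : List Bool)
    (S : Splitting (w.length + 1)) :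
    P.entry w S = Set.pi (Finset.range P.heads) fun _ => {u | S.address u = 0} := by
  ext x
  simp [Program.entry, Splitting.address]

/-- It ensures that `IsTrue` and `IsFalse` exclude each other. -/
theorem Program.cubeMeasure_entry_pos {m : Microcosm} (P : Program m) (w : List Bool)
    (S : Splitting (w.length + 1)) : 0 < cubeMeasure (P.entry w S) := by
  have hm : MeasurableSet {u | S.address u = 0} :=
    S.measurable_address (measurableSet_singleton 0)
  rw [P.entry_eq, cubeMeasure, Measure.infinitePi_pi _ fun _ _ => hm]
  simp [S.volume_address, pos_iff_ne_zero, ENNReal.inv_eq_zero]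

/-- The summand is the length of the part of `[j, j + 1]` below `s`. With `s = N * t` the sum gives
the measure of the preimage of `[0, t]` under `affine`. -/
theorem sum_clamp (n : ℕ) {s : ℝ} (hs : 0 ≤ s) :
    ∑ j ∈ Finset.range n, min 1 (max 0 (s - j)) = min (n : ℝ) s := by
  induction n with
  | zero => simp [hs]
  | succ n ih =>
    rw [Finset.sum_range_succ, ih]
    push_cast
    rcases le_total s n with h | h
    · rw [min_eq_right h, max_eq_left (by linarith), min_eq_right (by norm_num : (0 : ℝ) ≤ 1),
        min_eq_right (by linarith)]
      ring
    · rw [min_eq_left h, max_eq_right (by linarith)]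
      rcases le_total s (n + 1) with h' | h'
      · rw [min_eq_right h', min_eq_right (by linarith)]; ring
      · rw [min_eq_left h', min_eq_left (by linarith)]

theorem volume_unitInterval_le (t : ℝ) :
    volume {u : unitInterval | (u : ℝ) ≤ t} = ENNReal.ofReal (min 1 (max 0 t)) := by
  rcases lt_or_ge t 0 with h | h
  · have : {u : unitInterval | (u : ℝ) ≤ t} = ∅ := by
      ext u
      simpa using h.trans_le u.2.1
    simp [this, h.le]
  · rw [max_eq_right h]
    rcases le_total t 1 with h' | h'
    · have : {u : unitInterval | (u : ℝ) ≤ t} = Set.Iic ⟨t, h, h'⟩ := by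
        ext u; simp [← Subtype.coe_le_coe]
      rw [this, unitInterval.volume_Iic, min_eq_right h']
    · have : {u : unitInterval | (u : ℝ) ≤ t} = Set.univ := by
        ext u
        simpa using u.2.2.trans h'
      rw [this, min_eq_left h']
      simp

namespace Splitting

/-- The point `(j + u) / N`. -/
noncomputable def affine (N : ℕ) (q : Fin N × unitInterval) : unitInterval :=
  Set.projIcc 0 1 zero_le_one ((q.1 + q.2) / N)

theorem coe_affine {N : ℕ} (q : Fin N × unitInterval) : (affine N q : ℝ) = (q.1 + q.2) / N := by
  have hN : (0 : ℝ) < N := by exact_mod_cast q.1.pos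
  have h : ((q.1 : ℕ) : ℝ) + 1 ≤ N := by exact_mod_cast q.1.2
  rw [affine, Set.projIcc_of_mem _ ⟨by have := q.2.2.1; positivity, ?_⟩]
  rw [div_le_one hN]
  have := q.2.2.2
  linarith

theorem measurable_affine (N : ℕ) : Measurable (affine N) := by
  have h1 : Measurable fun q : Fin N × unitInterval => ((q.1 : ℕ) : ℝ) :=
    (measurable_of_countable fun j : Fin N => ((j : ℕ) : ℝ)).comp measurable_fst
  have h2 : Measurable fun q : Fin N × unitInterval => ((q.1 + q.2) / N : ℝ) :=
    (h1.add (measurable_subtype_coe.comp measurable_snd)).div_const _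
  exact continuous_projIcc.measurable.comp h2

theorem measurePreserving_affine (N : ℕ) [NeZero N] : MeasurePreserving (affine N)
    ((N : ENNReal)⁻¹ • (Measure.count : Measure (Fin N)).prod (volume : Measure unitInterval))
    volume := by
  have hN : (0 : ℝ) < N := by exact_mod_cast Nat.pos_of_ne_zero (NeZero.ne N)
  refine ⟨measurable_affine N, (Measure.ext_of_Iic _ _ fun t => ?_).symm⟩
  rw [Measure.map_apply (measurable_affine N) measurableSet_Iic, Measure.smul_apply,
    Measure.prod_apply (measurable_affine N measurableSet_Iic), lintegral_count, tsum_fintype,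
    unitInterval.volume_Iic]
  have h : ∀ j : Fin N, volume (Prod.mk j ⁻¹' (affine N ⁻¹' Set.Iic t)) =
      ENNReal.ofReal (min 1 (max 0 (N * t - j))) := by
    intro j
    rw [← volume_unitInterval_le]
    congr 1
    ext u
    simp only [Set.mem_preimage, Set.mem_Iic, Set.mem_ofPred_eq]
    rw [← Subtype.coe_le_coe, coe_affine, div_le_iff₀ hN]
    constructor <;> intro h <;> simp only at h ⊢ <;> linarith
  simp_rw [h]
  rw [← ENNReal.ofReal_sum_of_nonneg fun _ _ => le_min zero_le_one (le_max_left _ _),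
    Fin.sum_univ_eq_sum_range (fun j => min 1 (max 0 ((N : ℝ) * t - j))),
    sum_clamp _ (mul_nonneg hN.le t.2.1), min_eq_right (by nlinarith [t.2.2]),
    ENNReal.ofReal_mul hN.le, ENNReal.ofReal_natCast, smul_eq_mul, ← mul_assoc,
    ENNReal.inv_mul_cancel (by simp [NeZero.ne N]) (by simp), one_mul]

/-- The inverse of `affine`. -/
noncomputable def affineLocate (N : ℕ) [NeZero N] (u : unitInterval) : Fin N × unitInterval :=
  (Fin.ofNat N ⌊(N * u : ℝ)⌋₊, Set.projIcc 0 1 zero_le_one (N * u - ⌊(N * u : ℝ)⌋₊))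

theorem measurable_affineLocate (N : ℕ) [NeZero N] : Measurable (affineLocate N) := by
  have h1 : Measurable fun u : unitInterval => (N * u : ℝ) :=
    measurable_const.mul measurable_subtype_coe
  have h2 : Measurable fun u : unitInterval => ⌊(N * u : ℝ)⌋₊ := Nat.measurable_floor.comp h1
  have h3 : Measurable fun u : unitInterval => ((⌊(N * u : ℝ)⌋₊ : ℕ) : ℝ) :=
    (measurable_of_countable fun n : ℕ => (n : ℝ)).comp h2
  exact ((measurable_of_countable (Fin.ofNat N)).comp h2).prodMk
    (continuous_projIcc.measurable.comp (h1.sub h3))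

theorem affineLocate_affine {N : ℕ} [NeZero N] (q : Fin N × unitInterval) (hq : q.2 ≠ 1) :
    affineLocate N (affine N q) = q := by
  obtain ⟨j, u⟩ := q
  have hN : (N : ℝ) ≠ 0 := by simp [NeZero.ne N]
  have hu : (u : ℝ) < 1 := lt_of_le_of_ne u.2.2 fun h => hq (Subtype.ext h)
  have e : (N * (affine N (j, u) : ℝ)) = j + u := by
    rw [coe_affine]; field_simp
  have hf : ⌊((j : ℕ) : ℝ) + u⌋₊ = j := by
    rw [Nat.floor_eq_iff (by have := u.2.1; positivity)]
    exact ⟨by linarith [u.2.1], by linarith⟩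
  rw [affineLocate, e, hf, add_sub_cancel_left]
  refine Prod.ext (by simp) ?_
  simp [Set.projIcc_val]

/-- The splitting into intervals of length `1 / N`. -/
noncomputable def intervals (N : ℕ) [NeZero N] : Splitting N where
  point := affine N
  locate := affineLocate N
  measurePreserving_point := measurePreserving_affine N
  measurable_locate := measurable_affineLocate N
  locate_point := by
    have h : ∀ᵐ u : unitInterval, u ≠ 1 := by simp [ae_iff]
    filter_upwards [Measure.quasiMeasurePreserving_snd.ae h] with q hq
    exact affineLocate_affine q hq

theorem dist_intervals_point_le {N : ℕ} [NeZero N] (j : Fin N) (u v : unitInterval) :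
    dist ((intervals N).point (j, u)) ((intervals N).point (j, v)) ≤ 1 / N := by
  have hN : (0 : ℝ) < N := by exact_mod_cast j.pos
  have e : ((j : ℕ) + u : ℝ) / N - (j + v) / N = (u - v) / N := by ring
  rw [Subtype.dist_eq, Real.dist_eq]
  show |(affine N (j, u) : ℝ) - affine N (j, v)| ≤ _
  rw [coe_affine, coe_affine, e, abs_div, abs_of_pos hN]
  gcongr
  rw [abs_le]
  constructor <;> linarith [u.2.1, u.2.2, v.2.1, v.2.2]

/-- The normalised measure of `Fin N × [0,1]`. -/
noncomputable abbrev uniform (N : ℕ) : Measure (Fin N × unitInterval) :=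
  ((N : ENNReal)⁻¹ • (Measure.count : Measure (Fin N))).prod (volume : Measure unitInterval)

theorem smul_count_prod (N : ℕ) [NeZero N] :
    (N : ENNReal)⁻¹ • (Measure.count : Measure (Fin N)).prod (volume : Measure unitInterval) =
      uniform N := by
  rw [uniform, Measure.prod_smul_left]

instance (N : ℕ) [NeZero N] :
    IsProbabilityMeasure ((N : ENNReal)⁻¹ • (Measure.count : Measure (Fin N))) :=
  ⟨by simp [ENNReal.inv_mul_cancel, NeZero.ne N]⟩

theorem measurePreserving_point_uniform {N : ℕ} [NeZero N] (S : Splitting N) :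
    MeasurePreserving S.point (uniform N) volume := by
  rw [← smul_count_prod]; exact S.measurePreserving_point

theorem measurePreserving_locate_uniform {N : ℕ} [NeZero N] (S : Splitting N) :
    MeasurePreserving S.locate volume (uniform N) := by
  rw [← smul_count_prod]; exact S.measurePreserving_locate

theorem measurePreserving_blockPosition {M N : ℕ} [NeZero M] (R : Splitting M) :
    MeasurePreserving (fun q : Fin N × unitInterval => (q.1, (R.locate q.2).2))
      (uniform N) (uniform N) :=
  (MeasurePreserving.id ((N : ENNReal)⁻¹ • (Measure.count : Measure (Fin N)))).prod
    (measurePreserving_snd.comp R.measurePreserving_locate_uniform)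

section Blocks

variable {M N : ℕ} [NeZero M] [NeZero N] (R : Splitting M) (S : Splitting N)

/-- Split each address of `R` according to `S`. -/
noncomputable def blockPoint (q : Fin N × unitInterval) : Fin M × unitInterval :=
  ((R.locate q.2).1, S.point (q.1, (R.locate q.2).2))

/-- A composition of evident maps, with `I = [0,1]`: `N × I → N × (M × I) → (N × M) × I → (M × N) ×
I → M × (N × I) → M × I`. -/
theorem measurePreserving_blockPoint :
    MeasurePreserving (blockPoint R S) (uniform N) (uniform M) := by
  have h1 := (MeasurePreserving.id ((N : ENNReal)⁻¹ • (Measure.count : Measure (Fin N)))).prod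
    R.measurePreserving_locate_uniform
  have h2 := (measurePreserving_prodAssoc ((N : ENNReal)⁻¹ • (Measure.count : Measure (Fin N)))
    ((M : ENNReal)⁻¹ • (Measure.count : Measure (Fin M))) (volume : Measure unitInterval)).symm
  have h3 := (Measure.measurePreserving_swap
    (μ := (N : ENNReal)⁻¹ • (Measure.count : Measure (Fin N)))
    (ν := (M : ENNReal)⁻¹ • (Measure.count : Measure (Fin M)))).prod
    (MeasurePreserving.id (volume : Measure unitInterval))
  have h4 := measurePreserving_prodAssoc ((M : ENNReal)⁻¹ • (Measure.count : Measure (Fin M)))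
    ((N : ENNReal)⁻¹ • (Measure.count : Measure (Fin N))) (volume : Measure unitInterval)
  have h5 := (MeasurePreserving.id ((M : ENNReal)⁻¹ • (Measure.count : Measure (Fin M)))).prod
    S.measurePreserving_point_uniform
  exact h5.comp (h4.comp (h3.comp (h2.comp h1)))

/-- The splitting that splits each address of `R` according to `S`. -/
noncomputable def blocks : Splitting N where
  point q := R.point (blockPoint R S q)
  locate u := ((S.locate (R.locate u).2).1, R.point ((R.locate u).1, (S.locate (R.locate u).2).2))
  measurePreserving_point := by
    rw [smul_count_prod]
    exact R.measurePreserving_point_uniform.comp (measurePreserving_blockPoint R S)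
  measurable_locate := by
    have h1 := S.measurable_locate.comp (measurable_snd.comp R.measurable_locate)
    exact (measurable_fst.comp h1).prodMk (R.measurePreserving_point.measurable.comp
      ((measurable_fst.comp R.measurable_locate).prodMk (measurable_snd.comp h1)))
  locate_point := by
    have h : ∀ᵐ q ∂(uniform N), R.locate (R.point (blockPoint R S q)) = blockPoint R S q ∧
        S.locate (S.point (q.1, (R.locate q.2).2)) = (q.1, (R.locate q.2).2) ∧
        R.point (R.locate q.2) = q.2 := by
      have hR := R.ae_locate_point
      have hS := S.ae_locate_point
      rw [smul_count_prod] at hR hS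
      exact ((measurePreserving_blockPoint R S).quasiMeasurePreserving.ae hR).and
        (((measurePreserving_blockPosition R).quasiMeasurePreserving.ae hS).and
          (Measure.quasiMeasurePreserving_snd.ae R.ae_point_locate))
    rw [← smul_count_prod, Measure.ae_ennreal_smul_measure_eq (by simp)] at h
    filter_upwards [h] with q hq
    obtain ⟨h1, h2, h3⟩ := hq
    rw [h1, blockPoint]
    simp only [h2]
    exact Prod.ext rfl h3

/-- A change of address in `blocks R S` stays within one address of `R`. -/
theorem dist_blocks_point_le {ε : ℝ}
    (h : ∀ j u v, dist (R.point (j, u)) (R.point (j, v)) ≤ ε) (j : Fin N)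
    (q : Fin N × unitInterval) :
    dist ((blocks R S).point (j, q.2)) ((blocks R S).point q) ≤ ε :=
  h _ _ _

end Blocks

/-- Cut `[0,1]` into short intervals and distribute all `N` addresses over each of them; a change of
address is then a small displacement. -/
theorem exists_move_near (N : ℕ) [NeZero N] {ε : ℝ} (hε : 0 < ε) :
    ∃ S : Splitting N, ∀ j u, S.Regular u → dist (S.move j u) u < ε := by
  obtain ⟨M, hM⟩ := exists_nat_one_div_lt hε
  refine ⟨blocks (intervals (M + 1)) (intervals N), fun j u hu => ?_⟩
  refine lt_of_le_of_lt ?_ hM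
  have h := dist_blocks_point_le (intervals (M + 1)) (intervals N)
    (fun j u v => dist_intervals_point_le j u v) j
    ((blocks (intervals (M + 1)) (intervals N)).locate u)
  rw [hu.1] at h
  exact_mod_cast h

end Splitting

/-! ### Circular automata as programs -/

theorem headMaps_mono : Monotone headMaps :=
  monotone_nat_of_le_succ fun _ => le_sup_left

theorem headMaps_le_headMapsTop {k : ℕ} {i : ℕ∞} (h : (k : ℕ∞) ≤ i) :
    headMaps k ≤ headMapsTop i := by
  induction i using ENat.recTopCoe with
  | top => exact le_iSup headMaps k
  | coe n => exact headMaps_mono (by exact_mod_cast h)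

theorem translation_mem_headMaps (z : ℤ) (k : ℕ) : translation z ∈ headMaps k :=
  headMaps_mono (Nat.zero_le k) ⟨z, rfl⟩

theorem headSwap_mem_headMaps {a k : ℕ} (h : a < k) : headSwap a ∈ headMaps k :=
  headMaps_mono (Nat.succ_le_of_lt h)
    (le_sup_right (a := headMaps a) (Submonoid.subset_closure rfl))

theorem update_comp_perm {α : Type*} (x : ℕ → α) (σ : Equiv.Perm ℕ) (u : α) :
    Function.update (fun b => x (σ b)) 0 u = fun b => Function.update x (σ 0) u (σ b) := by
  funext b
  rcases eq_or_ne b 0 with rfl | hb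
  · simp
  · rw [Function.update_of_ne hb, Function.update_of_ne (σ.injective.ne hb)]

theorem swap_update {α : Type*} (x : ℕ → α) (a : ℕ) (u : α) :
    Function.update (fun b => x (Equiv.swap 0 a b)) 0 u =
      fun b => Function.update x a u (Equiv.swap 0 a b) := by
  rw [update_comp_perm, Equiv.swap_apply_left]

namespace CircularAutomaton

variable {k : ℕ} (A : CircularAutomaton k)

/-- The edges of the program of an automaton: the initial edge, and an edge for each state, head
and vertex. -/
abbrev Edge : Type := Option (A.Q × Fin k × ListVertex)

/-- The source state of an edge: the state of the automaton, and the head whose position is the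
first coordinate of the current point. -/
def edgeDom (e : A.Edge) : Option (A.Q × Fin k) := e.map fun c => (c.1, c.2.1)

/-- The index of the source of an edge. -/
def edgeIndex : A.Edge → ℤ
  | none => acceptIndex
  | some c => c.2.2.index

/-- The action of the automaton. -/
def edgeAction : A.Edge → CircularAction A.Q k
  -- The first action is built into the initial edge, since all heads start at `⋆`.
  | none => A.δ A.start none
  | some c => A.δ c.1 c.2.2.1

/-- The target state of an edge with a given action. -/
def actionCod : CircularAction A.Q k → Option (A.Q × Fin k)
  | .go q a _ _ => some (q, a)
  | _ => none

/-- The index of the target of an edge with a given action. -/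
def actionIndex : CircularAction A.Q k → ℤ
  | .go _ _ s r => ListVertex.index (s, !r)
  | _ => acceptIndex

/-- The source of an edge. -/
def edgeSrc (e : A.Edge) : Set Pt :=
  {p | p.1 = A.edgeIndex e ∧ A.edgeAction e ≠ .reject}

theorem mem_space_of_edgeIndex (e : A.Edge) {p : Pt} (h : p.1 = A.edgeIndex e) :
    p ∈ listSpace ∪ boolSpace := by
  cases e with
  | none => exact Or.inr (Or.inl h)
  | some c => exact Or.inl (mem_listSpace_iff.2 ⟨_, h⟩)

theorem mem_space_of_actionIndex (c : CircularAction A.Q k) {p : Pt} (h : p.1 = A.actionIndex c) :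
    p ∈ listSpace ∪ boolSpace := by
  cases c with
  | go q a s r => exact Or.inl (mem_listSpace_iff.2 ⟨_, h⟩)
  | _ => exact Or.inr (Or.inl h)

theorem measurableSet_edgeSrc (e : A.Edge) : MeasurableSet (A.edgeSrc e) :=
  (measurableSet_segment _).inter (MeasurableSet.const _)

theorem eq_of_edgeDom {e e' : A.Edge} (h : A.edgeDom e = A.edgeDom e')
    (h' : A.edgeIndex e = A.edgeIndex e') : e = e' := by
  cases e <;> cases e' <;> simp [edgeDom, edgeIndex] at h h' ⊢
  have := ListVertex.index_injective h'
  aesop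

variable [NeZero k]

/-- The head that has moved last. -/
def edgeHead : A.Edge → Fin k
  | none => 0
  | some c => c.2.1

/-- The head that moves next. -/
def actionHead : CircularAction A.Q k → Fin k
  | .go _ a _ _ => a
  | _ => 0

/-- The realisation of an edge. -/
def edgeReal (e : A.Edge) : Function.End Pt :=
  -- Read from right to left: the head that moved last returns to its own coordinate, the next head
  -- comes to the front, and the segment changes.
  translation (A.actionIndex (A.edgeAction e) - A.edgeIndex e) *
    (headSwap (A.actionHead (A.edgeAction e)) * headSwap (A.edgeHead e))

theorem edgeReal_mem (e : A.Edge) : A.edgeReal e ∈ headMaps k :=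
  mul_mem (translation_mem_headMaps _ _)
    (mul_mem (headSwap_mem_headMaps (Fin.is_lt _)) (headSwap_mem_headMaps (Fin.is_lt _)))

theorem edgeReal_apply {e : A.Edge} {p : Pt} (h : p.1 = A.edgeIndex e) :
    A.edgeReal e p = (A.actionIndex (A.edgeAction e), fun b => p.2 (Equiv.swap 0 (A.edgeHead e : ℕ)
      (Equiv.swap 0 (A.actionHead (A.edgeAction e) : ℕ) b))) :=
  Prod.ext ((congrArg (· + _) h).trans (add_sub_cancel _ _)) rfl

theorem image_edgeReal (e : A.Edge) : A.edgeReal e '' A.edgeSrc e =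
    {p | p.1 = A.actionIndex (A.edgeAction e) ∧ A.edgeAction e ≠ .reject} := by
  ext p
  constructor
  · rintro ⟨p, ⟨h1, h2⟩, rfl⟩
    rw [A.edgeReal_apply h1]
    exact ⟨rfl, h2⟩
  · rintro ⟨h1, h2⟩
    refine ⟨(A.edgeIndex e, fun b => p.2 (Equiv.swap 0 (A.actionHead (A.edgeAction e) : ℕ)
      (Equiv.swap 0 (A.edgeHead e : ℕ) b))), ⟨rfl, h2⟩, ?_⟩
    rw [A.edgeReal_apply rfl]
    refine Prod.ext h1.symm ?_
    funext b
    simp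

/-- The program that simulates an automaton. -/
def toProgram {i : ℕ∞} (hk : (k : ℕ∞) ≤ i) : Program (headMicrocosm i) where
  D := Option (A.Q × Fin k)
  finite_D := inferInstance
  graphing :=
    { carrier := listSpace ∪ boolSpace
      measurableSet_carrier := measurableSet_listSpace.union
        ((measurableSet_segment _).union (measurableSet_segment _))
      E := A.Edge
      countable_E := inferInstance
      dom := A.edgeDom
      cod := fun e => A.actionCod (A.edgeAction e)
      src := A.edgeSrc
      measurableSet_src := A.measurableSet_edgeSrc
      src_subset := fun e _ h => A.mem_space_of_edgeIndex e h.1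
      real := A.edgeReal
      measurable_real := fun e => (headMaps_le k (A.edgeReal_mem e)).1
      mapsTo := fun e p h => A.mem_space_of_actionIndex (A.edgeAction e)
        (by rw [A.edgeReal_apply h.1]) }
  isIn := fun e => ⟨headMaps_le_headMapsTop hk (A.edgeReal_mem e), by
    show MeasurableSet (A.edgeReal e '' A.edgeSrc e)
    rw [image_edgeReal]
    exact (measurableSet_segment _).inter (MeasurableSet.const _)⟩
  isDeterministic := fun d => by
    convert measure_empty (μ := ptMeasure)
    rw [Set.eq_empty_iff_forall_notMem]
    rintro p ⟨e, e', hne, h, h', hp, hp'⟩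
    exact hne (A.eq_of_edgeDom (h.trans h'.symm) (hp.1.symm.trans hp'.1))
  carrier_eq := rfl
  finite_real := Set.finite_range _
  init := none
  heads := k

variable {A} {i : ℕ∞} (hk : (k : ℕ∞) ≤ i) {w : List Bool} {S : Splitting (w.length + 1)}

/-- A configuration of the automaton is represented by a state and a point. -/
def IsCoded (S : Splitting (w.length + 1)) (c : A.Cfg w) (s : Option (A.Q × Fin k) × Pt) : Prop :=
  ∃ e : A.Edge, A.edgeDom e = s.1 ∧ s.2.1 = A.edgeIndex e ∧ A.edgeHead e = c.2.1 ∧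
    A.edgeAction e = A.action w c ∧ ∃ x : Cube, s.2.2 = (fun b => x (Equiv.swap 0 (c.2.1 : ℕ) b)) ∧
      ∀ a : Fin k, S.address (x a) = c.2.2 a ∧ S.Regular (x a)

/-- State and segment determine the edge, so a coded point has no other step than that of the
automaton. -/
theorem IsCoded.edgeStep_iff {c : A.Cfg w} {d : Option (A.Q × Fin k)} {n : ℤ} {x : Cube}
    (h : ∃ e : A.Edge, A.edgeDom e = d ∧ n = A.edgeIndex e ∧ A.edgeHead e = c.2.1 ∧
      A.edgeAction e = A.action w c) (d' : Option (A.Q × Fin k)) (p' : Pt) :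
    (A.toProgram hk).EdgeStep (d, (n, fun b => x (Equiv.swap 0 (c.2.1 : ℕ) b))) (d', p') ↔
      A.action w c ≠ .reject ∧ d' = A.actionCod (A.action w c) ∧
        p' = (A.actionIndex (A.action w c),
          fun b => x (Equiv.swap 0 (A.actionHead (A.action w c) : ℕ) b)) := by
  obtain ⟨e, rfl, rfl, h3, h4⟩ := h
  have hreal : A.edgeReal e (A.edgeIndex e, fun b => x (Equiv.swap 0 (c.2.1 : ℕ) b)) =
      (A.actionIndex (A.action w c),
        fun b => x (Equiv.swap 0 (A.actionHead (A.action w c) : ℕ) b)) := by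
    rw [A.edgeReal_apply rfl, h3, h4]
    simp
  constructor
  · rintro ⟨e', h5, h6, h7, h8⟩
    obtain rfl := A.eq_of_edgeDom (e := e) (e' := e') h5.symm h7.1
    refine ⟨h4 ▸ h7.2, ?_, h8.symm.trans hreal⟩
    rw [← h4]; exact h6.symm
  · rintro ⟨h5, rfl, rfl⟩
    exact ⟨e, rfl, congrArg A.actionCod h4, ⟨rfl, h4 ▸ h5⟩, hreal⟩

theorem IsCoded.next {q : A.Q} {a : Fin k} {r : Bool} {x : Cube}
    {pos : Fin k → Fin (w.length + 1)}
    (hx : ∀ a : Fin k, S.address (x a) = pos a ∧ S.Regular (x a)) :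
    IsCoded (A := A) S (q, a, Function.update pos a (neighbour r (pos a)))
      (some (q, a), (ListVertex.index (symbolAt w (neighbour r (pos a)), r),
        Function.update (fun b => x (Equiv.swap 0 (a : ℕ) b)) 0
          (S.move (neighbour r (pos a)) (x a)))) := by
  refine ⟨some (q, a, (symbolAt w (neighbour r (pos a)), r)), rfl, rfl, rfl, ?_,
    Function.update x a (S.move (neighbour r (pos a)) (x a)), swap_update _ _ _, fun b => ?_⟩
  · simp [edgeAction, action]
  · rcases eq_or_ne b a with rfl | hb
    · simp only [Function.update_self]
      exact ⟨(hx b).2.address_move _, (hx b).2.move _⟩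
    · have hb' : (b : ℕ) ≠ a := fun h => hb (Fin.ext h)
      simp only [Function.update_of_ne hb, Function.update_of_ne hb']
      exact hx b

/-- The word itself checks the announced symbol: it has an edge at the new point only if the address
of the moved head carries this symbol. -/
theorem acceptsAt_toProgram {x : Cube} (hx : ∀ a, S.Regular (x a))
    (hx' : x ∈ (A.toProgram hk).entry w S) :
    (A.toProgram hk).AcceptsAt w S x ↔ A.Accepts w := by
  rw [Program.acceptsAt_iff]
  refine accFrom_iff_of_bisimulation (Rel := fun (c : A.Cfg w) s => IsCoded S c s) ?_ ?_ ?_ ?_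
  · rintro ⟨q, a, pos⟩ ⟨d, n, y⟩ ⟨e, h1, h2, h3, h4, x, rfl, -⟩
    have key := IsCoded.edgeStep_iff (A := A) hk (x := x) ⟨e, h1, h2, h3, h4⟩
    refine (exists_congr fun p => and_congr_left' (key none p)).trans ?_
    simp only [CircularAutomaton.next, Acc]
    cases A.action w (q, a, pos) <;> simp [actionCod, actionIndex]
  · rintro ⟨q, a, pos⟩ ⟨d, n, y⟩ c' ⟨e, h1, h2, h3, h4, x, rfl, h5⟩ hn
    have key := IsCoded.edgeStep_iff (A := A) hk (x := x) ⟨e, h1, h2, h3, h4⟩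
    simp only [CircularAutomaton.next] at hn
    cases hc : A.action w (q, a, pos) with
    | accept => simp [hc] at hn
    | reject => simp [hc] at hn
    | go q' a' s r =>
      simp only [hc, Option.ite_none_right_eq_some, Option.some.injEq] at hn
      obtain ⟨hs, rfl⟩ := hn
      refine ⟨(some (q', a'), _), ⟨_, (key (some (q', a')) _).2 ⟨?_, ?_, rfl⟩, r, ?_, rfl⟩, ?_⟩
      · simp [hc]
      · simp [hc, actionCod]
      · simp [hc, actionIndex, actionHead, (h5 a').1, hs]
      · have := IsCoded.next (A := A) (q := q') (a := a') (r := r) h5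
        simpa [hc, actionHead, (h5 a').1] using this
  · rintro ⟨q, a, pos⟩ ⟨d, n, y⟩ ⟨d', p'⟩ ⟨e, h1, h2, h3, h4, x, rfl, h5⟩ ⟨p, hp, r', hr, hp'⟩
    obtain ⟨h6, h7, rfl⟩ := (IsCoded.edgeStep_iff (A := A) hk (x := x) ⟨e, h1, h2, h3, h4⟩ ..).1 hp
    simp only at h7 hp' hr
    subst h7 hp'
    cases hc : A.action w (q, a, pos) with
    | accept =>
      simp only [hc, actionIndex] at hr
      exact absurd hr.symm (ListVertex.index_ne_acceptIndex _)
    | reject => exact absurd hc h6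
    | go q' a' s r =>
      simp only [hc, actionIndex, actionHead, Equiv.swap_apply_left, (h5 a').1] at hr
      have hr := ListVertex.index_injective hr
      rw [Prod.mk.injEq, Bool.not_inj_iff] at hr
      obtain ⟨rfl, rfl⟩ := hr
      refine ⟨_, by rw [CircularAutomaton.next, hc]; exact if_pos rfl, ?_⟩
      have := IsCoded.next (A := A) (q := q') (a := a') (r := r) h5
      simpa [hc, actionHead, actionCod, (h5 a').1] using this
  · refine ⟨none, rfl, rfl, rfl, rfl, x, ?_, fun a => ⟨hx' a a.2, hx a⟩⟩
    simp

theorem exists_program (A : CircularAutomaton k) (hk : (k : ℕ∞) ≤ i) :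
    ∃ P : Program (headMicrocosm i), P.HasType ∧ P.language = {w | A.Accepts w} := by
  have key : ∀ w (S : Splitting (w.length + 1)), ∀ᵐ x ∂cubeMeasure,
      x ∈ (A.toProgram hk).entry w S → ((A.toProgram hk).AcceptsAt w S x ↔ A.Accepts w) :=
    fun w S => (ae_cube S.ae_regular).mono fun x hx => acceptsAt_toProgram hk hx
  have htrue : ∀ w, A.Accepts w → ∀ S, (A.toProgram hk).IsTrue w S := fun w hw S =>
    (key w S).mono fun x hx hx' => (hx hx').2 hw
  refine ⟨A.toProgram hk, fun w => ?_, Set.ext fun w => ⟨fun h => ?_, htrue w⟩⟩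
  · by_cases hw : A.Accepts w
    · exact Or.inl (htrue w hw)
    · exact Or.inr fun S => (key w S).mono fun x hx hx' => fun h => hw ((hx hx').1 h)
  -- A word of the language that is not accepted would make `entry` null.
  · by_contra hw
    have hS := h (Splitting.intervals _)
    have h0 : ∀ᵐ x ∂cubeMeasure, x ∉ (A.toProgram hk).entry w (Splitting.intervals _) := by
      filter_upwards [key w _, hS] with x h1 h2 h3
      exact hw ((h1 h3).1 (h2 h3))
    exact ((A.toProgram hk).cubeMeasure_entry_pos w (Splitting.intervals _)).ne'
      (measure_eq_zero_iff_ae_notMem.2 h0)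

end CircularAutomaton

/-! ### Rotations of the heads -/

-- The product uniformity is coarser than that of uniform convergence.
open scoped Uniformity Topology in
theorem exists_dist_lt_of_mem_uniformity {V : Set (Cube × Cube)} (hV : V ∈ 𝓤 Cube) :
    ∃ ε : ℝ, 0 < ε ∧ ∀ x y : Cube, (∀ a, dist (x a) (y a) < ε) → (x, y) ∈ V := by
  have h := (UniformFun.uniformContinuous_toFun (α := ℕ) (β := unitInterval)) hV
  obtain ⟨ε, hε, h⟩ := (UniformFun.hasBasis_uniformity_of_basis ℕ unitInterval
    Metric.uniformity_basis_dist).mem_iff.1 (Filter.mem_map.1 h)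
  exact ⟨ε, hε, fun x y hxy => h (a := (UniformFun.ofFun x, UniformFun.ofFun y)) hxy⟩

namespace Splitting

variable {N : ℕ} (S : Splitting N)

/-- Move the number by a given number of addresses. -/
def rotate (b : Fin N) (u : unitInterval) : unitInterval := S.move (S.address u + b) u

/-- Rotate the first coordinates. -/
def rotateCube {m : ℕ} (b : Fin m → Fin N) (x : Cube) : Cube := fun a =>
  if h : a < m then S.rotate (b ⟨a, h⟩) (x a) else x a

/-- Put the first coordinates in given addresses. -/
def place {m : ℕ} (j : Fin m → Fin N) (x : Cube) : Cube := fun a =>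
  if h : a < m then S.move (j ⟨a, h⟩) (x a) else x a

variable {S}

theorem regular_place {m : ℕ} {x : Cube} (hx : ∀ a, S.Regular (x a)) (j : Fin m → Fin N) (a : ℕ) :
    S.Regular (S.place j x a) := by
  unfold place
  split
  · exact (hx a).move _
  · exact hx a

theorem place_place {m : ℕ} {x : Cube} (hx : ∀ a, S.Regular (x a)) (i j : Fin m → Fin N) :
    S.place i (S.place j x) = S.place i x := by
  funext a
  by_cases h : a < m
  · simp [place, h, (hx a).move_move]
  · simp [place, h]

theorem place_update {k : ℕ} {x : Cube} (hr : ∀ a, S.Regular (x a))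
    (j : Fin k → Fin N) (a : Fin k)
    (b : Fin N) : S.place (Function.update j a b) x =
      Function.update (S.place j x) a (S.move b (S.place j x a)) := by
  funext c
  by_cases hc : c < k
  · rcases eq_or_ne c a with rfl | h
    · simp [place, (hr _).move_move]
    · have h' : (⟨c, hc⟩ : Fin k) ≠ a := fun e => h (congrArg Fin.val e)
      simp [place, hc, h, h']
  · have h : c ≠ a := fun e => hc (e ▸ a.2)
    simp [place, hc, h]

theorem address_place {k : ℕ} {x : Cube} (hr : ∀ a, S.Regular (x a))
    (j : Fin k → Fin N) (a : Fin k) :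
    S.address (S.place j x a) = j a := by
  simp [place, (hr _).address_move]

theorem rotateCube_eq {m : ℕ} (x : Cube) (b : Fin m → Fin N) :
    S.rotateCube b x = S.place (fun a => S.address (x a) + b a) x := rfl

variable [NeZero N]

/-- `place` itself does not preserve the measure, but each placement of a given point is one of
finitely many rotations, and those do. -/
theorem place_eq_rotateCube {m : ℕ} (x : Cube) (j : Fin m → Fin N) :
    S.place j x = S.rotateCube (fun a => j a - S.address (x a)) x := by
  rw [rotateCube_eq]
  congr 1
  funext a
  rw [add_sub_cancel]

variable (S)

theorem measurePreserving_rotate (b : Fin N) : MeasurePreserving (S.rotate b) := by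
  have h1 : MeasurePreserving (fun j : Fin N => j + b) Measure.count Measure.count :=
    measurePreserving_add_right _ b
  have h2 := (h1.prod (MeasurePreserving.id (volume : Measure unitInterval))).smul_measure
    (N : ENNReal)⁻¹
  exact S.measurePreserving_point.comp (h2.comp S.measurePreserving_locate)

theorem measurePreserving_rotateCube {m : ℕ} (b : Fin m → Fin N) :
    MeasurePreserving (S.rotateCube b) cubeMeasure cubeMeasure := by
  have h : ∀ a : ℕ, MeasurePreserving
      (fun u : unitInterval => if h : a < m then S.rotate (b ⟨a, h⟩) u else u) := by
    intro a
    by_cases h : a < m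
    · simpa [h] using S.measurePreserving_rotate _
    · simp only [h, dite_false]
      exact MeasurePreserving.id (volume : Measure unitInterval)
  refine ⟨measurable_pi_lambda _ fun a => (h a).measurable.comp (measurable_pi_apply a), ?_⟩
  have h' := Measure.infinitePi_map_pi (μ := fun _ : ℕ => (volume : Measure unitInterval))
    fun a => (h a).measurable
  simp_rw [(h _).map_eq] at h'
  exact h'

end Splitting

/-- In a set of positive measure, one can find points all of whose first coordinates can be moved
freely between the addresses of some splitting. -/
theorem exists_frequently_place_mem {K : Set Cube} (hK : MeasurableSet K) (hK0 : cubeMeasure K ≠ 0)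
    (m N : ℕ) [NeZero N] : ∃ S : Splitting N, ∃ᵐ x ∂cubeMeasure, (∀ a, S.Regular (x a)) ∧
      (∀ a < m, S.address (x a) = 0) ∧ ∀ j : Fin m → Fin N, S.place j x ∈ K := by
  obtain ⟨C, hCK, hC, hC0⟩ := hK.exists_lt_isClosed_of_ne_top (measure_ne_top _ _)
    (pos_iff_ne_zero.2 hK0)
  -- So many sets of measure at most `δ` as there are rotations cannot cover `C`.
  obtain ⟨δ, hδ, hδC⟩ := ENNReal.exists_nnreal_pos_mul_lt
    (ENNReal.natCast_ne_top (Fintype.card (Fin m → Fin N))) hC0.ne'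
  obtain ⟨U, hCU, hU, -, hUC⟩ := hC.measurableSet.exists_isOpen_sdiff_lt (μ := cubeMeasure)
    (measure_ne_top _ _) (ENNReal.coe_ne_zero.2 hδ.ne')
  -- By compactness, displacing the coordinates by less than `ε` does not lead from `C` out of `U`;
  -- changes of address in `S` are that small.
  obtain ⟨V, hV, -, hVU⟩ := lebesgue_number_of_compact_open hC.isCompact hU hCU
  obtain ⟨ε, hε, hεV⟩ := exists_dist_lt_of_mem_uniformity hV
  obtain ⟨S, hS⟩ := Splitting.exists_move_near N hε
  refine ⟨S, fun hnot => ?_⟩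
  have h1 : ∀ᵐ x ∂cubeMeasure, ∀ b : Fin m → Fin N, ¬ _ := ae_all_iff.2 fun b =>
    (S.measurePreserving_rotateCube b).quasiMeasurePreserving.ae hnot
  -- If the claim fails, almost every point of `C` has a placement outside of `K`. It is in `U` by
  -- the choice of `S`, so a rotation takes the point into `U \ C`, whose measure is less than `δ`.
  have h2 : C ≤ᵐ[cubeMeasure] ⋃ b : Fin m → Fin N, S.rotateCube b ⁻¹' (U \ C) := by
    filter_upwards [h1, ae_cube S.ae_regular] with x hx hr hxC
    -- The claim concerns points with addresses `0`; it is used at the rotation of `x` that has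
    -- them, whose placements are those of `x`.
    have hx0 := hx fun a => 0 - S.address (x a)
    rw [← Splitting.place_eq_rotateCube] at hx0
    have h0 : ∀ a < m, S.address (S.place (fun _ : Fin m => (0 : Fin N)) x a) = 0 := fun a ha => by
      simp [Splitting.place, ha, (hr a).address_move]
    have hj : ∃ j : Fin m → Fin N, S.place j x ∉ K := by
      by_contra! hj
      exact hx0 ⟨Splitting.regular_place hr _, h0, fun j => by
        rw [Splitting.place_place hr]; exact hj j⟩
    obtain ⟨j, hj⟩ := hj
    refine Set.mem_iUnion.2 ⟨fun a => j a - S.address (x a), ?_, ?_⟩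
    · rw [← Splitting.place_eq_rotateCube]
      refine hVU x hxC (hεV _ _ fun a => ?_)
      unfold Splitting.place
      split
      · rw [dist_comm]
        exact hS _ _ (hr a)
      · simpa using hε
    · rw [← Splitting.place_eq_rotateCube]
      exact fun h => hj (hCK h)
  refine absurd hδC (not_lt.2 ((measure_mono_ae h2).trans ((measure_iUnion_le _).trans ?_)))
  rw [tsum_fintype]
  refine (Finset.sum_le_card_nsmul Finset.univ _ (δ : ENNReal) fun b _ => ?_).trans ?_
  · rw [(S.measurePreserving_rotateCube b).measure_preimage
      (hU.measurableSet.diff hC.measurableSet).nullMeasurableSet]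
    exact hUC.le
  · rw [nsmul_eq_mul, mul_comm, Finset.card_univ]

/-! ### Permutations of the heads -/

/-- The permutations of the coordinates that fix all coordinates but the first `k`. -/
abbrev HeadPerm (k : ℕ) : Type := {σ : Equiv.Perm ℕ // ∀ a, ¬ a < k → σ a = a}

instance (k : ℕ) : Finite (HeadPerm k) := by
  have : Finite {a : ℕ // a < k} := (Set.finite_lt_nat k).to_subtype
  exact Finite.of_equiv _ (Equiv.Perm.subtypeEquivSubtypePerm fun a => a < k)

theorem HeadPerm.lt {k : ℕ} (σ : HeadPerm k) {a : ℕ} (ha : a < k) : σ.1 a < k := by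
  by_contra h
  exact h (by rwa [σ.1.injective (σ.2 _ h)])

/-- The map that translates the segment and permutes the coordinates. -/
def permMap (z : ℤ) (σ : Equiv.Perm ℕ) : Function.End Pt := fun p => (p.1 + z, fun a => p.2 (σ a))

/-- The maps that translate the segment and permute the first `k` coordinates. -/
def permMaps (k : ℕ) : Submonoid (Function.End Pt) where
  carrier := {f | ∃ (z : ℤ) (σ : HeadPerm k), f = permMap z σ.1}
  one_mem' := ⟨0, ⟨1, fun _ _ => rfl⟩, funext fun p => Prod.ext (add_zero p.1).symm rfl⟩
  mul_mem' := by
    rintro _ _ ⟨z, σ, rfl⟩ ⟨z', σ', rfl⟩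
    refine ⟨z' + z, ⟨σ'.1 * σ.1, fun a ha => ?_⟩, funext fun p => Prod.ext (add_assoc _ _ _) rfl⟩
    rw [Equiv.Perm.mul_apply, σ.2 a ha, σ'.2 a ha]

theorem permMaps_mono : Monotone permMaps := by
  rintro k l h _ ⟨z, σ, rfl⟩
  exact ⟨z, ⟨σ.1, fun a ha => σ.2 a fun h' => ha (h'.trans_le h)⟩, rfl⟩

/-- The exchanges that occur fix all coordinates from `k` on. Only this inclusion is needed, because
an automaton may follow arbitrary permutations of its heads. -/
theorem headMaps_le_permMaps {k : ℕ} (hk : 1 ≤ k) : headMaps k ≤ permMaps k := by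
  have h0 : headMaps 0 ≤ permMaps 0 := by
    rintro _ ⟨z, rfl⟩
    exact ⟨z, ⟨1, fun _ _ => rfl⟩, rfl⟩
  induction k with
  | zero => exact h0
  | succ k ih =>
    refine sup_le ?_ ?_
    · rcases Nat.eq_zero_or_pos k with rfl | h
      · exact h0.trans (permMaps_mono (Nat.zero_le _))
      · exact (ih h).trans (permMaps_mono (Nat.le_succ k))
    · rw [Submonoid.closure_le]
      rintro _ rfl
      refine ⟨0, ⟨Equiv.swap 0 k, fun a ha => ?_⟩,
        funext fun p => Prod.ext (add_zero p.1).symm rfl⟩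
      exact Equiv.swap_apply_of_ne_of_ne (by omega) (by omega)

theorem measurePreserving_perm (σ : Equiv.Perm ℕ) :
    MeasurePreserving (fun (x : Cube) a => x (σ a)) cubeMeasure cubeMeasure := by
  refine ⟨measurable_pi_lambda _ fun a => measurable_pi_apply _, ?_⟩
  have h := Measure.infinitePi_map_piCongrLeft
    (fun _ : ℕ => (volume : Measure unitInterval)) σ.symm
  have hf : (fun (x : Cube) a => x (σ a)) =
      MeasurableEquiv.piCongrLeft (fun _ : ℕ => unitInterval) σ.symm := by
    funext x a
    have h1 := Equiv.piCongrLeft_apply_apply (fun _ : ℕ => unitInterval) σ.symm x (σ a)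
    rw [Equiv.symm_apply_apply] at h1
    exact h1.symm
  rw [hf]
  exact h

/-- Finitely many maps with arbitrarily many heads have a bounded number of heads. -/
theorem exists_heads {i : ℕ∞} (hi : 1 ≤ i) {R : Set (Function.End Pt)} (hR : R.Finite)
    (h : R ⊆ headMapsTop i) : ∃ k : ℕ, 1 ≤ k ∧ (k : ℕ∞) ≤ i ∧ R ⊆ permMaps k := by
  induction i using ENat.recTopCoe with
  | coe n =>
    have hn : 1 ≤ n := by exact_mod_cast hi
    exact ⟨n, hn, le_rfl, h.trans (headMaps_le_permMaps hn)⟩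
  | top =>
    have h' : ∀ f ∈ R, ∃ k, f ∈ headMaps k := fun f hf =>
      (Submonoid.mem_iSup_of_directed headMaps_mono.directed_le).1 (h hf)
    choose! l hl using h'
    obtain ⟨b, hb⟩ := (hR.image l).bddAbove
    refine ⟨b + 1, by omega, le_top, fun f hf => headMaps_le_permMaps (by omega)
      (headMaps_mono ?_ (hl f hf))⟩
    exact (hb ⟨f, hf, rfl⟩).trans (Nat.le_succ b)

/-! ### The behaviour of a program at a point -/

/-- The segments from which a program makes a step: "accept" and the segments of words. -/
def vertexIndex : Option ListVertex → ℤ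
  | none => acceptIndex
  | some v => v.index

namespace Program

variable {i : ℕ∞} (P : Program (headMicrocosm i)) (k : ℕ)

/-- The steps that a program may make: from a state, a segment and an order of the coordinates
to a state, by a realisation. -/
abbrev Behaviour : Type :=
  (P.D × Option ListVertex × HeadPerm k) × (P.D × Set.range P.graphing.real)

instance : Finite (Set.range P.graphing.real) := P.finite_real

/-- The points at which a program makes a step. -/
def stepSet (b : P.Behaviour k) : Set Cube :=
  {x | ∃ e, P.graphing.dom e = b.1.1 ∧ P.graphing.cod e = b.2.1 ∧ P.graphing.real e = b.2.2 ∧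
    (vertexIndex b.1.2.1, fun a => x (b.1.2.2.1 a)) ∈ P.graphing.src e}

theorem measurableSet_stepSet (b : P.Behaviour k) : MeasurableSet (P.stepSet k b) := by
  have := P.graphing.countable_E
  have h : P.stepSet k b = ⋃ e, {x | (P.graphing.dom e = b.1.1 ∧ P.graphing.cod e = b.2.1 ∧
      P.graphing.real e = b.2.2)} ∩ (fun x : Cube => (vertexIndex b.1.2.1,
        fun a => x (b.1.2.2.1 a))) ⁻¹' P.graphing.src e := by
    ext x
    simp [stepSet, and_assoc]
  rw [h]
  refine MeasurableSet.iUnion fun e => (MeasurableSet.const _).inter ?_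
  exact (measurable_const.prodMk (measurable_pi_lambda _ fun a => measurable_pi_apply _))
    (P.graphing.measurableSet_src e)

/-- All steps that a program may make at a point. -/
def behaviours (x : Cube) : Set (P.Behaviour k) := {b | x ∈ P.stepSet k b}

theorem measurableSet_behaviours (t : Set (P.Behaviour k)) :
    MeasurableSet {x | P.behaviours k x = t} := by
  have h : {x | P.behaviours k x = t} = ⋂ b, {x | x ∈ P.stepSet k b ↔ b ∈ t} := by
    ext x
    simp [behaviours, Set.ext_iff]
  rw [h]
  refine MeasurableSet.iInter fun b => ?_
  by_cases hb : b ∈ t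
  · simpa [hb] using P.measurableSet_stepSet k b
  · simp only [hb, iff_false]
    exact (P.measurableSet_stepSet k b).compl

/-- A set of steps with at most one step from each state, segment and order. -/
def IsFunctional (t : Set (P.Behaviour k)) : Prop :=
  ∀ c r r', (c, r) ∈ t → (c, r') ∈ t → r = r'

/-- Determinism holds off a null set; it is pulled back along the finitely many permutations of the
heads, which preserve the measure. -/
theorem ae_isFunctional : ∀ᵐ x ∂cubeMeasure, P.IsFunctional k (P.behaviours k x) := by
  have h1 : ∀ d (n : ℤ), ∀ᵐ y ∂cubeMeasure, ∀ e e', P.graphing.dom e = d →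
      P.graphing.dom e' = d → (n, y) ∈ P.graphing.src e → (n, y) ∈ P.graphing.src e' → e = e' := by
    intro d n
    have h : ∀ᵐ p ∂ptMeasure, ∀ e e', P.graphing.dom e = d → P.graphing.dom e' = d →
        p ∈ P.graphing.src e → p ∈ P.graphing.src e' → e = e' := by
      rw [ae_iff]
      refine measure_mono_null (fun p hp => ?_) (P.isDeterministic d)
      simp only [not_forall, Set.mem_ofPred_eq] at hp
      obtain ⟨e, e', h1, h2, h3, h4, h5⟩ := hp
      exact ⟨e, e', h5, h1, h2, h3, h4⟩
    have h := Measure.ae_ae_of_ae_prod h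
    rw [Measure.ae_count_iff] at h
    exact h n
  have h2 : ∀ c : P.D × Option ListVertex × HeadPerm k, ∀ᵐ x ∂cubeMeasure, ∀ e e',
      P.graphing.dom e = c.1 → P.graphing.dom e' = c.1 →
      (vertexIndex c.2.1, fun a => x (c.2.2.1 a)) ∈ P.graphing.src e →
      (vertexIndex c.2.1, fun a => x (c.2.2.1 a)) ∈ P.graphing.src e' → e = e' := fun c =>
    (measurePreserving_perm c.2.2.1).quasiMeasurePreserving.ae (h1 c.1 (vertexIndex c.2.1))
  filter_upwards [ae_all_iff.2 h2] with x hx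
  rintro c ⟨d, f⟩ ⟨d', f'⟩ ⟨e, h3, h4, h5, h6⟩ ⟨e', h3', h4', h5', h6'⟩
  obtain rfl := hx c e e' h3 h3' h6 h6'
  exact Prod.ext (h4.symm.trans h4') (Subtype.ext (h5.symm.trans h5'))

/-- Finitely many sets cover the cube up to a null set, so one of them is not null. No word is
involved in this choice. -/
theorem exists_behaviours : ∃ t, P.IsFunctional k t ∧
    cubeMeasure {x | P.behaviours k x = t} ≠ 0 := by
  by_contra! h
  have h1 : ∀ᵐ x ∂cubeMeasure, ∀ t, P.IsFunctional k t → P.behaviours k x ≠ t := by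
    rw [ae_all_iff]
    intro t
    by_cases ht : P.IsFunctional k t
    · filter_upwards [measure_eq_zero_iff_ae_notMem.1 (h t ht)] with x hx _
      exact hx
    · exact Filter.Eventually.of_forall fun x h => absurd h ht
  obtain ⟨x, hx, hx'⟩ := (h1.and (P.ae_isFunctional k)).exists
  exact hx _ hx' rfl

variable {k} (hreal : Set.range P.graphing.real ⊆ (permMaps k : Set (Function.End Pt)))

/-- The translation of a realisation. -/
noncomputable def shift (f : Set.range P.graphing.real) : ℤ := (hreal f.2).choose

/-- The permutation of a realisation. -/
noncomputable def perm (f : Set.range P.graphing.real) : HeadPerm k :=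
  (hreal f.2).choose_spec.choose

theorem real_eq (f : Set.range P.graphing.real) :
    (f : Pt → Pt) = permMap (P.shift hreal f) (P.perm hreal f).1 :=
  (hreal f.2).choose_spec.choose_spec

/-- The composition of permutations of the heads. -/
def _root_.HeadPerm.comp {k : ℕ} (σ τ : HeadPerm k) : HeadPerm k :=
  ⟨σ.1 * τ.1, fun a ha => by rw [Equiv.Perm.mul_apply, τ.2 a ha, σ.2 a ha]⟩

-- On points all of whose placements have the behaviour `t`, the positions inside of the addresses
-- no longer matter: the steps are read off from `t`.
variable {P hreal} in
theorem edgeStep_iff {t : Set (P.Behaviour k)} {w : List Bool} {S : Splitting (w.length + 1)}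
    {x : Cube} (hx : ∀ j : Fin k → _, P.behaviours k (S.place j x) = t) (d d' : P.D)
    (v : Option ListVertex) (σ : HeadPerm k) (j : Fin k → Fin (w.length + 1)) (p' : Pt) :
    P.EdgeStep (d, (vertexIndex v, fun b => S.place j x (σ.1 b))) (d', p') ↔
      ∃ f, ((d, v, σ), (d', f)) ∈ t ∧ p' = (vertexIndex v + P.shift hreal f,
        fun b => S.place j x ((σ.comp (P.perm hreal f)).1 b)) := by
  constructor
  · rintro ⟨e, h1, h2, h3, h4⟩
    refine ⟨⟨P.graphing.real e, e, rfl⟩, ?_, ?_⟩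
    · rw [← hx j]
      exact ⟨e, h1, h2, rfl, h3⟩
    · exact h4.symm.trans (congrFun (P.real_eq hreal ⟨P.graphing.real e, e, rfl⟩) _)
  · rintro ⟨f, h, rfl⟩
    rw [← hx j] at h
    obtain ⟨e, h1, h2, h3, h4⟩ := h
    refine ⟨e, h1, h2, h4, ?_⟩
    rw [h3]
    exact congrFun (P.real_eq hreal f) _

/-- The head that a permutation brings to the first coordinate. -/
def _root_.HeadPerm.head {k : ℕ} [NeZero k] (σ : HeadPerm k) : Fin k :=
  ⟨σ.1 0, σ.lt (Nat.pos_of_ne_zero (NeZero.ne k))⟩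

/-! ### The automaton of a fixed behaviour -/

section Automaton

variable [NeZero k]

/-- The vertex at which the automaton is. -/
def vertexAt (b : Option Bool) (s : Option Bool) : Option ListVertex := b.map fun r => (s, r)

open Classical in
/-- The action of the automaton that simulates a step of a program. -/
noncomputable def stepAction (c : P.D × Option ListVertex × HeadPerm k)
    (r : P.D × Set.range P.graphing.real) :
    CircularAction (P.D × Option Bool × HeadPerm k) k :=
  if vertexIndex c.2.1 + P.shift hreal r.2 = acceptIndex then
    if r.1 = P.init then .accept else .reject
  else if h : ∃ v : ListVertex, vertexIndex c.2.1 + P.shift hreal r.2 = v.index then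
    .go (r.1, some (!h.choose.2), c.2.2.comp (P.perm hreal r.2))
      (c.2.2.comp (P.perm hreal r.2)).head h.choose.1 (!h.choose.2)
  else .reject

open Classical in
/-- The automaton that simulates a program with a given behaviour. -/
noncomputable def toCircular (t : Set (P.Behaviour k)) : CircularAutomaton k where
  Q := P.D × Option Bool × HeadPerm k
  finite_Q := inferInstance
  start := (P.init, none, ⟨1, fun _ _ => rfl⟩)
  δ := fun q s =>
    if h : ∃ r, ((q.1, vertexAt q.2.1 s, q.2.2), r) ∈ t then
      P.stepAction hreal (q.1, vertexAt q.2.1 s, q.2.2) h.choose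
    else .reject

variable {P hreal} {t : Set (P.Behaviour k)}

theorem stepAction_go {c : P.D × Option ListVertex × HeadPerm k}
    {r : P.D × Set.range P.graphing.real} {s : Option Bool} {b : Bool}
    (h : vertexIndex c.2.1 + P.shift hreal r.2 = ListVertex.index (s, !b)) :
    P.stepAction hreal c r = .go (r.1, some b, c.2.2.comp (P.perm hreal r.2))
      (c.2.2.comp (P.perm hreal r.2)).head s b := by
  have h' : ∃ v : ListVertex, vertexIndex c.2.1 + P.shift hreal r.2 = v.index := ⟨_, h⟩
  have hv : h'.choose = (s, !b) := ListVertex.index_injective (h'.choose_spec.symm.trans h)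
  rw [stepAction, if_neg (by rw [h]; exact ListVertex.index_ne_acceptIndex _), dif_pos h', hv]
  simp

theorem stepAction_eq_go {c : P.D × Option ListVertex × HeadPerm k}
    {r : P.D × Set.range P.graphing.real} {q : P.D × Option Bool × HeadPerm k} {a : Fin k}
    {s : Option Bool} {b : Bool} (h : P.stepAction hreal c r = .go q a s b) :
    vertexIndex c.2.1 + P.shift hreal r.2 = ListVertex.index (s, !b) ∧
      q = (r.1, some b, c.2.2.comp (P.perm hreal r.2)) ∧
      a = (c.2.2.comp (P.perm hreal r.2)).head := by
  by_cases h' : ∃ v : ListVertex, vertexIndex c.2.1 + P.shift hreal r.2 = v.index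
  · obtain ⟨⟨s', b'⟩, hv⟩ := h'
    have := stepAction_go (P := P) (hreal := hreal) (c := c) (r := r) (s := s') (b := !b')
      (by rw [hv, Bool.not_not])
    rw [this] at h
    cases h
    exact ⟨by rw [hv, Bool.not_not], rfl, rfl⟩
  · rw [stepAction, dif_neg h'] at h
    split_ifs at h

theorem stepAction_eq_accept {c : P.D × Option ListVertex × HeadPerm k}
    {r : P.D × Set.range P.graphing.real} : P.stepAction hreal c r = .accept ↔
      vertexIndex c.2.1 + P.shift hreal r.2 = acceptIndex ∧ r.1 = P.init := by
  rw [stepAction]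
  split_ifs <;> simp [*]

/-- Functionality of `t` makes the choice in the definition immaterial. -/
theorem toCircular_δ (ht : P.IsFunctional k t) {q : P.D × Option Bool × HeadPerm k}
    {s : Option Bool} {r : P.D × Set.range P.graphing.real}
    (h : ((q.1, vertexAt q.2.1 s, q.2.2), r) ∈ t) :
    (P.toCircular hreal t).δ q s = P.stepAction hreal (q.1, vertexAt q.2.1 s, q.2.2) r := by
  have h' : ∃ r, ((q.1, vertexAt q.2.1 s, q.2.2), r) ∈ t := ⟨r, h⟩
  have e := ht _ _ _ h'.choose_spec h
  simp only [toCircular]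
  rw [dif_pos h', e]

theorem exists_of_toCircular_δ {q : P.D × Option Bool × HeadPerm k} {s : Option Bool}
    (h : (P.toCircular hreal t).δ q s ≠ .reject) :
    ∃ r, ((q.1, vertexAt q.2.1 s, q.2.2), r) ∈ t := by
  by_contra h'
  simp only [toCircular] at h
  exact h (dif_neg h')

variable {w : List Bool} {S : Splitting (w.length + 1)} {x : Cube}

/-- A configuration of the automaton represents a state and a point. -/
def Codes (S : Splitting (w.length + 1)) (x : Cube) (c : (P.toCircular hreal t).Cfg w)
    (s : P.D × Pt) : Prop :=
  c.2.1 = c.1.2.2.head ∧ s = (c.1.1, (vertexIndex (vertexAt c.1.2.1 (symbolAt w (c.2.2 c.2.1))),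
    fun b => S.place c.2.2 x (c.1.2.2.1 b)))

theorem codes_next (hr : ∀ a, S.Regular (x a)) (d : P.D) (b : Bool) (σ : HeadPerm k)
    (j : Fin k → Fin (w.length + 1)) (j' : Fin (w.length + 1)) :
    Codes (t := t) (hreal := hreal) S x ((d, some b, σ), σ.head, Function.update j σ.head j')
      (d, (ListVertex.index (symbolAt w j', b),
        Function.update (fun b => S.place j x (σ.1 b)) 0 (S.move j' (S.place j x (σ.1 0))))) := by
  refine ⟨rfl, ?_⟩
  simp only [Function.update_self, Splitting.place_update hr, update_comp_perm]
  rfl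

/-- The control keeps the state, the kind of vertex and the order of the coordinates; the symbol,
which completes the vertex, is read at the head in front. Word steps change only addresses, so the
cube coordinates after each step are a permuted placement of `x`, where the behaviour is `t`. -/
theorem acceptsAt_iff_toCircular (ht : P.IsFunctional k t) (hr : ∀ a, S.Regular (x a))
    (hx : ∀ j : Fin k → _, P.behaviours k (S.place j x) = t)
    (h0 : ∀ a < k, S.address (x a) = 0) :
    P.AcceptsAt w S x ↔ (P.toCircular hreal t).Accepts w := by
  rw [acceptsAt_iff]
  refine accFrom_iff_of_bisimulation
    (Rel := fun (c : (P.toCircular hreal t).Cfg w) s => Codes S x c s) ?_ ?_ ?_ ?_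
  · rintro ⟨⟨d, v, σ⟩, a, j⟩ s ⟨ha, rfl⟩
    refine (exists_congr fun p => and_congr_left' (edgeStep_iff (hreal := hreal) hx ..)).trans ?_
    simp only [CircularAutomaton.next, CircularAutomaton.Acc]
    constructor
    · rintro ⟨_, ⟨f, h1, rfl⟩, h2⟩
      have h : (P.toCircular hreal t).action w ((d, v, σ), a, j) = .accept :=
        (toCircular_δ ht h1).trans (stepAction_eq_accept.2 ⟨h2, rfl⟩)
      simp [h]
    · rintro ⟨-, h⟩
      obtain ⟨⟨d', f⟩, h1⟩ := exists_of_toCircular_δ (P := P) (hreal := hreal) (t := t)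
        (q := (d, v, σ)) (s := symbolAt w (j a)) (by
          intro h'; exact absurd (h.symm.trans h') (by simp))
      obtain ⟨h2, h3⟩ := stepAction_eq_accept.1 ((toCircular_δ ht h1).symm.trans h)
      simp only at h3
      subst h3
      exact ⟨_, ⟨f, h1, rfl⟩, h2⟩
  · rintro ⟨⟨d, v, σ⟩, a, j⟩ s c' ⟨ha, rfl⟩ hn
    simp only [CircularAutomaton.next] at hn
    cases h : (P.toCircular hreal t).action w ((d, v, σ), a, j) with
    | accept => simp [h] at hn
    | reject => simp [h] at hn
    | go q a' s b =>
      simp only [h, Option.ite_none_right_eq_some, Option.some.injEq] at hn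
      obtain ⟨rfl, rfl⟩ := hn
      obtain ⟨⟨d', f⟩, h1⟩ := exists_of_toCircular_δ (P := P) (hreal := hreal) (t := t)
        (q := (d, v, σ)) (s := symbolAt w (j a)) (by
          intro h'; exact absurd (h.symm.trans h') (by simp))
      obtain ⟨h2, rfl, rfl⟩ := stepAction_eq_go ((toCircular_δ ht h1).symm.trans h)
      have haddr := Splitting.address_place hr j (σ.comp (P.perm hreal f)).head
      refine ⟨(d', _), ⟨_, (edgeStep_iff (hreal := hreal) hx ..).2 ⟨f, h1, rfl⟩, b, ?_, rfl⟩, ?_⟩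
      · rw [h2]
        exact congrArg (fun i => ListVertex.index (symbolAt w i, !b)) haddr.symm
      · have := codes_next (P := P) (t := t) (hreal := hreal) hr d' b (σ.comp (P.perm hreal f)) j
          (CircularAutomaton.neighbour b (j (σ.comp (P.perm hreal f)).head))
        rw [← haddr] at this ⊢
        exact this
  · rintro ⟨⟨d, v, σ⟩, a, j⟩ s ⟨d', p''⟩ ⟨ha, rfl⟩ ⟨p, hp, b, h2, h3⟩
    obtain ⟨f, h1, rfl⟩ := (edgeStep_iff (hreal := hreal) hx ..).1 hp
    simp only at h2 h3 h1
    subst h3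
    have haddr := Splitting.address_place hr j (σ.comp (P.perm hreal f)).head
    have haddr' : S.address (S.place j x ((σ.comp (P.perm hreal f)).1 0)) =
      j (σ.comp (P.perm hreal f)).head := haddr
    rw [haddr'] at h2 ⊢
    have h : (P.toCircular hreal t).action w ((d, v, σ), a, j) = _ :=
      (toCircular_δ ht h1).trans (stepAction_go h2)
    refine ⟨_, by rw [CircularAutomaton.next, h]; exact if_pos rfl, ?_⟩
    exact codes_next (P := P) (t := t) (hreal := hreal) hr d' b (σ.comp (P.perm hreal f)) j
      (CircularAutomaton.neighbour b (j (σ.comp (P.perm hreal f)).head))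
  · refine ⟨rfl, Prod.ext rfl (Prod.ext rfl ?_)⟩
    funext b
    by_cases hb : b < k
    · have := (hr b).move_address
      rw [h0 b hb] at this
      simp [Splitting.place, hb, this, toCircular]
    · simp [Splitting.place, hb, toCircular]

end Automaton

variable {P}

/-- First `t` is fixed, then a splitting is chosen for each word, so one automaton serves for all
words. A comparison at a single splitting suffices, since the type makes all of them agree. -/
theorem exists_circularAutomaton (hi : 1 ≤ i) (hP : P.HasType) :
    ∃ (k : ℕ) (_ : NeZero k) (A : CircularAutomaton k), (k : ℕ∞) ≤ i ∧
      ∀ w, A.Accepts w ↔ w ∈ P.language := by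
  obtain ⟨k, hk1, hki, hreal⟩ := exists_heads hi P.finite_real
    (by rintro _ ⟨e, rfl⟩; exact (P.isIn e).1)
  have : NeZero k := ⟨by omega⟩
  obtain ⟨t, ht, ht0⟩ := P.exists_behaviours k
  refine ⟨k, this, P.toCircular hreal t, hki, fun w => ?_⟩
  -- The automaton starts with `k` heads at `⋆`, and `entry` asks the same of `P.heads` coordinates,
  -- which may be more or fewer; hence the maximum.
  obtain ⟨S, hS⟩ := exists_frequently_place_mem (P.measurableSet_behaviours k t) ht0
    (max k P.heads) (w.length + 1)
  have key : ∃ᵐ x ∂cubeMeasure, x ∈ P.entry w S ∧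
      (P.AcceptsAt w S x ↔ (P.toCircular hreal t).Accepts w) := by
    refine hS.mono fun x hx => ?_
    obtain ⟨hr, h0, hx⟩ := hx
    refine ⟨fun a ha => h0 a (ha.trans_le (le_max_right _ _)),
      acceptsAt_iff_toCircular ht hr (fun j => ?_) fun a ha => h0 a (ha.trans_le (le_max_left _ _))⟩
    -- The coordinates from `k` on are at the address `0` already, so placing them there changes
    -- nothing.
    have e : S.place j x =
        S.place (fun a : Fin (max k P.heads) => if h : (a : ℕ) < k then j ⟨a, h⟩ else 0) x := by
      funext a
      by_cases ha : a < k
      · simp [Splitting.place, ha, ha.trans_le (le_max_left k P.heads)]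
      · by_cases ha' : a < max k P.heads
        · have := (hr a).move_address
          rw [h0 a ha'] at this
          simp only [Splitting.place, ha, ha', dite_false, dite_true, this]
        · simp only [Splitting.place, ha, ha', dite_false]
    rw [e]
    exact hx _
  rcases hP w with h | h
  · obtain ⟨x, ⟨hx, hx'⟩, h1⟩ := (key.and_eventually (h S)).exists
    exact iff_of_true (hx'.1 (h1 hx)) h
  · obtain ⟨x, ⟨hx, hx'⟩, h1⟩ := (key.and_eventually (h S)).exists
    refine iff_of_false (fun hA => h1 hx (hx'.2 hA)) fun hw => ?_
    -- Otherwise the execution would be both true and false on entry points that do not form a null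
    -- set.
    obtain ⟨x, ⟨hx, hx'⟩, h1, h2⟩ := (key.and_eventually ((h S).and (hw S))).exists
    exact h1 hx (h2 hx)

end Program

/-! ### The characterisations -/

theorem characterises_headMicrocosm {i : ℕ∞} (hi : 1 ≤ i) :
    Characterises (headMicrocosm i) (twoWayDFAClass i) := by
  refine Set.ext fun L => ⟨?_, ?_⟩
  · rintro ⟨P, hP, rfl⟩
    obtain ⟨k, hk, A, hki, hA⟩ := Program.exists_circularAutomaton hi hP
    obtain ⟨M, hM⟩ := A.exists_twoWayDFA
    exact ⟨k, Nat.pos_of_ne_zero hk.out, hki, M, Set.ext fun w => (hM w).trans (hA w)⟩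
  · rintro ⟨k, hk, hki, M, rfl⟩
    have : NeZero k := ⟨by omega⟩
    obtain ⟨P, hP, hL⟩ := M.toCircular.exists_program hki
    exact ⟨P, hP, hL.trans (Set.ext fun w => M.accepts_toCircular w)⟩

theorem theorem4 :
    (∀ i : ℕ∞, 1 ≤ i → Characterises (headMicrocosm i) (twoWayDFAClass i)) ∧
    Characterises (headMicrocosm 1) {L | L.IsRegular} ∧
    Characterises (headMicrocosm ⊤) Logspace := by
  refine ⟨fun i hi => characterises_headMicrocosm hi, ?_, ?_⟩
  · rw [← twoWayDFAClass_one]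
    exact characterises_headMicrocosm le_rfl
  · rw [← twoWayDFAClass_top]
    exact characterises_headMicrocosm le_top
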